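/- Let $a<b$, and consider the initial-boundary value problem $$\partial_t\rho+\tfrac{d}{dx}f(t,x,\rho,\mathcal J\rho)=0 \ \text{ on } \mathbb R^+\times(a,b),\qquad \rho(0,x)=\rho_o(x),\quad \rho(t,a)=\rho_a(t),\quad \rho(t,b)=\rho_b(t),$$ with the nonlocal term $(\mathcal J\rho(t))(x)=\frac1{W(x)}\int_a^b\rho(t,y)\,\omega(y-x)\,dy$, $W(x)=\int_a^b\omega(y-x)\,dy$. Assumptions. ($f$) $f\in C^2(\mathbb R^+\times[a,b]\times\mathbb R\times\mathbb R;\mathbb R)$ and there are $L,C>0$ such that, for all $t\ge0$, $x\in[a,b]$, $\rho,R\in\mathbb R$: $f(t,x,0,R)=0$, $|\partial_\rho f|\le L$, and $|\partial_xf|$, $|\partial_Rf|$, $|\partial^2_{xx}f|$, $|\partial^2_{xR}f|$, $|\partial^2_{RR}f|$ are all $\le C|\rho|$ at $(t,x,\rho,R)$. ($\omega$) $\omega\in (C^2\cap W^{2,1}\cap W^{2,\infty})(\mathbb R;\mathbb R)$, $\int_{\mathbb R}\omega=1$, and there is $K_\omega>0$ with $W(x)\ge K_\omega$ for all $x\in[a,b]$.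 (Data) $\rho_o$ is nonnegative and of bounded variation on $(a,b)$; $\rho_a,\rho_b$ are nonnegative and of bounded variation on $(0,\infty)$. Scheme. Let $\alpha\ge1$, let $N\ge1$ be an integer, $\Delta x=(b-a)/N$, $\Delta t>0$, $\lambda=\Delta t/\Delta x$, $t^n=n\Delta t$, $x_{j+1/2}=a+j\Delta x$, $\omega^k=\omega((k-\frac12)\Delta x)$. Put $\rho_j^0=\frac1{\Delta x}\int_{x_{j-1/2}}^{x_{j+1/2}}\rho_o$ for $1\le j\le N$ and, for $n\ge0$, $\rho_0^n=\frac1{\Delta t}\int_{t^n}^{t^{n+1}}\rho_a$, $\rho_{N+1}^n=\frac1{\Delta t}\int_{t^n}^{t^{n+1}}\rho_b$. For $0\le j\le N$ let $W_{j+1/2}=\Delta x\sum_{k=1}^N\omega^{k-j}$, $R^n_{j+1/2}=\frac{\Delta x}{W_{j+1/2}}\sum_{k=1}^N\omega^{k-j}\rho_k^n$, and $$F^n_{j+1/2}=\tfrac12\big[f(t^n,x_{j+1/2},\rho_j^n,R^n_{j+1/2})+f(t^n,x_{j+1/2},\rho_{j+1}^n,R^n_{j+1/2})-\alpha(\rho_{j+1}^n-\rho_j^n)\big],$$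 and for $n\ge0$, $1\le j\le N$ let $\rho_j^{n+1}=\rho_j^n-\lambda\,(F^n_{j+1/2}-F^n_{j-1/2})$. The approximate solution is $\rho_\Delta(t,x)=\rho^n_j$ for $t\in[t^n,t^{n+1})$, $x\in[x_{j-1/2},x_{j+1/2})$, $1\le j\le N$, $n\ge0$. The CFL condition is $$\alpha\ge L,\qquad \lambda\le\tfrac13\min\Big\{\tfrac1\alpha,\ \tfrac1{2L+C\Delta x}\Big\}.$$ Entropy weak solution (Martin-Vovelle). Let $s^+=\max\{s,0\}$, $s^-=\max\{-s,0\}$; $\operatorname{sgn}^+(s)=1$ if $s>0$ and $0$ otherwise; $\operatorname{sgn}^-(s)=-1$ if $s<0$ and $0$ otherwise. A function $\rho$ on $\mathbb R^+\times(a,b)$ that belongs to $L^\infty((0,T)\times(a,b))$ for every $T>0$ is an entropy weak solution if, with $R(t,x)=(\mathcal J\rho(t))(x)$, for all $\phi\in C^1_c(\mathbb R^2;[0,\infty))$, all $k\in\mathbb R$ and both signs, $$\begin{aligned}&\int_0^\infty\!\!\int_a^b\Big\{(\rho-k)^\pm\partial_t\phi+\operatorname{sgn}^\pm(\rho-k)\big[f(t,x,\rho,R)-f(t,x,k,R)\big]\partial_x\phi\\&\qquad-\operatorname{sgn}^\pm(\rho-k)\big(\partial_xf(t,x,k,R)+\partial_Rf(t,x,k,R)\,\partial_xR\big)\phi\Big\}\,dx\,dt\\&+\int_a^b(\rho_o-k)^\pm\phi(0,x)\,dx+M\Big(\int_0^\infty(\rho_a-k)^\pm\phi(t,a)\,dt+\int_0^\infty(\rho_b-k)^\pm\phi(t,b)\,dt\Big)\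 \ge\ 0,\end{aligned}$$ where $M=\sup\{|\partial_\rho f(t,x,r,R(t,x))| : t>0,\ x\in[a,b],\ r\in\mathbb R\}$. Claim. Fix $\alpha\ge1$ and let $(\Delta x_m,\Delta t_m)_m$ be any sequence of mesh sizes, $\Delta x_m=(b-a)/N_m$, $\Delta t_m>0$, all satisfying the CFL condition, with $\Delta x_m\to0$. Then there are a subsequence and an entropy weak solution $\rho$ such that, along this subsequence, the approximate solutions $\rho_\Delta$ converge to $\rho$ in $L^1((0,T)\times(a,b))$ for every $T>0$. -/

import Mathlib

open MeasureTheory Set Filter Topology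

noncomputable section

namespace NonlocalIBVP

/-! ### Partial derivatives of the flux `f (t, x, ρ, R)`, for `x` in the closed interval `[a, b]`

The derivatives in `x` are one-sided at the end points `a` and `b`. -/

/-- `∂_ρ f (t, x, ρ, R)` -/
def dRho (f : ℝ → ℝ → ℝ → ℝ → ℝ) (t x r R : ℝ) : ℝ :=
  deriv (fun s => f t x s R) r

/-- `∂_R f (t, x, ρ, R)` -/
def dR (f : ℝ → ℝ → ℝ → ℝ → ℝ) (t x r R : ℝ) : ℝ :=
  deriv (fun S => f t x r S) R

/-- `∂_x f (t, x, ρ, R)` -/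
def dX (a b : ℝ) (f : ℝ → ℝ → ℝ → ℝ → ℝ) (t x r R : ℝ) : ℝ :=
  derivWithin (fun y => f t y r R) (Icc a b) x

/-- The flux `f` is of class `C²` on `ℝ⁺ × [a, b] × ℝ × ℝ`, vanishes at `ρ = 0`, and its
derivatives obey the bounds with the constants `L` and `C`. -/
structure FluxAssumption (a b L C : ℝ) (f : ℝ → ℝ → ℝ → ℝ → ℝ) : Prop where
  L_pos : 0 < L
  C_pos : 0 < C
  contDiffOn : ContDiffOn ℝ 2 (fun p : ℝ × ℝ × ℝ × ℝ => f p.1 p.2.1 p.2.2.1 p.2.2.2)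
    (Ici (0 : ℝ) ×ˢ Icc a b ×ˢ (univ : Set ℝ) ×ˢ (univ : Set ℝ))
  zero : ∀ t, 0 ≤ t → ∀ x ∈ Icc a b, ∀ R, f t x 0 R = 0
  bound_rho : ∀ t, 0 ≤ t → ∀ x ∈ Icc a b, ∀ r R, |dRho f t x r R| ≤ L
  bound_x : ∀ t, 0 ≤ t → ∀ x ∈ Icc a b, ∀ r R, |dX a b f t x r R| ≤ C * |r|
  bound_R : ∀ t, 0 ≤ t → ∀ x ∈ Icc a b, ∀ r R, |dR f t x r R| ≤ C * |r|
  bound_xx : ∀ t, 0 ≤ t → ∀ x ∈ Icc a b, ∀ r R,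
    |derivWithin (fun y => dX a b f t y r R) (Icc a b) x| ≤ C * |r|
  bound_xR : ∀ t, 0 ≤ t → ∀ x ∈ Icc a b, ∀ r R,
    |derivWithin (fun y => dR f t y r R) (Icc a b) x| ≤ C * |r|
  bound_RR : ∀ t, 0 ≤ t → ∀ x ∈ Icc a b, ∀ r R,
    |deriv (fun S => dR f t x r S) R| ≤ C * |r|

/-- `W (x) = ∫_a^b ω (y - x) dy` -/
def kernelMass (a b : ℝ) (ω : ℝ → ℝ) (x : ℝ) : ℝ :=
  ∫ y in a..b, ω (y - x)

/-- `ω ∈ C² ∩ W^{2,1} ∩ W^{2,∞}` (for a `C²` function the weak derivatives are the classical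
ones), `∫ ω = 1`, and `W` is bounded below on `[a, b]` by a positive constant. -/
structure KernelAssumption (a b : ℝ) (ω : ℝ → ℝ) : Prop where
  contDiff : ContDiff ℝ 2 ω
  memLp_one : ∀ i : ℕ, i ≤ 2 → MemLp (iteratedDeriv i ω) 1 volume
  memLp_top : ∀ i : ℕ, i ≤ 2 → MemLp (iteratedDeriv i ω) ⊤ volume
  integral_eq_one : ∫ y, ω y = 1
  mass_lower_bound : ∃ K : ℝ, 0 < K ∧ ∀ x ∈ Icc a b, K ≤ kernelMass a b ω x

/-- `u` has bounded variation on `s` as a class of functions modulo equality almost everywhere: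
some representative has finite pointwise total variation on `s`. -/
def EssBoundedVariationOn (u : ℝ → ℝ) (s : Set ℝ) : Prop :=
  ∃ v : ℝ → ℝ, BoundedVariationOn v s ∧ u =ᵐ[volume.restrict s] v

/-- A boundary or initial datum: nonnegative, of bounded variation on `s`. -/
def IsBVDatum (u : ℝ → ℝ) (s : Set ℝ) : Prop :=
  EssBoundedVariationOn u s ∧ ∀ᵐ x ∂(volume.restrict s), 0 ≤ u x

/-! ### Entropy weak solutions -/

/-- The nonlocal operator `R (t, x) = (1 / W (x)) ∫_a^b ρ (t, y) ω (y - x) dy`. -/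
def nonlocalTerm (a b : ℝ) (ω : ℝ → ℝ) (ρ : ℝ → ℝ → ℝ) (t x : ℝ) : ℝ :=
  (1 / kernelMass a b ω x) * ∫ y in a..b, ρ t y * ω (y - x)

/-- `s⁺` -/
def semiPos (s : ℝ) : ℝ := max s 0

/-- `s⁻` -/
def semiNeg (s : ℝ) : ℝ := max (-s) 0

/-- `sgn⁺` -/
def sgnPos (s : ℝ) : ℝ := if 0 < s then 1 else 0

/-- `sgn⁻` -/
def sgnNeg (s : ℝ) : ℝ := if s < 0 then -1 else 0

/-- The Lipschitz constant in `r` of the flux `(t, x, r) ↦ f (t, x, r, R (t, x))`, i.e. the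
supremum of `|∂_ρ f (t, x, r, R (t, x))|` over `t > 0`, `x ∈ [a, b]` and `r ∈ ℝ`. -/
def fluxLip (a b : ℝ) (f : ℝ → ℝ → ℝ → ℝ → ℝ) (R : ℝ → ℝ → ℝ) : ℝ :=
  sSup {m : ℝ | ∃ t x r : ℝ, 0 < t ∧ x ∈ Icc a b ∧ m = |dRho f t x r (R t x)|}

/-- The left-hand side of the entropy inequality, for the semi-entropy `η` (which is `s⁺` or `s⁻`)
and its sign function `sg`, the level `k` and the test function `φ`. -/
def entropyFunctional (a b : ℝ) (f : ℝ → ℝ → ℝ → ℝ → ℝ) (ω ρo ρa ρb : ℝ → ℝ)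
    (η sg : ℝ → ℝ) (ρ : ℝ → ℝ → ℝ) (k : ℝ) (φ : ℝ × ℝ → ℝ) : ℝ :=
  let R := nonlocalTerm a b ω ρ
  (∫ p in Ioi (0 : ℝ) ×ˢ Ioo a b,
      (η (ρ p.1 p.2 - k) * deriv (fun t => φ (t, p.2)) p.1
        + sg (ρ p.1 p.2 - k)
          * (f p.1 p.2 (ρ p.1 p.2) (R p.1 p.2) - f p.1 p.2 k (R p.1 p.2))
          * deriv (fun x => φ (p.1, x)) p.2
        - sg (ρ p.1 p.2 - k)
          * (dX a b f p.1 p.2 k (R p.1 p.2)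
            + dR f p.1 p.2 k (R p.1 p.2) * deriv (fun x => R p.1 x) p.2)
          * φ p))
    + (∫ x in Ioo a b, η (ρo x - k) * φ (0, x))
    + fluxLip a b f R
      * ((∫ t in Ioi (0 : ℝ), η (ρa t - k) * φ (t, a))
        + ∫ t in Ioi (0 : ℝ), η (ρb t - k) * φ (t, b))

/-- Entropy weak solutions in the sense of Martin and Vovelle, on `ℝ⁺ × ]a, b[`: functions that
are essentially bounded on `]0, T[ × ]a, b[` for every `T` and satisfy the entropy inequalities
for both semi-entropies, all levels `k` and all nonnegative test functions in `C_c¹ (ℝ²)`. -/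
structure IsEntropySolution (a b : ℝ) (f : ℝ → ℝ → ℝ → ℝ → ℝ) (ω ρo ρa ρb : ℝ → ℝ)
    (ρ : ℝ → ℝ → ℝ) : Prop where
  memLp : ∀ T : ℝ, 0 < T →
    MemLp (fun p : ℝ × ℝ => ρ p.1 p.2) ⊤ (volume.restrict (Ioo 0 T ×ˢ Ioo a b))
  entropy_pos : ∀ φ : ℝ × ℝ → ℝ, ContDiff ℝ 1 φ → HasCompactSupport φ → (∀ p, 0 ≤ φ p) →
    ∀ k : ℝ, 0 ≤ entropyFunctional a b f ω ρo ρa ρb semiPos sgnPos ρ k φ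
  entropy_neg : ∀ φ : ℝ × ℝ → ℝ, ContDiff ℝ 1 φ → HasCompactSupport φ → (∀ p, 0 ≤ φ p) →
    ∀ k : ℝ, 0 ≤ entropyFunctional a b f ω ρo ρa ρb semiNeg sgnNeg ρ k φ

/-! ### The adapted Lax-Friedrichs scheme

A row `r : ℕ → ℝ` holds the values `r 1, …, r N` of the cells and the boundary values `r 0` and
`r (N + 1)`. The interface `x_{j+1/2} = a + j Δx` has the index `j`. -/

/-- `W_{j+1/2} = Δx ∑_{k=1}^N ω^{k-j}` with `ω^i = ω ((i - 1/2) Δx)` -/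
def discreteMass (ω : ℝ → ℝ) (N : ℕ) (Δx : ℝ) (j : ℕ) : ℝ :=
  Δx * ∑ k ∈ Finset.Icc 1 N, ω (((k : ℝ) - (j : ℝ) - 1 / 2) * Δx)

/-- `R_{j+1/2} = (Δx / W_{j+1/2}) ∑_{k=1}^N ω^{k-j} ρ_k` -/
def discreteNonlocal (ω : ℝ → ℝ) (N : ℕ) (Δx : ℝ) (r : ℕ → ℝ) (j : ℕ) : ℝ :=
  Δx / discreteMass ω N Δx j
    * ∑ k ∈ Finset.Icc 1 N, ω (((k : ℝ) - (j : ℝ) - 1 / 2) * Δx) * r k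

/-- The numerical flux `F_{j+1/2} (ρ_j, ρ_{j+1})` at time `t` -/
def numFlux (a : ℝ) (f : ℝ → ℝ → ℝ → ℝ → ℝ) (ω : ℝ → ℝ) (α : ℝ) (N : ℕ) (Δx t : ℝ)
    (r : ℕ → ℝ) (j : ℕ) : ℝ :=
  1 / 2 * (f t (a + j * Δx) (r j) (discreteNonlocal ω N Δx r j)
    + f t (a + j * Δx) (r (j + 1)) (discreteNonlocal ω N Δx r j)
    - α * (r (j + 1) - r j))

/-- The mean of the datum `u` over the time step `[n Δt, (n + 1) Δt]` -/
def timeMean (u : ℝ → ℝ) (Δt : ℝ) (n : ℕ) : ℝ :=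
  1 / Δt * ∫ t in (n * Δt)..((n + 1) * Δt), u t

/-- The value `ρ_j^n`, for `0 ≤ j ≤ N + 1`, of the scheme with `N` cells of length
`Δx = (b - a) / N` and time step `Δt`. -/
def scheme (a b : ℝ) (f : ℝ → ℝ → ℝ → ℝ → ℝ) (ω ρo ρa ρb : ℝ → ℝ) (α : ℝ) (N : ℕ) (Δt : ℝ) :
    ℕ → ℕ → ℝ
  | 0, j =>
      if j = 0 then timeMean ρa Δt 0
      else if N < j then timeMean ρb Δt 0
      else 1 / ((b - a) / N)
        * ∫ x in (a + ((j : ℝ) - 1) * ((b - a) / N))..(a + (j : ℝ) * ((b - a) / N)), ρo x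
  | n + 1, j =>
      if j = 0 then timeMean ρa Δt (n + 1)
      else if N < j then timeMean ρb Δt (n + 1)
      else scheme a b f ω ρo ρa ρb α N Δt n j
        - Δt / ((b - a) / N)
          * (numFlux a f ω α N ((b - a) / N) (n * Δt) (scheme a b f ω ρo ρa ρb α N Δt n) j
            - numFlux a f ω α N ((b - a) / N) (n * Δt)
                (scheme a b f ω ρo ρa ρb α N Δt n) (j - 1))

/-- The piecewise constant approximate solution: `ρ_Δ (t, x) = ρ_j^n` for `t ∈ [t^n, t^{n+1}[` and
`x ∈ [x_{j-1/2}, x_{j+1/2}[`, where `t ≥ 0` and `x ∈ [a, b[`. -/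
def approxSolution (a b : ℝ) (f : ℝ → ℝ → ℝ → ℝ → ℝ) (ω ρo ρa ρb : ℝ → ℝ) (α : ℝ) (N : ℕ)
    (Δt : ℝ) (t x : ℝ) : ℝ :=
  scheme a b f ω ρo ρa ρb α N Δt ⌊t / Δt⌋₊ (⌊(x - a) / ((b - a) / N)⌋₊ + 1)

/-- The CFL condition: `α ≥ L` and `Δt / Δx ≤ (1/3) min {1 / α, 1 / (2 L + C Δx)}`. -/
def CFL (L C α Δx Δt : ℝ) : Prop :=
  L ≤ α ∧ Δt / Δx ≤ 1 / 3 * min (1 / α) (1 / (2 * L + C * Δx))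

end NonlocalIBVP

end

namespace NonlocalIBVP

/-! ### The flux -/

/-- The domain `ℝ⁺ × [a, b] × ℝ × ℝ` of the flux. -/
def fluxDomain (a b : ℝ) : Set (ℝ × ℝ × ℝ × ℝ) :=
  Ici (0 : ℝ) ×ˢ Icc a b ×ˢ (univ : Set ℝ) ×ˢ (univ : Set ℝ)

theorem uniqueDiffOn_fluxDomain {a b : ℝ} (hab : a < b) :
    UniqueDiffOn ℝ (fluxDomain a b) :=
  (uniqueDiffOn_Ici 0).prod ((uniqueDiffOn_Icc hab).prod (uniqueDiffOn_univ.prod uniqueDiffOn_univ))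

/-- The flux as a function on the product space. -/
def uncurryFlux (f : ℝ → ℝ → ℝ → ℝ → ℝ) (p : ℝ × ℝ × ℝ × ℝ) : ℝ := f p.1 p.2.1 p.2.2.1 p.2.2.2

/-- The retraction of `ℝ⁴` onto the domain of the flux. -/
noncomputable def clampDomain (a b : ℝ) (p : ℝ × ℝ × ℝ × ℝ) : ℝ × ℝ × ℝ × ℝ :=
  (max p.1 0, max a (min b p.2.1), p.2.2.1, p.2.2.2)

theorem continuous_clampDomain (a b : ℝ) : Continuous (clampDomain a b) := by
  unfold clampDomain; fun_prop

theorem clampDomain_mem {a b : ℝ} (hab : a < b) (p : ℝ × ℝ × ℝ × ℝ) :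
    clampDomain a b p ∈ fluxDomain a b := by
  refine ⟨mem_Ici.2 (le_max_right _ _), ⟨le_max_left _ _, max_le hab.le (min_le_left _ _)⟩, trivial, trivial⟩

theorem clampDomain_eq {a b t x r R : ℝ} (ht : 0 ≤ t) (hx : x ∈ Icc a b) :
    clampDomain a b (t, x, r, R) = (t, x, r, R) := by
  simp [clampDomain, max_eq_left ht, min_eq_right hx.2, max_eq_right hx.1]

variable {a b L C : ℝ} {f : ℝ → ℝ → ℝ → ℝ → ℝ}

theorem FluxAssumption.hasFDerivWithinAt (hf : FluxAssumption a b L C f) {p : ℝ × ℝ × ℝ × ℝ}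
    (hp : p ∈ fluxDomain a b) :
    HasFDerivWithinAt (uncurryFlux f) (fderivWithin ℝ (uncurryFlux f) (fluxDomain a b) p)
      (fluxDomain a b) p :=
  ((hf.contDiffOn.differentiableOn (by norm_num)) p hp).hasFDerivWithinAt

theorem FluxAssumption.hasDerivAt_rho (hf : FluxAssumption a b L C f) {t x : ℝ} (ht : 0 ≤ t)
    (hx : x ∈ Icc a b) (r R : ℝ) : HasDerivAt (fun s => f t x s R) (dRho f t x r R) r := by
  have h1 := (hf.hasFDerivWithinAt (p := (t, x, r, R)) ⟨ht, hx, trivial, trivial⟩)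
  have h2 : HasDerivWithinAt (fun s : ℝ => ((t, x, s, R) : ℝ × ℝ × ℝ × ℝ)) (0, 0, 1, 0) univ r :=
    (hasDerivWithinAt_const _ _ _).prodMk ((hasDerivWithinAt_const _ _ _).prodMk
      ((hasDerivWithinAt_id _ _).prodMk (hasDerivWithinAt_const _ _ _)))
  have h3 := h1.comp_hasDerivWithinAt (t := fluxDomain a b) r h2
    (fun s _ => ⟨ht, hx, trivial, trivial⟩)
  rw [hasDerivWithinAt_univ] at h3
  exact h3.differentiableAt.hasDerivAt

theorem FluxAssumption.hasDerivAt_R' (hf : FluxAssumption a b L C f) {t x : ℝ} (ht : 0 ≤ t)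
    (hx : x ∈ Icc a b) (r R : ℝ) : HasDerivAt (fun S => f t x r S)
      (fderivWithin ℝ (uncurryFlux f) (fluxDomain a b) (t, x, r, R) (0, 0, 0, 1)) R := by
  have h1 := (hf.hasFDerivWithinAt (p := (t, x, r, R)) ⟨ht, hx, trivial, trivial⟩)
  have h2 : HasDerivWithinAt (fun s : ℝ => ((t, x, r, s) : ℝ × ℝ × ℝ × ℝ)) (0, 0, 0, 1) univ R :=
    (hasDerivWithinAt_const _ _ _).prodMk ((hasDerivWithinAt_const _ _ _).prodMk
      ((hasDerivWithinAt_const _ _ _).prodMk (hasDerivWithinAt_id _ _)))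
  have h3 := h1.comp_hasDerivWithinAt (t := fluxDomain a b) R h2
    (fun s _ => ⟨ht, hx, trivial, trivial⟩)
  rwa [hasDerivWithinAt_univ] at h3

theorem FluxAssumption.dR_eq (hf : FluxAssumption a b L C f) {t x : ℝ} (ht : 0 ≤ t)
    (hx : x ∈ Icc a b) (r R : ℝ) : dR f t x r R =
      fderivWithin ℝ (uncurryFlux f) (fluxDomain a b) (t, x, r, R) (0, 0, 0, 1) :=
  (hf.hasDerivAt_R' ht hx r R).deriv

theorem FluxAssumption.hasDerivAt_R (hf : FluxAssumption a b L C f) {t x : ℝ} (ht : 0 ≤ t)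
    (hx : x ∈ Icc a b) (r R : ℝ) : HasDerivAt (fun S => f t x r S) (dR f t x r R) R := by
  rw [hf.dR_eq ht hx]; exact hf.hasDerivAt_R' ht hx r R

theorem FluxAssumption.hasDerivWithinAt_X' (hf : FluxAssumption a b L C f) {t x : ℝ} (ht : 0 ≤ t)
    (hx : x ∈ Icc a b) (r R : ℝ) : HasDerivWithinAt (fun y => f t y r R)
      (fderivWithin ℝ (uncurryFlux f) (fluxDomain a b) (t, x, r, R) (0, 1, 0, 0)) (Icc a b) x := by
  have h1 := (hf.hasFDerivWithinAt (p := (t, x, r, R)) ⟨ht, hx, trivial, trivial⟩)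
  have h2 : HasDerivWithinAt (fun s : ℝ => ((t, s, r, R) : ℝ × ℝ × ℝ × ℝ)) (0, 1, 0, 0)
      (Icc a b) x :=
    (hasDerivWithinAt_const _ _ _).prodMk ((hasDerivWithinAt_id _ _).prodMk
      ((hasDerivWithinAt_const _ _ _).prodMk (hasDerivWithinAt_const _ _ _)))
  exact h1.comp_hasDerivWithinAt (t := fluxDomain a b) x h2
    (fun s hs => ⟨ht, hs, trivial, trivial⟩)

theorem FluxAssumption.dX_eq (hf : FluxAssumption a b L C f) (hab : a < b) {t x : ℝ} (ht : 0 ≤ t)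
    (hx : x ∈ Icc a b) (r R : ℝ) : dX a b f t x r R =
      fderivWithin ℝ (uncurryFlux f) (fluxDomain a b) (t, x, r, R) (0, 1, 0, 0) :=
  (hf.hasDerivWithinAt_X' ht hx r R).derivWithin (uniqueDiffOn_Icc hab x hx)

theorem FluxAssumption.hasDerivWithinAt_X (hf : FluxAssumption a b L C f) (hab : a < b) {t x : ℝ}
    (ht : 0 ≤ t) (hx : x ∈ Icc a b) (r R : ℝ) :
    HasDerivWithinAt (fun y => f t y r R) (dX a b f t x r R) (Icc a b) x := by
  rw [hf.dX_eq hab ht hx]; exact hf.hasDerivWithinAt_X' ht hx r R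

theorem FluxAssumption.continuous_clamp (hf : FluxAssumption a b L C f) (hab : a < b) :
    Continuous (fun p => uncurryFlux f (clampDomain a b p)) :=
  hf.contDiffOn.continuousOn.comp_continuous (continuous_clampDomain a b) (clampDomain_mem hab)

theorem FluxAssumption.continuous_fderivWithin_clamp (hf : FluxAssumption a b L C f) (hab : a < b)
    (v : ℝ × ℝ × ℝ × ℝ) : Continuous (fun p =>
      fderivWithin ℝ (uncurryFlux f) (fluxDomain a b) (clampDomain a b p) v) := by
  have h := (hf.contDiffOn.continuousOn_fderivWithin (uniqueDiffOn_fluxDomain hab)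
    (by norm_num)).comp_continuous (continuous_clampDomain a b) (clampDomain_mem hab)
  exact h.clm_apply continuous_const

theorem FluxAssumption.continuous_dX_clamp (hf : FluxAssumption a b L C f) (hab : a < b) :
    Continuous (fun p => uncurryFlux (dX a b f) (clampDomain a b p)) := by
  convert hf.continuous_fderivWithin_clamp hab (0, 1, 0, 0) using 2 with p
  exact hf.dX_eq hab (clampDomain_mem hab p).1 (clampDomain_mem hab p).2.1 _ _

theorem FluxAssumption.continuous_dR_clamp (hf : FluxAssumption a b L C f) (hab : a < b) :
    Continuous (fun p => uncurryFlux (dR f) (clampDomain a b p)) := by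
  convert hf.continuous_fderivWithin_clamp hab (0, 0, 0, 1) using 2 with p
  exact hf.dR_eq (clampDomain_mem hab p).1 (clampDomain_mem hab p).2.1 _ _

theorem tendsto_of_continuous_clamp {g : ℝ → ℝ → ℝ → ℝ → ℝ}
    (hg : Continuous (fun p => uncurryFlux g (clampDomain a b p))) {ι : Type*} {l : Filter ι}
    {T X r R : ι → ℝ} {t x u S : ℝ} (hT : ∀ i, 0 ≤ T i) (hX : ∀ i, X i ∈ Icc a b) (ht : 0 ≤ t)
    (hx : x ∈ Icc a b)
    (h1 : Tendsto T l (𝓝 t)) (h2 : Tendsto X l (𝓝 x)) (h3 : Tendsto r l (𝓝 u))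
    (h4 : Tendsto R l (𝓝 S)) :
    Tendsto (fun i => g (T i) (X i) (r i) (R i)) l (𝓝 (g t x u S)) := by
  have h := (hg.tendsto (t, x, u, S)).comp
    (h1.prodMk_nhds (h2.prodMk_nhds (h3.prodMk_nhds h4)))
  rw [clampDomain_eq ht hx] at h
  refine h.congr fun i => ?_
  simp only [Function.comp, clampDomain_eq (hT i) (hX i)]
  rfl

theorem FluxAssumption.abs_sub_le_of_dRho_le (hf : FluxAssumption a b L C f) {t x : ℝ} (ht : 0 ≤ t)
    (hx : x ∈ Icc a b) {M R : ℝ} (hM : ∀ r, |dRho f t x r R| ≤ M) (r r' : ℝ) :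
    |f t x r R - f t x r' R| ≤ M * |r - r'| := by
  have := Convex.norm_image_sub_le_of_norm_hasDerivWithin_le (f := fun s => f t x s R)
    (f' := fun s => dRho f t x s R) (s := univ) (C := M) (x := r') (y := r)
    (fun s _ => (hf.hasDerivAt_rho ht hx s R).hasDerivWithinAt)
    (fun s _ => hM s) convex_univ trivial trivial
  simpa using this

theorem FluxAssumption.abs_sub_le (hf : FluxAssumption a b L C f) {t x : ℝ} (ht : 0 ≤ t)
    (hx : x ∈ Icc a b) (r r' R : ℝ) : |f t x r R - f t x r' R| ≤ L * |r - r'| :=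
  hf.abs_sub_le_of_dRho_le ht hx (fun r => hf.bound_rho t ht x hx r R) r r'

theorem FluxAssumption.abs_le (hf : FluxAssumption a b L C f) {t x : ℝ} (ht : 0 ≤ t)
    (hx : x ∈ Icc a b) (r R : ℝ) : |f t x r R| ≤ L * |r| := by
  simpa [hf.zero t ht x hx R] using hf.abs_sub_le ht hx r 0 R

theorem FluxAssumption.abs_sub_le_xR (hf : FluxAssumption a b L C f) (hab : a < b) {t x x' : ℝ}
    (ht : 0 ≤ t) (hx : x ∈ Icc a b) (hx' : x' ∈ Icc a b) (r R R' : ℝ) :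
    |f t x' r R' - f t x r R| ≤ C * |r| * (|x' - x| + |R' - R|) := by
  have h1 := Convex.norm_image_sub_le_of_norm_hasDerivWithin_le (f := fun S => f t x r S)
    (f' := fun S => dR f t x r S) (s := univ) (C := C * |r|) (x := R) (y := R')
    (fun s _ => (hf.hasDerivAt_R ht hx r s).hasDerivWithinAt)
    (fun s _ => hf.bound_R t ht x hx r s) convex_univ trivial trivial
  have h2 := Convex.norm_image_sub_le_of_norm_hasDerivWithin_le (f := fun y => f t y r R')
    (f' := fun y => dX a b f t y r R') (s := Icc a b) (C := C * |r|) (x := x) (y := x')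
    (fun s hs => hf.hasDerivWithinAt_X hab ht hs r R')
    (fun s hs => hf.bound_x t ht s hs r R') (convex_Icc a b) hx hx'
  simp only [Real.norm_eq_abs] at h1 h2
  calc _ = |(f t x' r R' - f t x r R') + (f t x r R' - f t x r R)| := by ring_nf
    _ ≤ _ := abs_add_le _ _
    _ ≤ _ := by linarith

/-- The difference quotient of the flux along `x` and `R` converges to the total derivative. -/
theorem FluxAssumption.tendsto_diffQuotient (hf : FluxAssumption a b L C f) (hab : a < b)
    {T X X' R R' h : ℕ → ℝ} {t x S S' k : ℝ}
    (hT : ∀ i, 0 ≤ T i) (hX : ∀ i, X i ∈ Icc a b) (hX' : ∀ i, X' i ∈ Icc a b) (ht : 0 ≤ t)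
    (hx : x ∈ Icc a b) (h1 : Tendsto T atTop (𝓝 t)) (h2 : Tendsto X atTop (𝓝 x))
    (h2' : Tendsto X' atTop (𝓝 x)) (h3 : Tendsto R atTop (𝓝 S)) (h3' : Tendsto R' atTop (𝓝 S))
    (h4 : ∀ i, X' i - X i = h i) (hpos : ∀ i, 0 < h i)
    (h5 : Tendsto (fun i => (R' i - R i) / h i) atTop (𝓝 S')) :
    Tendsto (fun i => (f (T i) (X' i) k (R' i) - f (T i) (X i) k (R i)) / h i) atTop
      (𝓝 (dX a b f t x k S + dR f t x k S * S')) := by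
  have e1 : ∀ i, ∃ ξ ∈ Icc (X i) (X' i),
      f (T i) (X' i) k (R' i) - f (T i) (X i) k (R' i)
        = dX a b f (T i) ξ k (R' i) * h i := by
    intro i
    have hlt : X i < X' i := by linarith [h4 i, hpos i]
    have hsub : Icc (X i) (X' i) ⊆ Icc a b := Icc_subset_Icc (hX i).1 (hX' i).2
    obtain ⟨ξ, hξ, e⟩ := exists_hasDerivAt_eq_slope (fun y => f (T i) y k (R' i))
      (fun y => dX a b f (T i) y k (R' i)) hlt
      (fun y hy => ((hf.hasDerivWithinAt_X hab (hT i) (hsub hy) k _).continuousWithinAt).mono hsub)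
      (fun y hy => (hf.hasDerivWithinAt_X hab (hT i) (hsub (Ioo_subset_Icc_self hy)) k _).hasDerivAt
        (Icc_mem_nhds ((hX i).1.trans_lt hy.1) (hy.2.trans_le (hX' i).2)))
    refine ⟨ξ, Ioo_subset_Icc_self hξ, ?_⟩
    rw [e, h4 i, div_mul_cancel₀ _ (hpos i).ne']
  have e2 : ∀ i, ∃ θ ∈ uIcc (R i) (R' i),
      f (T i) (X i) k (R' i) - f (T i) (X i) k (R i)
        = dR f (T i) (X i) k θ * (R' i - R i) := by
    intro i
    have key : ∀ u v : ℝ, u < v → ∃ θ ∈ Icc u v,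
        f (T i) (X i) k v - f (T i) (X i) k u = dR f (T i) (X i) k θ * (v - u) := by
      intro u v huv
      obtain ⟨θ, hθ, e⟩ := exists_hasDerivAt_eq_slope (fun y => f (T i) (X i) k y)
        (fun y => dR f (T i) (X i) k y) huv
        (fun y _ => (hf.hasDerivAt_R (hT i) (hX i) k y).continuousAt.continuousWithinAt)
        (fun y _ => hf.hasDerivAt_R (hT i) (hX i) k y)
      exact ⟨θ, Ioo_subset_Icc_self hθ, by
        rw [e, div_mul_cancel₀ _ (sub_pos.2 huv).ne']⟩
    rcases lt_trichotomy (R i) (R' i) with hlt | heq | hgt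
    · rw [uIcc_of_le hlt.le]; exact key _ _ hlt
    · exact ⟨R i, left_mem_uIcc, by simp [heq]⟩
    · obtain ⟨θ, hθ, e⟩ := key _ _ hgt
      rw [uIcc_of_ge hgt.le]; exact ⟨θ, hθ, by linarith⟩
  choose ξ hξ eξ using e1
  choose θ hθ eθ using e2
  have hξlim : Tendsto ξ atTop (𝓝 x) :=
    tendsto_of_tendsto_of_tendsto_of_le_of_le h2 h2' (fun i => (hξ i).1) (fun i => (hξ i).2)
  have hθlim : Tendsto θ atTop (𝓝 S) := by
    have a1 : Tendsto (fun i => min (R i) (R' i)) atTop (𝓝 S) := by simpa using h3.min h3'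
    have a2 : Tendsto (fun i => max (R i) (R' i)) atTop (𝓝 S) := by simpa using h3.max h3'
    exact tendsto_of_tendsto_of_tendsto_of_le_of_le a1 a2 (fun i => (hθ i).1) (fun i => (hθ i).2)
  have l1 := tendsto_of_continuous_clamp (hf.continuous_dX_clamp hab) hT
    (fun i => Icc_subset_Icc (hX i).1 (hX' i).2 (hξ i)) ht hx h1 hξlim
    (tendsto_const_nhds (x := k)) h3'
  have l2 := tendsto_of_continuous_clamp (hf.continuous_dR_clamp hab) hT hX ht hx h1 h2
    (tendsto_const_nhds (x := k)) hθlim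
  refine (l1.add (l2.mul h5)).congr fun i => ?_
  have : f (T i) (X' i) k (R' i) - f (T i) (X i) k (R i)
    = dX a b f (T i) (ξ i) k (R' i) * h i + dR f (T i) (X i) k (θ i) * (R' i - R i) := by
    rw [← eξ, ← eθ]; ring
  have hne := (hpos i).ne'
  rw [this]; field_simp

theorem four_point_of_lipschitz_fderivWithin {E : Type*} [NormedAddCommGroup E] [NormedSpace ℝ E]
    {F : E → ℝ} {F' : E → E →L[ℝ] ℝ} {K : Set E} (hK : Convex ℝ K)
    (hF : ∀ p ∈ K, HasFDerivWithinAt F (F' p) K p) {Λ : ℝ}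
    (hΛ : ∀ p ∈ K, ∀ q ∈ K, ‖F' p - F' q‖ ≤ Λ * ‖p - q‖) {p e d : E} (h0 : p ∈ K)
    (h1 : p + e ∈ K) (h2 : p + d ∈ K) (h3 : p + e + d ∈ K) :
    |F (p + e + d) - F (p + e) - F (p + d) + F p| ≤ Λ * ‖e‖ * ‖d‖ := by
  have m1 : ∀ s ∈ Icc (0 : ℝ) 1, p + s • d ∈ K := fun s hs => by
    simpa using hK.add_smul_mem h0 h2 hs
  have m2 : ∀ s ∈ Icc (0 : ℝ) 1, p + e + s • d ∈ K := fun s hs => by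
    simpa using hK.add_smul_mem h1 h3 hs
  have hc : ∀ (q : E) (s : ℝ), HasDerivWithinAt (fun s : ℝ => q + s • d) d (Icc 0 1) s := by
    intro q s
    simpa using ((hasDerivAt_id s).smul_const d).hasDerivWithinAt.const_add q
  have hd : ∀ s ∈ Icc (0 : ℝ) 1, HasDerivWithinAt (fun s : ℝ => F (p + e + s • d) - F (p + s • d))
      (F' (p + e + s • d) d - F' (p + s • d) d) (Icc 0 1) s := fun s hs =>
    ((hF _ (m2 s hs)).comp_hasDerivWithinAt s (hc _ s) m2).sub
      ((hF _ (m1 s hs)).comp_hasDerivWithinAt s (hc _ s) m1)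
  have hb : ∀ s ∈ Icc (0 : ℝ) 1, ‖F' (p + e + s • d) d - F' (p + s • d) d‖ ≤ Λ * ‖e‖ * ‖d‖ := by
    intro s hs
    rw [← sub_apply]
    refine (ContinuousLinearMap.le_opNorm _ _).trans ?_
    gcongr
    refine (hΛ _ (m2 s hs) _ (m1 s hs)).trans_eq ?_
    congr 2; abel
  have := (convex_Icc (0 : ℝ) 1).norm_image_sub_le_of_norm_hasDerivWithin_le hd hb
    (left_mem_Icc.2 zero_le_one) (right_mem_Icc.2 zero_le_one)
  simp only [one_smul, zero_smul, add_zero, sub_zero, norm_one, mul_one, Real.norm_eq_abs] at this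
  convert this using 2; ring

theorem FluxAssumption.exists_four_point (hf : FluxAssumption a b L C f) (hab : a < b)
    (T M B : ℝ) (hT : 0 < T) (hM : 0 < M) (hB : 0 < B) :
    ∃ Λ : ℝ, 0 ≤ Λ ∧ ∀ p e d : ℝ × ℝ × ℝ × ℝ,
      p ∈ Icc 0 T ×ˢ Icc a b ×ˢ Icc (-M) M ×ˢ Icc (-B) B →
      p + e ∈ Icc 0 T ×ˢ Icc a b ×ˢ Icc (-M) M ×ˢ Icc (-B) B →
      p + d ∈ Icc 0 T ×ˢ Icc a b ×ˢ Icc (-M) M ×ˢ Icc (-B) B →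
      p + e + d ∈ Icc 0 T ×ˢ Icc a b ×ˢ Icc (-M) M ×ˢ Icc (-B) B →
      |uncurryFlux f (p + e + d) - uncurryFlux f (p + e) - uncurryFlux f (p + d)
        + uncurryFlux f p| ≤ Λ * ‖e‖ * ‖d‖ := by
  set K : Set (ℝ × ℝ × ℝ × ℝ) := Icc 0 T ×ˢ Icc a b ×ˢ Icc (-M) M ×ˢ Icc (-B) B with hK
  have hconv : Convex ℝ K :=
    (convex_Icc _ _).prod ((convex_Icc _ _).prod ((convex_Icc _ _).prod (convex_Icc _ _)))
  have hcomp : IsCompact K :=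
    isCompact_Icc.prod (isCompact_Icc.prod (isCompact_Icc.prod isCompact_Icc))
  have huniq : UniqueDiffOn ℝ K :=
    (uniqueDiffOn_Icc hT).prod ((uniqueDiffOn_Icc hab).prod
      ((uniqueDiffOn_Icc (by linarith)).prod (uniqueDiffOn_Icc (by linarith))))
  have hsub : K ⊆ fluxDomain a b :=
    prod_mono Icc_subset_Ici_self (prod_mono le_rfl (prod_mono (subset_univ _) (subset_univ _)))
  have hcd : ContDiffOn ℝ 2 (uncurryFlux f) K := hf.contDiffOn.mono hsub
  have hcd' : ContDiffOn ℝ 1 (fderivWithin ℝ (uncurryFlux f) K) K :=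
    hcd.fderivWithin huniq (by norm_num)
  obtain ⟨B', hB'⟩ := hcomp.exists_bound_of_continuousOn
    (hcd'.continuousOn_fderivWithin huniq (by norm_num))
  refine ⟨max B' 0, le_max_right _ _, fun p e d h0 h1 h2 h3 => ?_⟩
  refine four_point_of_lipschitz_fderivWithin hconv
    (fun p hp => ((hcd.differentiableOn (by norm_num)) p hp).hasFDerivWithinAt)
    (fun p hp q hq => ?_) h0 h1 h2 h3
  exact hconv.norm_image_sub_le_of_norm_hasFDerivWithin_le
    (fun q hq => ((hcd'.differentiableOn (by norm_num)) q hq).hasFDerivWithinAt)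
    (fun q hq => (hB' q hq).trans (le_max_left _ _)) hq hp


/-! ### Integrals of piecewise constant functions -/

theorem floor_cell {a h y : ℝ} (hh : 0 < h) {i : ℕ} (hy : y ∈ Ico (a + i * h) (a + (i + 1) * h)) :
    ⌊(y - a) / h⌋₊ = i := by
  rw [Nat.floor_eq_iff (div_nonneg (by nlinarith [hy.1, (Nat.cast_nonneg i : (0 : ℝ) ≤ i)]) hh.le)]
  constructor
  · rw [le_div_iff₀ hh]; linarith [hy.1]
  · rw [div_lt_iff₀ hh]; linarith [hy.2]

theorem integral_comp_floor_cell {a h : ℝ} (hh : 0 < h) (c : ℕ → ℝ) (i : ℕ) :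
    IntervalIntegrable (fun y => c ⌊(y - a) / h⌋₊) volume (a + i * h) (a + (i + 1 : ℕ) * h) ∧
    ∫ y in (a + i * h)..(a + (i + 1 : ℕ) * h), c ⌊(y - a) / h⌋₊ = h * c i := by
  have hle : a + i * h ≤ a + (i + 1 : ℕ) * h := by push_cast; nlinarith
  have heq : EqOn (fun _ => c i) (fun y => c ⌊(y - a) / h⌋₊)
      (Ioo (a + i * h) (a + (i + 1 : ℕ) * h)) := by
    intro y hy
    simp only
    rw [floor_cell hh (i := i)]
    push_cast at hy
    exact Ioo_subset_Ico_self hy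
  have hae : ∀ᵐ y ∂(volume.restrict (uIoc (a + i * h) (a + (i + 1 : ℕ) * h))),
      c i = c ⌊(y - a) / h⌋₊ := by
    rw [uIoc_of_le hle, ← restrict_Ioo_eq_restrict_Ioc]
    exact (ae_restrict_iff' measurableSet_Ioo).2 (Eventually.of_forall heq)
  refine ⟨(intervalIntegrable_const (c := c i)).congr_ae hae, ?_⟩
  rw [← intervalIntegral.integral_congr_ae_restrict hae, intervalIntegral.integral_const]
  push_cast
  simp only [smul_eq_mul]
  ring

theorem integral_comp_floor {a b h : ℝ} {N : ℕ} (hh : 0 < h) (hN : N * h = b - a) (c : ℕ → ℝ) :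
    IntervalIntegrable (fun y => c ⌊(y - a) / h⌋₊) volume a b ∧
    ∫ y in a..b, c ⌊(y - a) / h⌋₊ = h * ∑ i ∈ Finset.range N, c i := by
  have e := intervalIntegral.sum_integral_adjacent_intervals (μ := volume)
    (f := fun y => c ⌊(y - a) / h⌋₊)
    (a := fun i : ℕ => a + i * h) (n := N) (fun i _ => (integral_comp_floor_cell hh c i).1)
  have e' := IntervalIntegrable.trans_iterate (μ := volume) (f := fun y => c ⌊(y - a) / h⌋₊)
    (a := fun i : ℕ => a + i * h) (n := N) (fun i _ => (integral_comp_floor_cell hh c i).1)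
  have hb : a + N * h = b := by linarith
  simp only [Nat.cast_zero, zero_mul, add_zero, hb] at e e'
  refine ⟨e', ?_⟩
  rw [← e, Finset.mul_sum]
  exact Finset.sum_congr rfl fun i _ => (integral_comp_floor_cell hh c i).2

theorem sum_Icc_one_eq_range (g : ℕ → ℝ) (N : ℕ) :
    ∑ k ∈ Finset.Icc 1 N, g k = ∑ i ∈ Finset.range N, g (i + 1) := by
  rw [Finset.range_eq_Ico, Finset.sum_Ico_add' g 0 N 1]
  rfl

theorem sum_Icc_eq_integral {a b h : ℝ} {N : ℕ} (hh : 0 < h) (hN : N * h = b - a) (g : ℕ → ℝ) :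
    h * ∑ k ∈ Finset.Icc 1 N, g k = ∫ y in a..b, g (⌊(y - a) / h⌋₊ + 1) := by
  rw [sum_Icc_one_eq_range, (integral_comp_floor hh hN fun i => g (i + 1)).2]

theorem intervalIntegrable_comp_floor_succ {a b h : ℝ} {N : ℕ} (hh : 0 < h) (hN : N * h = b - a)
    (g : ℕ → ℝ) : IntervalIntegrable (fun y => g (⌊(y - a) / h⌋₊ + 1)) volume a b :=
  (integral_comp_floor hh hN fun i => g (i + 1)).1

/-! ### The kernel -/

/-- `B` bounds the kernel and its derivatives up to order two. -/
structure KernelBound (ω : ℝ → ℝ) (B : ℝ) : Prop where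
  pos : 0 < B
  differentiable : Differentiable ℝ ω
  continuous_deriv : Continuous (deriv ω)
  bound : ∀ s, |ω s| ≤ B
  bound_deriv : ∀ s, |deriv ω s| ≤ B
  lip : ∀ s s', |ω s - ω s'| ≤ B * |s - s'|
  lip_deriv : ∀ s s', |deriv ω s - deriv ω s'| ≤ B * |s - s'|
  second : ∀ s d, |ω (s + d + d) - ω (s + d) - ω (s + d) + ω s| ≤ B * |d| * |d|
  taylor : ∀ s d, |ω (s + d) - ω s - deriv ω s * d| ≤ B * |d| * |d|

theorem Continuous.exists_bound_of_memLp_top {g : ℝ → ℝ} (hg : Continuous g)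
    (h : MemLp g ⊤ volume) : ∃ B, ∀ s, |g s| ≤ B := by
  refine ⟨(eLpNorm g ⊤ volume).toReal, fun s => ?_⟩
  have hae : ∀ᵐ s, |g s| ≤ (eLpNorm g ⊤ volume).toReal := by
    rw [eLpNorm_exponent_top]
    filter_upwards [ae_le_eLpNormEssSup (f := g) (μ := volume)] with s hs
    have hfin : eLpNormEssSup g volume ≠ ⊤ := by
      rw [← eLpNorm_exponent_top]; exact h.2.ne
    have := (ENNReal.toReal_le_toReal (by simp) hfin).2 hs
    simpa using this
  have hd := Measure.dense_of_ae hae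
  have hcl : IsClosed {s | |g s| ≤ (eLpNorm g ⊤ volume).toReal} :=
    isClosed_le hg.abs continuous_const
  have := hcl.closure_eq.symm.trans hd.closure_eq
  exact this.ge (mem_univ s)

theorem KernelAssumption.exists_bound {a b : ℝ} {ω : ℝ → ℝ} (hω : KernelAssumption a b ω) :
    ∃ B, KernelBound ω B := by
  have hd0 : ContDiff ℝ 2 ω := hω.contDiff
  have hd1 : ContDiff ℝ 1 (deriv ω) := by
    have : ContDiff ℝ (1 + 1) ω := by norm_num; exact hd0
    exact (contDiff_succ_iff_deriv.1 this).2.2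
  have hc2 : Continuous (deriv (deriv ω)) := hd1.continuous_deriv (le_refl _)
  obtain ⟨B0, h0⟩ := Continuous.exists_bound_of_memLp_top hd0.continuous
    (by simpa using hω.memLp_top 0 (by norm_num))
  obtain ⟨B1, h1⟩ := Continuous.exists_bound_of_memLp_top hd1.continuous
    (by simpa [iteratedDeriv_one] using hω.memLp_top 1 (by norm_num))
  obtain ⟨B2, h2⟩ := Continuous.exists_bound_of_memLp_top hc2
    (by simpa [iteratedDeriv_succ, iteratedDeriv_zero] using hω.memLp_top 2 (by norm_num))
  set B := max 1 (max B0 (max B1 B2)) with hB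
  have h0' : ∀ s, |ω s| ≤ B := fun s => (h0 s).trans (by simp [hB])
  have h1' : ∀ s, |deriv ω s| ≤ B := fun s => (h1 s).trans (by simp [hB])
  have h2' : ∀ s, |deriv (deriv ω) s| ≤ B := fun s => (h2 s).trans (by simp [hB])
  have hD0 : Differentiable ℝ ω := hd0.differentiable (by norm_num)
  have hD1 : Differentiable ℝ (deriv ω) := hd1.differentiable (by norm_num)
  have hlip1 : ∀ s s', |deriv ω s - deriv ω s'| ≤ B * |s - s'| := fun s s' =>
    convex_univ.norm_image_sub_le_of_norm_deriv_le (fun x _ => hD1 x) (fun x _ => h2' x)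
      (mem_univ s') (mem_univ s)
  have hB0 : 0 < B := lt_of_lt_of_le one_pos (le_max_left _ _)
  refine ⟨B, hB0, hD0, hd1.continuous, h0', h1', fun s s' =>
    convex_univ.norm_image_sub_le_of_norm_deriv_le (fun x _ => hD0 x) (fun x _ => h1' x)
      (mem_univ s') (mem_univ s), hlip1, fun s d => ?_, fun s d => ?_⟩
  · have key := (convex_univ (𝕜 := ℝ) (E := ℝ)).norm_image_sub_le_of_norm_hasDerivWithin_le
      (f := fun y => ω (y + d) - ω y) (f' := fun y => deriv ω (y + d) - deriv ω y) (C := B * |d|)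
      (x := s) (y := s + d)
      (fun y _ => (((hD0 (y + d)).hasDerivAt.comp_add_const y d).sub
        (hD0 y).hasDerivAt).hasDerivWithinAt)
      (fun y _ => by simpa using hlip1 (y + d) y) trivial trivial
    simp only [Real.norm_eq_abs, add_sub_cancel_left] at key
    convert key using 2; ring
  · have key := (convex_uIcc (0 : ℝ) d).norm_image_sub_le_of_norm_hasDerivWithin_le
      (f := fun y => ω (s + y) - deriv ω s * y) (f' := fun y => deriv ω (s + y) - deriv ω s)
      (C := B * |d|) (x := 0) (y := d)
      (fun y _ => (((hD0 (s + y)).hasDerivAt.comp_const_add s y).sub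
        (by simpa using (hasDerivAt_id y).const_mul (deriv ω s))).hasDerivWithinAt)
      (fun y hy => by
        refine (hlip1 (s + y) s).trans ?_
        refine mul_le_mul_of_nonneg_left ?_ hB0.le
        simpa using abs_sub_left_of_mem_uIcc hy)
      left_mem_uIcc right_mem_uIcc
    simp only [Real.norm_eq_abs, add_zero, mul_zero, sub_zero] at key
    convert key using 2; ring

/-- `A_{j+1/2} = Δx ∑_k ω^{k-j} r_k`, the numerator of the discrete nonlocal term. -/
noncomputable def discreteConv (ω : ℝ → ℝ) (N : ℕ) (h : ℝ) (r : ℕ → ℝ) (j : ℕ) : ℝ :=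
  h * ∑ k ∈ Finset.Icc 1 N, ω (((k : ℝ) - (j : ℝ) - 1 / 2) * h) * r k

theorem discreteNonlocal_eq (ω : ℝ → ℝ) (N : ℕ) (h : ℝ) (r : ℕ → ℝ) (j : ℕ) :
    discreteNonlocal ω N h r j = discreteConv ω N h r j / discreteMass ω N h j := by
  unfold discreteNonlocal discreteConv; ring

theorem discreteMass_eq (ω : ℝ → ℝ) (N : ℕ) (h : ℝ) (j : ℕ) :
    discreteMass ω N h j = discreteConv ω N h (fun _ => 1) j := by
  simp [discreteMass, discreteConv]

theorem abs_mul_sum_mul_le {h B : ℝ} (hh : 0 ≤ h) {s : Finset ℕ} {c r : ℕ → ℝ}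
    (hc : ∀ k ∈ s, |c k| ≤ B) : |h * ∑ k ∈ s, c k * r k| ≤ B * (h * ∑ k ∈ s, |r k|) := by
  rw [abs_mul, abs_of_nonneg hh]
  calc h * |∑ k ∈ s, c k * r k| ≤ h * ∑ k ∈ s, B * |r k| := by
        gcongr
        refine (Finset.abs_sum_le_sum_abs _ _).trans (Finset.sum_le_sum fun k hk => ?_)
        rw [abs_mul]; gcongr; exact hc k hk
    _ = _ := by rw [← Finset.mul_sum]; ring

section DiscreteBounds
variable {ω : ℝ → ℝ} {B h : ℝ} (hB : KernelBound ω B) (hh : 0 ≤ h) (N : ℕ) (r : ℕ → ℝ) (j : ℕ)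
include hB hh

theorem KernelBound.abs_discreteConv_le :
    |discreteConv ω N h r j| ≤ B * (h * ∑ k ∈ Finset.Icc 1 N, |r k|) :=
  abs_mul_sum_mul_le hh fun _ _ => hB.bound _

theorem KernelBound.abs_discreteConv_sub_le :
    |discreteConv ω N h r (j + 1) - discreteConv ω N h r j|
      ≤ B * h * (h * ∑ k ∈ Finset.Icc 1 N, |r k|) := by
  unfold discreteConv
  rw [← mul_sub, ← Finset.sum_sub_distrib]
  simp_rw [← sub_mul]
  refine abs_mul_sum_mul_le hh fun k _ => (hB.lip _ _).trans_eq ?_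
  rw [show (((k : ℝ) - ((j + 1 : ℕ) : ℝ) - 1 / 2) * h - ((k : ℝ) - (j : ℝ) - 1 / 2) * h) = -h by
    push_cast; ring, abs_neg, abs_of_nonneg hh]

theorem KernelBound.abs_discreteConv_second_le :
    |discreteConv ω N h r (j + 2) - 2 * discreteConv ω N h r (j + 1) + discreteConv ω N h r j|
      ≤ B * h * h * (h * ∑ k ∈ Finset.Icc 1 N, |r k|) := by
  have e : discreteConv ω N h r (j + 2) - 2 * discreteConv ω N h r (j + 1)
      + discreteConv ω N h r j = h * ∑ k ∈ Finset.Icc 1 N,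
        (ω (((k : ℝ) - (j : ℝ) - 1 / 2) * h + -h + -h)
          - ω (((k : ℝ) - (j : ℝ) - 1 / 2) * h + -h)
          - ω (((k : ℝ) - (j : ℝ) - 1 / 2) * h + -h)
          + ω (((k : ℝ) - (j : ℝ) - 1 / 2) * h)) * r k := by
    unfold discreteConv
    rw [mul_left_comm 2 h, ← mul_sub, ← mul_add, Finset.mul_sum (a := 2),
      ← Finset.sum_sub_distrib, ← Finset.sum_add_distrib]
    congr 1
    refine Finset.sum_congr rfl fun k _ => ?_
    push_cast
    ring_nf
  rw [e]
  refine abs_mul_sum_mul_le hh fun k _ => (hB.second _ _).trans_eq ?_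
  rw [abs_neg, abs_of_nonneg hh]

end DiscreteBounds

/-- Bounds on the discrete nonlocal term and on its first and second differences. -/
theorem KernelBound.discreteNonlocal_bounds {ω : ℝ → ℝ} {B h κ ℓ w : ℝ} (hB : KernelBound ω B)
    (hh : 0 ≤ h) {N : ℕ} (hκ : 0 < κ) (hmass : ∀ j ≤ N, κ ≤ discreteMass ω N h j)
    (hw : N * h = w) {r : ℕ → ℝ} (hr : h * ∑ k ∈ Finset.Icc 1 N, |r k| ≤ ℓ) :
    (∀ j ≤ N, |discreteNonlocal ω N h r j| ≤ B * ℓ / κ) ∧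
    (∀ j, j + 1 ≤ N → |discreteNonlocal ω N h r (j + 1) - discreteNonlocal ω N h r j|
      ≤ (B * ℓ + B * ℓ / κ * (B * w)) / κ * h) ∧
    (∀ j, j + 2 ≤ N → |discreteNonlocal ω N h r (j + 2) - 2 * discreteNonlocal ω N h r (j + 1)
        + discreteNonlocal ω N h r j|
      ≤ (B * ℓ + 2 * ((B * ℓ + B * ℓ / κ * (B * w)) / κ) * (B * w) + B * ℓ / κ * (B * w)) / κ
        * h ^ 2) := by
  have hBp := hB.pos
  have hl0 : 0 ≤ ℓ := le_trans (mul_nonneg hh (Finset.sum_nonneg fun k _ => abs_nonneg _)) hr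
  have hw0 : 0 ≤ w := hw ▸ mul_nonneg (Nat.cast_nonneg _) hh
  have hmw : h * ∑ k ∈ Finset.Icc 1 N, |(1 : ℝ)| ≤ w := by simp [← hw, mul_comm]
  have hA : ∀ j ≤ N, discreteNonlocal ω N h r j * discreteMass ω N h j = discreteConv ω N h r j :=
    fun j hj => by rw [discreteNonlocal_eq, div_mul_cancel₀ _ (hκ.trans_le (hmass j hj)).ne']
  have b0 : ∀ j ≤ N, |discreteNonlocal ω N h r j| ≤ B * ℓ / κ := fun j hj => by
    rw [discreteNonlocal_eq, abs_div, abs_of_pos (hκ.trans_le (hmass j hj))]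
    exact div_le_div₀ (by positivity)
      ((hB.abs_discreteConv_le hh N r j).trans (by gcongr)) hκ (hmass j hj)
  have mW : ∀ j, |discreteMass ω N h (j + 1) - discreteMass ω N h j| ≤ B * w * h := fun j => by
    rw [discreteMass_eq, discreteMass_eq]
    refine (hB.abs_discreteConv_sub_le hh N (fun _ => 1) j).trans ?_
    calc _ ≤ B * h * w := by gcongr
      _ = _ := by ring
  have mW2 : ∀ j, |discreteMass ω N h (j + 2) - 2 * discreteMass ω N h (j + 1)
      + discreteMass ω N h j| ≤ B * w * h ^ 2 := fun j => by
    simp only [discreteMass_eq]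
    refine (hB.abs_discreteConv_second_le hh N (fun _ => 1) j).trans ?_
    calc _ ≤ B * h * h * w := by gcongr
      _ = _ := by ring
  have b1 : ∀ j, j + 1 ≤ N → |discreteNonlocal ω N h r (j + 1) - discreteNonlocal ω N h r j|
      ≤ (B * ℓ + B * ℓ / κ * (B * w)) / κ * h := fun j hj => by
    have hm := hmass (j + 1) hj
    have e : (discreteNonlocal ω N h r (j + 1) - discreteNonlocal ω N h r j)
        * discreteMass ω N h (j + 1) = (discreteConv ω N h r (j + 1) - discreteConv ω N h r j)
        - discreteNonlocal ω N h r j * (discreteMass ω N h (j + 1) - discreteMass ω N h j) := by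
      rw [← hA j (by omega), ← hA (j + 1) hj]; ring
    rw [div_mul_eq_mul_div, le_div_iff₀ hκ]
    calc _ ≤ |discreteNonlocal ω N h r (j + 1) - discreteNonlocal ω N h r j|
            * |discreteMass ω N h (j + 1)| := by
          gcongr; exact hm.trans (le_abs_self _)
      _ = |(discreteConv ω N h r (j + 1) - discreteConv ω N h r j)
        - discreteNonlocal ω N h r j * (discreteMass ω N h (j + 1) - discreteMass ω N h j)| := by
          rw [← abs_mul, e]
      _ ≤ _ := abs_sub _ _
      _ ≤ B * h * ℓ + B * ℓ / κ * (B * w * h) := by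
          gcongr
          · exact (hB.abs_discreteConv_sub_le hh N r j).trans (by gcongr)
          · rw [abs_mul]; gcongr
            · exact b0 j (by omega)
            · exact mW j
      _ = _ := by ring
  refine ⟨b0, b1, fun j hj => ?_⟩
  have hm := hmass (j + 1) (by omega)
  set R := discreteNonlocal ω N h r
  set W := discreteMass ω N h
  set D := (B * ℓ + B * ℓ / κ * (B * w)) / κ
  have e : (R (j + 2) - 2 * R (j + 1) + R j) * W (j + 1)
      = (discreteConv ω N h r (j + 2) - 2 * discreteConv ω N h r (j + 1) + discreteConv ω N h r j)
      - ((R (j + 2) - R (j + 1)) + (R (j + 1) - R j)) * (W (j + 2) - W (j + 1))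
      - R j * (W (j + 2) - 2 * W (j + 1) + W j) := by
    rw [← hA j (by omega), ← hA (j + 1) (by omega), ← hA (j + 2) hj]; ring
  rw [div_mul_eq_mul_div, le_div_iff₀ hκ]
  have hD : 0 ≤ D := by positivity
  calc _ ≤ |R (j + 2) - 2 * R (j + 1) + R j| * |W (j + 1)| := by
        gcongr; exact hm.trans (le_abs_self _)
    _ = _ := by rw [← abs_mul, e]
    _ ≤ _ := (abs_sub _ _).trans (add_le_add_left (abs_sub _ _) _)
    _ ≤ B * h * h * ℓ + (D * h + D * h) * (B * w * h) + B * ℓ / κ * (B * w * h ^ 2) := by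
        gcongr
        · exact (hB.abs_discreteConv_second_le hh N r j).trans (by gcongr)
        · rw [abs_mul]; gcongr
          · exact (abs_add_le _ _).trans (add_le_add (b1 (j + 1) hj) (b1 j (by omega)))
          · exact mW (j + 1)
        · rw [abs_mul]; gcongr
          · exact b0 j (by omega)
          · exact mW2 j
    _ = _ := by ring


theorem floor_cell_bounds {a h y : ℝ} (hh : 0 < h) (hy : a ≤ y) :
    a + ⌊(y - a) / h⌋₊ * h ≤ y ∧ y < a + (⌊(y - a) / h⌋₊ + 1) * h := by
  have h0 : 0 ≤ (y - a) / h := div_nonneg (by linarith) hh.le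
  have h1 := Nat.floor_le h0
  have h2 := Nat.lt_floor_add_one ((y - a) / h)
  rw [le_div_iff₀ hh] at h1
  rw [div_lt_iff₀ hh] at h2
  constructor <;> linarith

theorem abs_sum_kernel_sub_integral_le {a b h B x : ℝ} {N : ℕ} (hab : a ≤ b) (hh : 0 < h)
    (hN : N * h = b - a) {g : ℝ → ℝ} (hg : Continuous g) (hgB : ∀ s, |g s| ≤ B)
    (hgL : ∀ s s', |g s - g s'| ≤ B * |s - s'|) (r : ℕ → ℝ) (i : ℕ) {v : ℝ → ℝ}
    (hv : IntervalIntegrable v volume a b) :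
    |h * ∑ k ∈ Finset.Icc 1 N, g (((k : ℝ) - (i : ℝ) - 1 / 2) * h) * r k
        - ∫ y in a..b, v y * g (y - x)|
      ≤ B * (h + |a + i * h - x|) * (h * ∑ k ∈ Finset.Icc 1 N, |r k|)
        + B * ∫ y in a..b, |r (⌊(y - a) / h⌋₊ + 1) - v y| := by
  have hB : 0 ≤ B := (abs_nonneg _).trans (hgB 0)
  have hu := intervalIntegrable_comp_floor_succ hh hN r
  have hgx : Continuous fun y => g (y - x) := by fun_prop
  have i1 := intervalIntegrable_comp_floor_succ hh hN
    (fun k => g (((k : ℝ) - (i : ℝ) - 1 / 2) * h) * r k)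
  have i2 := hu.mul_continuousOn (g := fun y => g (y - x)) hgx.continuousOn
  have i3 := hv.mul_continuousOn (g := fun y => g (y - x)) hgx.continuousOn
  rw [sum_Icc_eq_integral hh hN, sum_Icc_eq_integral hh hN]
  have e : (∫ y in a..b, g (((⌊(y - a) / h⌋₊ + 1 : ℕ) - (i : ℝ) - 1 / 2) * h)
        * r (⌊(y - a) / h⌋₊ + 1)) - ∫ y in a..b, v y * g (y - x)
      = ∫ y in a..b, (g (((⌊(y - a) / h⌋₊ + 1 : ℕ) - (i : ℝ) - 1 / 2) * h)
        * r (⌊(y - a) / h⌋₊ + 1) - v y * g (y - x)) :=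
    (intervalIntegral.integral_sub i1 i3).symm
  rw [e, ← intervalIntegral.integral_const_mul, ← intervalIntegral.integral_const_mul,
    ← intervalIntegral.integral_add (hu.abs.const_mul _) ((hu.sub hv).abs.const_mul _)]
  refine (intervalIntegral.abs_integral_le_integral_abs hab).trans ?_
  refine intervalIntegral.integral_mono_on hab (i1.sub i3).abs
    ((hu.abs.const_mul _).add ((hu.sub hv).abs.const_mul _)) fun y hy => ?_
  obtain ⟨h1, h2⟩ := floor_cell_bounds hh hy.1
  set P := ⌊(y - a) / h⌋₊
  have hd : |((P + 1 : ℕ) - (i : ℝ) - 1 / 2) * h - (y - x)| ≤ h + |a + i * h - x| := by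
    have e : ((P + 1 : ℕ) - (i : ℝ) - 1 / 2) * h - (y - x)
        = (a + (P + 1 / 2) * h - y) - (a + i * h - x) := by push_cast; ring
    rw [e]
    refine (abs_sub _ _).trans (add_le_add ?_ le_rfl)
    rw [abs_le]; constructor <;> linarith
  calc _ = |(g (((P + 1 : ℕ) - (i : ℝ) - 1 / 2) * h) - g (y - x)) * r (P + 1)
        + g (y - x) * (r (P + 1) - v y)| := by congr 1; ring
    _ ≤ _ := abs_add_le _ _
    _ ≤ _ := by
      rw [abs_mul, abs_mul]
      gcongr
      · exact (hgL _ _).trans (by gcongr)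
      · exact hgB _

theorem tendsto_sum_kernel {a b B x : ℝ} (hab : a ≤ b) {h : ℕ → ℝ} {N i : ℕ → ℕ} {r : ℕ → ℕ → ℝ}
    (hh : ∀ m, 0 < h m) (hN : ∀ m, N m * h m = b - a) (hlim : Tendsto h atTop (𝓝 0))
    (hi : Tendsto (fun m => a + i m * h m) atTop (𝓝 x))
    {g : ℝ → ℝ} (hg : Continuous g) (hgB : ∀ s, |g s| ≤ B)
    (hgL : ∀ s s', |g s - g s'| ≤ B * |s - s'|) {v : ℝ → ℝ}
    (hv : IntervalIntegrable v volume a b)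
    (hr : Tendsto (fun m => ∫ y in a..b, |r m (⌊(y - a) / h m⌋₊ + 1) - v y|) atTop (𝓝 0)) :
    Tendsto (fun m => h m * ∑ k ∈ Finset.Icc 1 (N m),
      g (((k : ℝ) - (i m : ℝ) - 1 / 2) * h m) * r m k) atTop (𝓝 (∫ y in a..b, v y * g (y - x))) := by
  have hB : 0 ≤ B := (abs_nonneg _).trans (hgB 0)
  have hl : ∀ m, h m * ∑ k ∈ Finset.Icc 1 (N m), |r m k|
      ≤ (∫ y in a..b, |r m (⌊(y - a) / h m⌋₊ + 1) - v y|) + ∫ y in a..b, |v y| := by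
    intro m
    have hu := intervalIntegrable_comp_floor_succ (hh m) (hN m) (r m)
    rw [sum_Icc_eq_integral (hh m) (hN m), ← intervalIntegral.integral_add (hu.sub hv).abs hv.abs]
    refine intervalIntegral.integral_mono_on hab hu.abs ((hu.sub hv).abs.add hv.abs) fun y _ => ?_
    simpa using abs_add_le (r m (⌊(y - a) / h m⌋₊ + 1) - v y) (v y)
  rw [tendsto_iff_dist_tendsto_zero]
  refine squeeze_zero (fun _ => dist_nonneg) (fun m => ?_)
    (g := fun m => B * (h m + |a + i m * h m - x|)
      * ((∫ y in a..b, |r m (⌊(y - a) / h m⌋₊ + 1) - v y|) + ∫ y in a..b, |v y|)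
      + B * ∫ y in a..b, |r m (⌊(y - a) / h m⌋₊ + 1) - v y|) ?_
  · rw [Real.dist_eq]
    refine (abs_sum_kernel_sub_integral_le hab (hh m) (hN m) hg hgB hgL (r m) (i m) hv).trans ?_
    have := (hh m).le
    gcongr
    exact hl m
  · have h1 : Tendsto (fun m => |a + i m * h m - x|) atTop (𝓝 0) := by
      simpa using (hi.sub_const x).abs
    simpa using (((hlim.add h1).const_mul B).mul (hr.add_const (∫ y in a..b, |v y|))).add
      (hr.const_mul B)

section Convergence
variable {a b B x : ℝ} (hab : a < b) {h : ℕ → ℝ} {N i : ℕ → ℕ} {r : ℕ → ℕ → ℝ}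
  (hh : ∀ m, 0 < h m) (hN : ∀ m, N m * h m = b - a) (hlim : Tendsto h atTop (𝓝 0))
  (hi : Tendsto (fun m => a + i m * h m) atTop (𝓝 x)) {ω : ℝ → ℝ} (hB : KernelBound ω B)
include hab hh hN hlim hi hB

theorem KernelBound.tendsto_discreteConv {v : ℝ → ℝ} (hv : IntervalIntegrable v volume a b)
    (hr : Tendsto (fun m => ∫ y in a..b, |r m (⌊(y - a) / h m⌋₊ + 1) - v y|) atTop (𝓝 0)) :
    Tendsto (fun m => discreteConv ω (N m) (h m) (r m) (i m)) atTop
      (𝓝 (∫ y in a..b, v y * ω (y - x))) :=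
  tendsto_sum_kernel hab.le hh hN hlim hi hB.differentiable.continuous hB.bound hB.lip hv hr

theorem KernelBound.tendsto_discreteConv_diff {v : ℝ → ℝ} (hv : IntervalIntegrable v volume a b)
    (hr : Tendsto (fun m => ∫ y in a..b, |r m (⌊(y - a) / h m⌋₊ + 1) - v y|) atTop (𝓝 0)) :
    Tendsto (fun m => (discreteConv ω (N m) (h m) (r m) (i m + 1)
        - discreteConv ω (N m) (h m) (r m) (i m)) / h m) atTop
      (𝓝 (-∫ y in a..b, v y * deriv ω (y - x))) := by
  have h1 := tendsto_sum_kernel hab.le hh hN hlim hi hB.continuous_deriv hB.bound_deriv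
    hB.lip_deriv hv hr
  have h2 := tendsto_sum_kernel (r := fun m k => |r m k|) (v := fun y => |v y|) hab.le hh hN hlim hi
    (g := fun _ => B) continuous_const (fun _ => (abs_of_pos hB.pos).le)
    (fun s s' => by simpa using mul_nonneg hB.pos.le (abs_nonneg _)) hv.abs
    (by
      refine squeeze_zero (fun m => intervalIntegral.integral_nonneg hab.le fun _ _ => abs_nonneg _)
        (fun m => ?_) hr
      have hu := intervalIntegrable_comp_floor_succ (hh m) (hN m) (r m)
      exact intervalIntegral.integral_mono_on hab.le (hu.abs.sub hv.abs).abs (hu.sub hv).abs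
        fun y _ => abs_abs_sub_abs_le_abs_sub _ _)
  refine tendsto_of_tendsto_of_dist h1.neg ?_
  have h3 : Tendsto (fun m => h m * (h m * ∑ k ∈ Finset.Icc 1 (N m), B * |r m k|)) atTop
      (𝓝 0) := by simpa using hlim.mul h2
  refine squeeze_zero (fun _ => dist_nonneg) (fun m => ?_) h3
  have hm := hh m
  rw [Real.dist_eq, abs_sub_comm]
  have e : (discreteConv ω (N m) (h m) (r m) (i m + 1)
        - discreteConv ω (N m) (h m) (r m) (i m)) / h m
        - -(h m * ∑ k ∈ Finset.Icc 1 (N m), deriv ω (((k : ℝ) - (i m : ℝ) - 1 / 2) * h m) * r m k)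
      = h m * ∑ k ∈ Finset.Icc 1 (N m), ((ω (((k : ℝ) - (i m : ℝ) - 1 / 2) * h m + -h m)
        - ω (((k : ℝ) - (i m : ℝ) - 1 / 2) * h m)
        - deriv ω (((k : ℝ) - (i m : ℝ) - 1 / 2) * h m) * -h m) * r m k) / h m := by
    unfold discreteConv
    rw [← mul_sub, ← Finset.sum_sub_distrib, mul_div_assoc, Finset.sum_div, ← mul_neg,
      ← Finset.sum_neg_distrib, ← mul_sub, ← Finset.sum_sub_distrib]
    congr 1
    refine Finset.sum_congr rfl fun k _ => ?_
    have : ((k : ℝ) - ((i m + 1 : ℕ) : ℝ) - 1 / 2) * h m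
      = ((k : ℝ) - (i m : ℝ) - 1 / 2) * h m + -h m := by push_cast; ring
    rw [this]
    field_simp
  rw [e, abs_mul, abs_of_pos hm]
  refine mul_le_mul_of_nonneg_left ?_ hm.le
  rw [Finset.mul_sum]
  refine (Finset.abs_sum_le_sum_abs _ _).trans (Finset.sum_le_sum fun k _ => ?_)
  rw [abs_div, abs_mul, abs_of_pos hm, div_le_iff₀ hm]
  have := hB.taylor (((k : ℝ) - (i m : ℝ) - 1 / 2) * h m) (-h m)
  rw [abs_neg, abs_of_pos hm] at this
  calc _ ≤ B * h m * h m * |r m k| := by gcongr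
    _ = _ := by ring

theorem KernelBound.tendsto_discreteMass :
    Tendsto (fun m => discreteMass ω (N m) (h m) (i m)) atTop (𝓝 (kernelMass a b ω x)) := by
  simp_rw [discreteMass_eq]
  have := hB.tendsto_discreteConv hab hh hN hlim hi (r := fun _ _ => 1) (v := fun _ => 1)
    intervalIntegrable_const (by simp)
  simpa [kernelMass] using this

end Convergence

theorem KernelBound.hasDerivAt_conv {a b B x : ℝ} {ω : ℝ → ℝ} (hB : KernelBound ω B) {v : ℝ → ℝ}
    (hv : IntervalIntegrable v volume a b) :
    HasDerivAt (fun x => ∫ y in a..b, v y * ω (y - x)) (-∫ y in a..b, v y * deriv ω (y - x)) x := by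
  have hc : ∀ x, Continuous fun y => ω (y - x) := fun x =>
    hB.differentiable.continuous.comp (by fun_prop)
  have hc' : Continuous fun y => deriv ω (y - x) := hB.continuous_deriv.comp (by fun_prop)
  have := intervalIntegral.hasDerivAt_integral_of_dominated_loc_of_deriv_le (μ := volume)
    (F := fun x y => v y * ω (y - x)) (F' := fun x y => v y * -deriv ω (y - x)) (x₀ := x)
    (a := a) (b := b) (bound := fun y => |v y| * B) (s := univ) univ_mem
    (Eventually.of_forall fun x' => (hv.mul_continuousOn (hc x').continuousOn).def'.aestronglyMeasurable)
    (hv.mul_continuousOn (hc x).continuousOn)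
    (hv.mul_continuousOn hc'.neg.continuousOn).def'.aestronglyMeasurable
    (Eventually.of_forall fun y _ x' _ => by
      rw [norm_mul, norm_neg]
      exact mul_le_mul_of_nonneg_left (hB.bound_deriv _) (norm_nonneg _))
    (hv.abs.mul_const B)
    (Eventually.of_forall fun y _ x' _ => by
      refine HasDerivAt.const_mul (v y) ?_
      exact (hB.differentiable (y - x')).hasDerivAt.comp_const_sub y x')
  simpa using this.2

theorem KernelBound.hasDerivAt_kernelMass {a b B x : ℝ} {ω : ℝ → ℝ} (hB : KernelBound ω B) :
    HasDerivAt (kernelMass a b ω) (-∫ y in a..b, deriv ω (y - x)) x := by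
  have := hB.hasDerivAt_conv (a := a) (b := b) (x := x) (v := fun _ => 1) intervalIntegrable_const
  simp only [one_mul] at this
  exact this

/-- The derivative in `x` of the nonlocal term. -/
noncomputable def nonlocalDeriv (a b : ℝ) (ω : ℝ → ℝ) (ρ : ℝ → ℝ → ℝ) (t x : ℝ) : ℝ :=
  (-(∫ y in a..b, ρ t y * deriv ω (y - x))
    - nonlocalTerm a b ω ρ t x * -∫ y in a..b, deriv ω (y - x)) / kernelMass a b ω x

theorem KernelBound.hasDerivAt_nonlocalTerm {a b B t x : ℝ} {ω : ℝ → ℝ} (hB : KernelBound ω B)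
    (hW : kernelMass a b ω x ≠ 0) {ρ : ℝ → ℝ → ℝ} (hρ : IntervalIntegrable (ρ t) volume a b) :
    HasDerivAt (fun x => nonlocalTerm a b ω ρ t x) (nonlocalDeriv a b ω ρ t x) x := by
  have h1 := hB.hasDerivAt_conv (x := x) hρ
  have h2 := (hB.hasDerivAt_kernelMass (a := a) (b := b) (x := x))
  have h3 := h1.div h2 hW
  have e1 : (fun x => nonlocalTerm a b ω ρ t x)
      = (fun x => ∫ y in a..b, ρ t y * ω (y - x)) / kernelMass a b ω := by
    ext y
    simp only [nonlocalTerm, Pi.div_apply]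
    ring
  rw [e1]
  refine h3.congr_deriv ?_
  simp only [nonlocalDeriv, nonlocalTerm]
  field_simp

section Convergence
variable {a b B x : ℝ} (hab : a < b) {h : ℕ → ℝ} {N i : ℕ → ℕ} {r : ℕ → ℕ → ℝ}
  (hh : ∀ m, 0 < h m) (hN : ∀ m, N m * h m = b - a) (hlim : Tendsto h atTop (𝓝 0))
  (hi : Tendsto (fun m => a + i m * h m) atTop (𝓝 x)) {ω : ℝ → ℝ} (hB : KernelBound ω B)
  (hW : kernelMass a b ω x ≠ 0) {ρ : ℝ → ℝ → ℝ} {t : ℝ}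
  (hρ : IntervalIntegrable (ρ t) volume a b)
  (hr : Tendsto (fun m => ∫ y in a..b, |r m (⌊(y - a) / h m⌋₊ + 1) - ρ t y|) atTop (𝓝 0))
include hab hh hN hlim hi hB hW hρ hr

theorem KernelBound.tendsto_discreteNonlocal :
    Tendsto (fun m => discreteNonlocal ω (N m) (h m) (r m) (i m)) atTop
      (𝓝 (nonlocalTerm a b ω ρ t x)) := by
  simp_rw [discreteNonlocal_eq]
  have := (hB.tendsto_discreteConv hab hh hN hlim hi hρ hr).div
    (hB.tendsto_discreteMass hab hh hN hlim hi) hW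
  have e : nonlocalTerm a b ω ρ t x
      = (∫ y in a..b, ρ t y * ω (y - x)) / kernelMass a b ω x := by
    simp only [nonlocalTerm]; ring
  rw [e]
  exact this

theorem KernelBound.tendsto_discreteNonlocal_diff :
    Tendsto (fun m => (discreteNonlocal ω (N m) (h m) (r m) (i m + 1)
        - discreteNonlocal ω (N m) (h m) (r m) (i m)) / h m) atTop
      (𝓝 (nonlocalDeriv a b ω ρ t x)) := by
  have hi' : Tendsto (fun m => a + (i m + 1 : ℕ) * h m) atTop (𝓝 x) := by
    have := hi.add hlim
    rw [add_zero] at this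
    refine this.congr fun m => ?_
    push_cast; ring
  have hm0 := hB.tendsto_discreteMass hab hh hN hlim hi
  have hm1 := hB.tendsto_discreteMass hab hh hN hlim hi'
  have hR := hB.tendsto_discreteNonlocal hab hh hN hlim hi hW hρ hr
  have hdA := hB.tendsto_discreteConv_diff hab hh hN hlim hi hρ hr
  have hdW := hB.tendsto_discreteConv_diff hab hh hN hlim hi (r := fun _ _ => 1) (v := fun _ => 1)
    intervalIntegrable_const (by simp)
  have e1 : ∀ m j, discreteConv ω (N m) (h m) (fun _ => 1) j = discreteMass ω (N m) (h m) j :=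
    fun m j => (discreteMass_eq _ _ _ _).symm
  simp only [e1, one_mul] at hdW
  refine ((hdA.sub (hR.mul hdW)).div hm1 hW).congr' ?_
  filter_upwards [hm0.eventually_ne hW, hm1.eventually_ne hW] with m n0 n1
  have hne := (hh m).ne'
  simp only [discreteNonlocal_eq, Pi.div_apply]
  field_simp
  ring

end Convergence

theorem KernelAssumption.exists_discreteMass_lower_bound {a b : ℝ} (hab : a < b) {ω : ℝ → ℝ}
    (hω : KernelAssumption a b ω) : ∃ κ > 0, ∃ h₀ > 0, ∀ (h : ℝ) (N : ℕ), 0 < h → h ≤ h₀ →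
      N * h = b - a → ∀ j ≤ N, κ ≤ discreteMass ω N h j := by
  obtain ⟨B, hB⟩ := hω.exists_bound
  obtain ⟨K, hK, hKm⟩ := hω.mass_lower_bound
  have hBp := hB.pos
  have hw : 0 < b - a := sub_pos.2 hab
  refine ⟨K / 2, by positivity, K / 2 / (B * (b - a)), by positivity, fun h N hh hle hN j hj => ?_⟩
  have hx : a + j * h ∈ Icc a b := by
    constructor
    · have : (0 : ℝ) ≤ j := Nat.cast_nonneg j
      nlinarith
    · have : (j : ℝ) ≤ N := Nat.cast_le.2 hj
      nlinarith
  have key := abs_sum_kernel_sub_integral_le hab.le hh hN hB.differentiable.continuous hB.bound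
    hB.lip (fun _ => 1) j (v := fun _ => 1) (x := a + j * h) intervalIntegrable_const
  have hm := hKm _ hx
  have e1 : h * ∑ k ∈ Finset.Icc 1 N, |(1 : ℝ)| = b - a := by simp [← hN, mul_comm]
  rw [e1] at key
  simp only [mul_one, one_mul, sub_self, abs_zero, add_zero, intervalIntegral.integral_zero,
    mul_zero] at key
  rw [le_div_iff₀ (by positivity)] at hle
  have := (abs_le.1 key).1
  unfold discreteMass
  unfold kernelMass at hm
  linarith


/-! ### Semi-entropies, with a sign `σ = ± 1` -/

/-- `η_σ (s) = (σ s)⁺` -/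
def semi (σ s : ℝ) : ℝ := max (σ * s) 0

/-- `sgn_σ (s)`, which is `σ` if `σ s > 0` and `0` otherwise -/
noncomputable def sgnSemi (σ s : ℝ) : ℝ := if 0 < σ * s then σ else 0

/-- `max u k` if `σ = 1`, `min u k` if `σ = -1` -/
def clip (σ k u : ℝ) : ℝ := k + σ * semi σ (u - k)

theorem semi_one : semi 1 = semiPos := by ext s; simp [semi, semiPos]
theorem semi_neg_one : semi (-1) = semiNeg := by ext s; simp [semi, semiNeg]
theorem sgnSemi_one : sgnSemi 1 = sgnPos := by ext s; simp [sgnSemi, sgnPos]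
theorem sgnSemi_neg_one : sgnSemi (-1) = sgnNeg := by ext s; simp [sgnSemi, sgnNeg]

theorem semi_nonneg (σ s : ℝ) : 0 ≤ semi σ s := le_max_right _ _

theorem clip_one (k u : ℝ) : clip 1 k u = max u k := by
  simp only [clip, semi, one_mul]
  rcases le_total u k with h | h
  · rw [max_eq_right (by linarith), max_eq_right h]; ring
  · rw [max_eq_left (by linarith), max_eq_left h]; ring

theorem clip_neg_one (k u : ℝ) : clip (-1) k u = min u k := by
  simp only [clip, semi]
  rcases le_total u k with h | h
  · rw [max_eq_left (by linarith), min_eq_left h]; ring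
  · rw [max_eq_right (by linarith), min_eq_right h]; ring

@[fun_prop] theorem continuous_semi (σ : ℝ) : Continuous (semi σ) := by unfold semi; fun_prop
@[fun_prop] theorem continuous_clip (σ k : ℝ) : Continuous (clip σ k) := by unfold clip; fun_prop

theorem sq_sign {σ : ℝ} (hσ : σ = 1 ∨ σ = -1) : σ * σ = 1 := by
  rcases hσ with rfl | rfl <;> norm_num

theorem abs_sign {σ : ℝ} (hσ : σ = 1 ∨ σ = -1) : |σ| = 1 := by
  rcases hσ with rfl | rfl <;> norm_num

theorem abs_clip_sub {σ : ℝ} (hσ : σ = 1 ∨ σ = -1) (k u : ℝ) :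
    |clip σ k u - k| = semi σ (u - k) := by
  unfold clip
  rw [add_sub_cancel_left, abs_mul, abs_sign hσ, one_mul, abs_of_nonneg (semi_nonneg _ _)]

theorem semi_le_abs {σ : ℝ} (hσ : σ = 1 ∨ σ = -1) (s : ℝ) : semi σ s ≤ |s| := by
  rcases hσ with rfl | rfl
  · simpa [semi] using le_abs_self s
  · simpa [semi] using neg_le_abs s

theorem abs_sgnSemi_le {σ : ℝ} (hσ : σ = 1 ∨ σ = -1) (s : ℝ) : |sgnSemi σ s| ≤ 1 := by
  unfold sgnSemi; split_ifs
  · exact (abs_sign hσ).le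
  · simp

theorem abs_semi_sub_le {σ : ℝ} (hσ : σ = 1 ∨ σ = -1) (s s' : ℝ) :
    |semi σ s - semi σ s'| ≤ |s - s'| := by
  refine (abs_max_sub_max_le_abs _ _ _).trans ?_
  rw [← mul_sub, abs_mul, abs_sign hσ, one_mul]

/-- `sgn_σ (u - k) (g u - g k) = σ (g (clip u) - g k)` -/
theorem sgnSemi_mul_sub {σ : ℝ} (hσ : σ = 1 ∨ σ = -1) (g : ℝ → ℝ) (u k : ℝ) :
    sgnSemi σ (u - k) * (g u - g k) = σ * (g (clip σ k u) - g k) := by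
  unfold sgnSemi
  split_ifs with h
  · have : clip σ k u = u := by
      unfold clip semi
      rw [max_eq_left h.le, ← mul_assoc, sq_sign hσ]; ring
    rw [this]
  · have : clip σ k u = k := by
      unfold clip semi
      rw [max_eq_right (not_lt.1 h)]; ring
    rw [this]; simp

/-- The entropy flux is Lipschitz continuous in the level `k`. -/
theorem abs_sgnSemi_mul_sub_le {σ : ℝ} (hσ : σ = 1 ∨ σ = -1) {g : ℝ → ℝ} {M : ℝ} (hM : 0 ≤ M)
    (hg : ∀ r r', |g r - g r'| ≤ M * |r - r'|) (u k k' : ℝ) :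
    |sgnSemi σ (u - k) * (g u - g k) - sgnSemi σ (u - k') * (g u - g k')| ≤ M * |k - k'| := by
  have h1 := hg k k'
  have h2 := hg u k
  have h3 := hg u k'
  have h4 := hg k' k
  rw [abs_sub_comm k' k] at h4
  have key : ∀ v w : ℝ, 0 < σ * (v - u) → 0 < σ * (u - w) → |v - u| ≤ |v - w| ∧ |u - w| ≤ |v - w| := by
    intro v w h1 h2
    have e1 : |v - u| = σ * (v - u) := by
      rw [← abs_of_pos h1, abs_mul, abs_sign hσ, one_mul]
    have e2 : |u - w| = σ * (u - w) := by
      rw [← abs_of_pos h2, abs_mul, abs_sign hσ, one_mul]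
    have e3 : |v - w| = σ * (v - w) := by
      rw [← abs_of_pos (show 0 < σ * (v - w) by nlinarith), abs_mul, abs_sign hσ, one_mul]
    constructor <;> nlinarith
  have aux : ∀ v w : ℝ, 0 < σ * (u - w) → ¬ 0 < σ * (u - v) → |u - w| ≤ |v - w| := by
    intro v w h1 h2
    have e2 : |u - w| = σ * (u - w) := by
      rw [← abs_of_pos h1, abs_mul, abs_sign hσ, one_mul]
    have e3 : |v - w| = σ * (v - w) := by
      rw [← abs_of_pos (show 0 < σ * (v - w) by nlinarith), abs_mul, abs_sign hσ, one_mul]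
    rw [e2, e3]; nlinarith
  unfold sgnSemi
  split_ifs with ha hb hb
  · rw [← mul_sub, abs_mul, abs_sign hσ, one_mul]
    rw [show g u - g k - (g u - g k') = g k' - g k by ring]; exact h4
  · rw [zero_mul, sub_zero, abs_mul, abs_sign hσ, one_mul]
    refine h2.trans (mul_le_mul_of_nonneg_left ?_ hM)
    rw [abs_sub_comm k k']; exact aux k' k ha hb
  · rw [zero_mul, zero_sub, abs_neg, abs_mul, abs_sign hσ, one_mul]
    exact h3.trans (mul_le_mul_of_nonneg_left (aux k k' hb ha) hM)
  · simpa using mul_nonneg hM (abs_nonneg _)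

/-! ### One step of the Lax-Friedrichs scheme -/

/-- The Lax-Friedrichs flux -/
noncomputable def laxFlux (α : ℝ) (g : ℝ → ℝ) (u v : ℝ) : ℝ := 1 / 2 * (g u + g v - α * (v - u))

/-- One step of the scheme, with flux functions `gm` and `gp` at the two interfaces of the cell -/
noncomputable def laxStep (lam α : ℝ) (gm gp : ℝ → ℝ) (u v w : ℝ) : ℝ :=
  v - lam * (laxFlux α gp v w - laxFlux α gm u v)

section Step
variable {lam α L : ℝ} {gm gp : ℝ → ℝ} (hlam : 0 ≤ lam) (hL : L ≤ α)
  (hlα : lam * α ≤ 1 / 3) (hm : ∀ r r', |gm r - gm r'| ≤ L * |r - r'|)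
  (hp : ∀ r r', |gp r - gp r'| ≤ L * |r - r'|)
include hlam hL hlα hm hp

theorem laxStep_mono {u v w u' v' w' : ℝ} (hu : u ≤ u') (hv : v ≤ v') (hw : w ≤ w') :
    laxStep lam α gm gp u v w ≤ laxStep lam α gm gp u' v' w' := by
  have b : ∀ {g : ℝ → ℝ}, (∀ r r', |g r - g r'| ≤ L * |r - r'|) → ∀ {r r' : ℝ}, r ≤ r' →
      -(α * (r' - r)) ≤ g r' - g r ∧ g r' - g r ≤ α * (r' - r) := by
    intro g hg r r' hr
    have h := hg r' r
    rw [abs_of_nonneg (sub_nonneg.2 hr)] at h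
    have h' := abs_le.1 (h.trans (mul_le_mul_of_nonneg_right hL (sub_nonneg.2 hr)))
    exact h'
  have h1 := b hp hw
  have h2 := b hm hu
  have h3 := b hp hv
  have h4 := b hm hv
  have e : laxStep lam α gm gp u' v' w' - laxStep lam α gm gp u v w
      = (v' - v) * (1 - 3 * (lam * α)) + (v' - v) * (lam * α)
        + lam / 2 * ((α * (v' - v) - (gp v' - gp v)) + ((gm v' - gm v) + α * (v' - v)))
        + lam / 2 * (α * (w' - w) - (gp w' - gp w))
        + lam / 2 * (α * (u' - u) + (gm u' - gm u)) := by
    unfold laxStep laxFlux; ring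
  have hα : 0 ≤ L := by
    have := hm 1 0
    simp only [sub_zero, abs_one, mul_one] at this
    exact (abs_nonneg _).trans this
  have t1 : 0 ≤ (v' - v) * (1 - 3 * (lam * α)) := mul_nonneg (by linarith) (by linarith)
  have t2 : 0 ≤ (v' - v) * (lam * α) :=
    mul_nonneg (by linarith) (mul_nonneg hlam (hα.trans hL))
  have t3 : 0 ≤ lam / 2 * ((α * (v' - v) - (gp v' - gp v)) + ((gm v' - gm v) + α * (v' - v))) :=
    mul_nonneg (by linarith) (by linarith)
  have t4 : 0 ≤ lam / 2 * (α * (w' - w) - (gp w' - gp w)) := mul_nonneg (by linarith) (by linarith)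
  have t5 : 0 ≤ lam / 2 * (α * (u' - u) + (gm u' - gm u)) := mul_nonneg (by linarith) (by linarith)
  linarith

/-- The discrete entropy inequality -/
theorem laxStep_entropy {σ : ℝ} (hσ : σ = 1 ∨ σ = -1) (k u v w : ℝ) :
    semi σ (laxStep lam α gm gp u v w - k) - semi σ (v - k)
      + lam * (σ * (laxFlux α gp (clip σ k v) (clip σ k w) - gp k)
        - σ * (laxFlux α gm (clip σ k u) (clip σ k v) - gm k))
      + lam * (sgnSemi σ (laxStep lam α gm gp u v w - k) * (gp k - gm k)) ≤ 0 := by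
  have hmono := @laxStep_mono lam α L gm gp hlam hL hlα hm hp
  have hK : laxStep lam α gm gp k k k = k - lam * (gp k - gm k) := by
    unfold laxStep laxFlux; ring
  have hX : σ * (laxStep lam α gm gp (clip σ k u) (clip σ k v) (clip σ k w)
      - laxStep lam α gm gp k k k)
      = semi σ (v - k) - lam * (σ * (laxFlux α gp (clip σ k v) (clip σ k w) - gp k)
        - σ * (laxFlux α gm (clip σ k u) (clip σ k v) - gm k)) := by
    rw [hK]
    unfold laxStep
    have : σ * clip σ k v = σ * k + semi σ (v - k) := by
      unfold clip; rw [mul_add, ← mul_assoc, sq_sign hσ, one_mul]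
    linear_combination this
  have h1 : 0 ≤ σ * (laxStep lam α gm gp (clip σ k u) (clip σ k v) (clip σ k w)
      - laxStep lam α gm gp k k k) := by
    rcases hσ with rfl | rfl
    · simp only [clip_one]
      linarith [hmono (le_max_right u k) (le_max_right v k) (le_max_right w k)]
    · simp only [clip_neg_one]
      linarith [hmono (min_le_right u k) (min_le_right v k) (min_le_right w k)]
  have h2 : 0 ≤ σ * (laxStep lam α gm gp (clip σ k u) (clip σ k v) (clip σ k w)
      - laxStep lam α gm gp u v w) := by
    rcases hσ with rfl | rfl
    · simp only [clip_one]
      linarith [hmono (le_max_left u k) (le_max_left v k) (le_max_left w k)]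
    · simp only [clip_neg_one]
      linarith [hmono (min_le_left u k) (min_le_left v k) (min_le_left w k)]
  rw [mul_sub, hK, mul_sub σ k] at h1
  rw [mul_sub, hK, mul_sub σ k] at hX
  rw [mul_sub] at h2
  unfold sgnSemi
  split_ifs with hs
  · have : semi σ (laxStep lam α gm gp u v w - k) = σ * (laxStep lam α gm gp u v w - k) :=
      max_eq_left hs.le
    rw [this]
    linarith
  · have : semi σ (laxStep lam α gm gp u v w - k) = 0 := max_eq_right (not_lt.1 hs)
    rw [this]
    linarith

end Step

theorem laxFlux_entropy_bounds {α L : ℝ} {g : ℝ → ℝ} (hL : L ≤ α)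
    (hg : ∀ r r', |g r - g r'| ≤ L * |r - r'|) {σ : ℝ} (hσ : σ = 1 ∨ σ = -1) (k u v : ℝ) :
    -(α * semi σ (v - k)) ≤ σ * (laxFlux α g (clip σ k u) (clip σ k v) - g k) ∧
    σ * (laxFlux α g (clip σ k u) (clip σ k v) - g k) ≤ α * semi σ (u - k) := by
  have b : ∀ u, |σ * (g (clip σ k u) - g k)| ≤ α * semi σ (u - k) := fun u => by
    rw [abs_mul, abs_sign hσ, one_mul]
    refine (hg _ _).trans ?_
    rw [abs_clip_sub hσ]
    exact mul_le_mul_of_nonneg_right hL (semi_nonneg _ _)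
  have hu := abs_le.1 (b u)
  have hv := abs_le.1 (b v)
  have e : σ * (laxFlux α g (clip σ k u) (clip σ k v) - g k)
      = 1 / 2 * (σ * (g (clip σ k u) - g k)) + 1 / 2 * (σ * (g (clip σ k v) - g k))
        - 1 / 2 * (α * semi σ (v - k)) + 1 / 2 * (α * semi σ (u - k)) := by
    have hc : σ * (clip σ k v - clip σ k u) = semi σ (v - k) - semi σ (u - k) := by
      unfold clip; linear_combination (semi σ (v - k) - semi σ (u - k)) * sq_sign hσ
    unfold laxFlux
    linear_combination (-α / 2) * hc
  rw [e]
  constructor <;> linarith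

theorem laxFlux_bounds {α L : ℝ} {g : ℝ → ℝ} (hL : L ≤ α)
    (hg : ∀ r, |g r| ≤ L * |r|) {u v : ℝ} (hu : 0 ≤ u) (hv : 0 ≤ v) :
    -(α * v) ≤ laxFlux α g u v ∧ laxFlux α g u v ≤ α * u := by
  have h1 := hg u
  have h2 := hg v
  rw [abs_of_nonneg hu] at h1
  rw [abs_of_nonneg hv] at h2
  have h1' := abs_le.1 (h1.trans (mul_le_mul_of_nonneg_right hL hu))
  have h2' := abs_le.1 (h2.trans (mul_le_mul_of_nonneg_right hL hv))
  unfold laxFlux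
  constructor <;> linarith

/-! ### Total variation -/

theorem sum_abs_diff_le {N : ℕ} {r r' s z g ε : ℕ → ℝ}
    (hr' : ∀ j ≤ N + 1, r' j = r j + s j - z j - g j + ε j)
    (hsz : ∀ j ≤ N, |r (j + 1) - r j - s j - z (j + 1)| ≤ |r (j + 1) - r j| - |s j| - |z (j + 1)|)
    (hs0 : s 0 = 0) (hs : s (N + 1) = 0) (hz0 : z 0 = 0) (hz : z (N + 1) = 0) :
    ∑ j ∈ Finset.range (N + 1), |r' (j + 1) - r' j| ≤ ∑ j ∈ Finset.range (N + 1), |r (j + 1) - r j|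
      + ∑ j ∈ Finset.range (N + 1), (|g (j + 1) - g j| + (|ε (j + 1)| + |ε j|)) := by
  have h1 : ∀ j ∈ Finset.range (N + 1), |r' (j + 1) - r' j| ≤
      (|r (j + 1) - r j| + (|g (j + 1) - g j| + (|ε (j + 1)| + |ε j|)))
        + ((|s (j + 1)| - |z (j + 1)|) - (|s j| - |z j|)) := by
    intro j hj
    have hj' : j ≤ N := Nat.lt_succ_iff.1 (Finset.mem_range.1 hj)
    rw [hr' (j + 1) (by omega), hr' j (by omega)]
    have e : r (j + 1) + s (j + 1) - z (j + 1) - g (j + 1) + ε (j + 1)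
        - (r j + s j - z j - g j + ε j)
        = (r (j + 1) - r j - s j - z (j + 1)) + s (j + 1) + z j - (g (j + 1) - g j)
          + ε (j + 1) - ε j := by ring
    rw [e]
    have t1 := abs_sub ((r (j + 1) - r j - s j - z (j + 1)) + s (j + 1) + z j - (g (j + 1) - g j)
          + ε (j + 1)) (ε j)
    have t2 := abs_add_le ((r (j + 1) - r j - s j - z (j + 1)) + s (j + 1) + z j
      - (g (j + 1) - g j)) (ε (j + 1))
    have t3 := abs_sub ((r (j + 1) - r j - s j - z (j + 1)) + s (j + 1) + z j) (g (j + 1) - g j)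
    have t4 := abs_add_le ((r (j + 1) - r j - s j - z (j + 1)) + s (j + 1)) (z j)
    have t5 := abs_add_le (r (j + 1) - r j - s j - z (j + 1)) (s (j + 1))
    linarith [hsz j hj']
  refine (Finset.sum_le_sum h1).trans_eq ?_
  rw [Finset.sum_add_distrib, Finset.sum_add_distrib,
    Finset.sum_range_sub (fun j => |s j| - |z j|)]
  simp [hs0, hs, hz0, hz]

/-- Total variation and modulus of continuity in time of one step of the scheme. -/
theorem laxStep_variation {N : ℕ} {lam α L c₁ c₂ c₃ : ℝ} (hN : 1 ≤ N) (hlam : 0 ≤ lam) (hL0 : 0 ≤ L)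
    (hL : L ≤ α) (hlα : lam * α ≤ 1 / 3) {r r' : ℕ → ℝ} {fl : ℕ → ℝ → ℝ}
    (hfl : ∀ j ≤ N, ∀ u v, |fl j u - fl j v| ≤ L * |u - v|)
    (hr' : ∀ j, j + 1 ≤ N →
      r' (j + 1) = laxStep lam α (fl j) (fl (j + 1)) (r j) (r (j + 1)) (r (j + 2)))
    (h1 : ∀ j, j + 1 ≤ N → |fl (j + 1) (r (j + 1)) - fl j (r (j + 1))| ≤ c₁)
    (h2 : ∀ j, j + 2 ≤ N → |(fl (j + 2) (r (j + 2)) - fl (j + 1) (r (j + 2)))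
      - (fl (j + 1) (r (j + 1)) - fl j (r (j + 1)))| ≤ c₂ * |r (j + 2) - r (j + 1)| + c₃)
    (hc₁ : 0 ≤ c₁) (hc₂ : 0 ≤ c₂) (hc₃ : 0 ≤ c₃) :
    (∑ j ∈ Finset.range (N + 1), |r' (j + 1) - r' j|
      ≤ (1 + lam * c₂) * ∑ j ∈ Finset.range (N + 1), |r (j + 1) - r j|
        + |r' 0 - r 0| + |r' (N + 1) - r (N + 1)| + lam * (2 * c₁ + N * c₃)) ∧
    ∑ j ∈ Finset.range N, |r' (j + 1) - r (j + 1)|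
      ≤ 2 * (lam * α) * (∑ j ∈ Finset.range (N + 1), |r (j + 1) - r j|) + N * (lam * c₁) := by
  set Δ : ℕ → ℝ := fun j => r (j + 1) - r j with hΔ
  have hβ : ∀ j, ∃ β, j ≤ N → fl j (r (j + 1)) - fl j (r j) = β * Δ j ∧ |β| ≤ L := by
    intro j
    by_cases hd : Δ j = 0
    · exact ⟨0, fun hj => ⟨by rw [show r (j + 1) = r j by simpa [hΔ, sub_eq_zero] using hd]; simp,
        by simpa using hL0⟩⟩
    · refine ⟨(fl j (r (j + 1)) - fl j (r j)) / Δ j, fun hj => ⟨by field_simp, ?_⟩⟩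
      rw [abs_div, div_le_iff₀ (abs_pos.2 hd)]
      exact hfl j hj _ _
  choose β hβ using hβ
  set s : ℕ → ℝ := fun j => if 1 ≤ j ∧ j ≤ N then lam / 2 * (α - β j) * Δ j else 0 with hs
  set z : ℕ → ℝ := fun j => if 1 ≤ j ∧ j ≤ N then lam / 2 * (α + β (j - 1)) * Δ (j - 1) else 0
    with hz
  set g : ℕ → ℝ := fun j => if 1 ≤ j ∧ j ≤ N then lam * (fl j (r j) - fl (j - 1) (r j)) else 0
    with hg
  set ε : ℕ → ℝ := fun j => if 1 ≤ j ∧ j ≤ N then 0 else r' j - r j with hε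
  have c0 : ∀ j ≤ N, 0 ≤ lam / 2 * (α - β j) ∧ 0 ≤ lam / 2 * (α + β j) := fun j hj => by
    have := abs_le.1 (hβ j hj).2
    exact ⟨mul_nonneg (by linarith) (by linarith), mul_nonneg (by linarith) (by linarith)⟩
  have hstep : ∀ j ≤ N + 1, r' j = r j + s j - z j - g j + ε j := by
    intro j hj
    by_cases hj1 : 1 ≤ j ∧ j ≤ N
    · simp only [hs, hz, hg, hε, if_pos hj1]
      obtain ⟨i, rfl⟩ : ∃ i, j = i + 1 := ⟨j - 1, by omega⟩
      rw [hr' i hj1.2, Nat.add_sub_cancel]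
      have e1 := (hβ (i + 1) hj1.2).1
      have e2 := (hβ i (by omega)).1
      simp only [hΔ] at *
      unfold laxStep laxFlux
      linear_combination (-lam / 2) * e1 - (lam / 2) * e2
    · simp only [hs, hz, hg, hε, if_neg hj1]; ring
  have hs0 : s 0 = 0 := by simp [hs]
  have hs1 : s (N + 1) = 0 := by simp [hs]
  have hz0 : z 0 = 0 := by simp [hz]
  have hz1 : z (N + 1) = 0 := by simp [hz]
  have hsj : ∀ j ≤ N, ∃ c, 0 ≤ c ∧ c ≤ lam / 2 * (α - β j) ∧ s j = c * Δ j := fun j hj => by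
    by_cases hj1 : 1 ≤ j ∧ j ≤ N
    · exact ⟨_, (c0 j hj).1, le_rfl, by simp only [hs, if_pos hj1]⟩
    · exact ⟨0, le_rfl, (c0 j hj).1, by simp only [hs, if_neg hj1]; ring⟩
  have hzj : ∀ j ≤ N, ∃ c, 0 ≤ c ∧ c ≤ lam / 2 * (α + β j) ∧ z (j + 1) = c * Δ j := fun j hj => by
    by_cases hj1 : 1 ≤ j + 1 ∧ j + 1 ≤ N
    · exact ⟨_, (c0 j hj).2, le_rfl, by simp only [hz, if_pos hj1, Nat.add_sub_cancel]⟩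
    · exact ⟨0, le_rfl, (c0 j hj).2, by simp only [hz, if_neg hj1]; ring⟩
  have hsz : ∀ j ≤ N, |r (j + 1) - r j - s j - z (j + 1)|
      ≤ |r (j + 1) - r j| - |s j| - |z (j + 1)| := by
    intro j hj
    obtain ⟨c, hc, hc', ec⟩ := hsj j hj
    obtain ⟨d, hd, hd', ed⟩ := hzj j hj
    rw [ec, ed]
    have e : r (j + 1) - r j - c * Δ j - d * Δ j = (1 - c - d) * Δ j := by simp only [hΔ]; ring
    rw [e, abs_mul, abs_mul, abs_mul, abs_of_nonneg hc, abs_of_nonneg hd,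
      abs_of_nonneg (by linarith : (0 : ℝ) ≤ 1 - c - d)]
    simp only [hΔ]; linarith
  have hgb : ∀ j, |g j| ≤ lam * c₁ := fun j => by
    by_cases hj1 : 1 ≤ j ∧ j ≤ N
    · obtain ⟨i, rfl⟩ : ∃ i, j = i + 1 := ⟨j - 1, by omega⟩
      simp only [hg, if_pos hj1, Nat.add_sub_cancel]
      rw [abs_mul, abs_of_nonneg hlam]
      exact mul_le_mul_of_nonneg_left (h1 i hj1.2) hlam
    · simp only [hg, if_neg hj1, abs_zero]; positivity
  constructor
  · refine (sum_abs_diff_le hstep hsz hs0 hs1 hz0 hz1).trans ?_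
    rw [Finset.sum_add_distrib]
    obtain ⟨n, rfl⟩ : ∃ n, N = n + 1 := ⟨N - 1, by omega⟩
    have hεs : ∑ j ∈ Finset.range (n + 1 + 1), (|ε (j + 1)| + |ε j|)
        = |r' 0 - r 0| + |r' (n + 1 + 1) - r (n + 1 + 1)| := by
      rw [Finset.sum_add_distrib, Finset.sum_range_succ, Finset.sum_range_succ' (fun j => |ε j|)]
      have e0 : ∀ j ∈ Finset.range (n + 1), |ε (j + 1)| = 0 := fun j hj => by
        have := Finset.mem_range.1 hj
        simp only [hε]
        rw [if_pos ⟨by omega, by omega⟩, abs_zero]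
      rw [Finset.sum_eq_zero e0]
      simp only [hε]
      rw [if_neg (by omega), if_neg (by omega)]
      ring
    have hgs : ∑ j ∈ Finset.range (n + 1 + 1), |g (j + 1) - g j|
        ≤ lam * c₂ * (∑ j ∈ Finset.range (n + 1 + 1), |Δ j|)
          + lam * (2 * c₁ + (n + 1 : ℕ) * c₃) := by
      rw [Finset.sum_range_succ, Finset.sum_range_succ', Finset.sum_range_succ,
        Finset.sum_range_succ']
      have g0 : g 0 = 0 := by simp [hg]
      have g1 : g (n + 1 + 1) = 0 := by simp [hg]
      have hb : ∀ j ∈ Finset.range n, |g (j + 1 + 1) - g (j + 1)|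
          ≤ lam * c₂ * |Δ (j + 1)| + lam * c₃ := by
        intro j hj
        have hj' := Finset.mem_range.1 hj
        simp only [hg]
        rw [if_pos ⟨by omega, by omega⟩, if_pos ⟨by omega, by omega⟩, ← mul_sub, abs_mul,
          abs_of_nonneg hlam]
        have := mul_le_mul_of_nonneg_left (h2 j (by omega)) hlam
        simp only [Nat.add_sub_cancel, hΔ]
        linarith
      have hb' := Finset.sum_le_sum hb
      rw [Finset.sum_add_distrib, ← Finset.mul_sum, Finset.sum_const, Finset.card_range,
        nsmul_eq_mul] at hb'
      rw [g0, g1, zero_sub, abs_neg, zero_add, sub_zero]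
      have b1 := hgb 1
      have b2 := hgb (n + 1)
      have p1 : 0 ≤ lam * c₂ * |Δ 0| := by positivity
      have p2 : 0 ≤ lam * c₂ * |Δ (n + 1)| := by positivity
      have p3 : 0 ≤ lam * c₃ := by positivity
      push_cast
      linarith
    rw [hεs]
    linarith
  · have hb : ∀ j ∈ Finset.range N, |r' (j + 1) - r (j + 1)|
        ≤ lam * α * |Δ (j + 1)| + lam * α * |Δ j| + lam * c₁ := by
      intro j hj
      have hj' := Finset.mem_range.1 hj
      have e : r' (j + 1) - r (j + 1) = s (j + 1) - z (j + 1) - g (j + 1) := by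
        rw [hstep (j + 1) (by omega)]
        have : ε (j + 1) = 0 := by simp only [hε]; rw [if_pos ⟨by omega, by omega⟩]
        rw [this]; ring
      rw [e]
      obtain ⟨c, hc, hc', ec⟩ := hsj (j + 1) (by omega)
      obtain ⟨d, hd, hd', ed⟩ := hzj j (by omega)
      have t1 := abs_sub (s (j + 1) - z (j + 1)) (g (j + 1))
      have t2 := abs_sub (s (j + 1)) (z (j + 1))
      have k1 := c0 (j + 1) (by omega)
      have k2 := c0 j (by omega)
      have t3 : |s (j + 1)| ≤ lam * α * |Δ (j + 1)| := by
        rw [ec, abs_mul, abs_of_nonneg hc]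
        exact mul_le_mul_of_nonneg_right (by linarith) (abs_nonneg _)
      have t4 : |z (j + 1)| ≤ lam * α * |Δ j| := by
        rw [ed, abs_mul, abs_of_nonneg hd]
        exact mul_le_mul_of_nonneg_right (by linarith) (abs_nonneg _)
      linarith [hgb (j + 1)]
    refine (Finset.sum_le_sum hb).trans ?_
    rw [Finset.sum_add_distrib, Finset.sum_add_distrib, ← Finset.mul_sum, ← Finset.mul_sum,
      Finset.sum_const, Finset.card_range, nsmul_eq_mul]
    have s1 : ∑ j ∈ Finset.range N, |Δ (j + 1)| ≤ ∑ j ∈ Finset.range (N + 1), |Δ j| := by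
      rw [Finset.sum_range_succ' (fun j => |Δ j|)]; linarith [abs_nonneg (Δ 0)]
    have s2 : ∑ j ∈ Finset.range N, |Δ j| ≤ ∑ j ∈ Finset.range (N + 1), |Δ j| := by
      rw [Finset.sum_range_succ (fun j => |Δ j|)]; linarith [abs_nonneg (Δ N)]
    have hla : 0 ≤ lam * α := mul_nonneg hlam (hL0.trans hL)
    have := mul_le_mul_of_nonneg_left s1 hla
    have := mul_le_mul_of_nonneg_left s2 hla
    simp only [hΔ] at *
    linarith


/-! ### The data -/

/-- The properties of a boundary or initial datum `u` that are used, in terms of a representative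
`v` bounded by `D` and of total variation at most `V`. -/
structure DatumRep (u : ℝ → ℝ) (s : Set ℝ) (v : ℝ → ℝ) (D V : ℝ) : Prop where
  isOpen : IsOpen s
  D_nonneg : 0 ≤ D
  abs_le : ∀ x ∈ s, |v x| ≤ D
  ae_eq : u =ᵐ[volume.restrict s] v
  ae_nonneg : ∀ᵐ x ∂(volume.restrict s), 0 ≤ u x
  aemeasurable : AEMeasurable v (volume.restrict s)
  variation : ∀ (n : ℕ) (p : ℕ → ℝ), MonotoneOn p (Iic n) → (∀ i ≤ n, p i ∈ s) →
    ∑ i ∈ Finset.range n, |v (p (i + 1)) - v (p i)| ≤ V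
  ae_continuousAt : ∀ᵐ x ∂(volume.restrict s), ContinuousAt v x

theorem IsBVDatum.exists_rep {u : ℝ → ℝ} {s : Set ℝ} (hu : IsBVDatum u s) (hs : IsOpen s)
    (hne : s.Nonempty) : ∃ v D V, DatumRep u s v D V := by
  obtain ⟨⟨v, hv, huv⟩, hnn⟩ := hu
  obtain ⟨x₀, hx₀⟩ := hne
  refine ⟨v, |v x₀| + (eVariationOn v s).toReal, (eVariationOn v s).toReal, hs, ?_, ?_, huv, hnn,
    ?_, ?_, ?_⟩
  · positivity
  · intro x hx
    have := hv.dist_le hx hx₀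
    rw [Real.dist_eq] at this
    have h2 := abs_add_le (v x - v x₀) (v x₀)
    rw [sub_add_cancel] at h2
    linarith
  · obtain ⟨p, q, hp, hq, e⟩ :=
      hv.locallyBoundedVariationOn.exists_monotoneOn_sub_monotoneOn
    have h1 := (aemeasurable_restrict_of_monotoneOn (μ := volume) hs.measurableSet hp).sub
      (aemeasurable_restrict_of_monotoneOn (μ := volume) hs.measurableSet hq)
    rwa [← e] at h1
  · intro n p hp hps
    have h := eVariationOn.sum_le_of_monotoneOn_Iic (f := v) hp hps
    have h' := ENNReal.toReal_mono hv h
    rw [ENNReal.toReal_sum (fun _ _ => edist_ne_top _ _)] at h'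
    refine le_trans (le_of_eq (Finset.sum_congr rfl fun i _ => ?_)) h'
    rw [← Real.dist_eq, dist_edist]
  · filter_upwards [hv.locallyBoundedVariationOn.ae_differentiableWithinAt hs.measurableSet,
      ae_restrict_mem hs.measurableSet] with x hx hxs
    exact hx.continuousWithinAt.continuousAt (hs.mem_nhds hxs)

/-- The mean of `u` over `[c, c + ℓ]` -/
noncomputable def mean (u : ℝ → ℝ) (ℓ c : ℝ) : ℝ := 1 / ℓ * ∫ x in c..(c + ℓ), u x

theorem ae_restrict_uIoc_of_ae {s : Set ℝ} {P : ℝ → Prop} {c d : ℝ} (hcd : c ≤ d)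
    (h : ∀ᵐ x ∂(volume.restrict s), P x) (hsub : Ioo c d ⊆ s) :
    ∀ᵐ x ∂(volume.restrict (uIoc c d)), P x := by
  rw [uIoc_of_le hcd, ← restrict_Ioo_eq_restrict_Ioc]
  exact ae_mono (Measure.restrict_mono hsub le_rfl) h

section DatumRep
variable {u v : ℝ → ℝ} {s : Set ℝ} {D V : ℝ} (hu : DatumRep u s v D V)
include hu

theorem DatumRep.ae_le : ∀ᵐ x ∂(volume.restrict s), u x ≤ D := by
  filter_upwards [hu.ae_eq, ae_restrict_mem hu.isOpen.measurableSet] with x hx hxs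
  rw [hx]; exact (le_abs_self _).trans (hu.abs_le x hxs)

theorem DatumRep.ae_abs_le : ∀ᵐ x ∂(volume.restrict s), |u x| ≤ D := by
  filter_upwards [hu.ae_le, hu.ae_nonneg] with x h1 h2
  rwa [abs_of_nonneg h2]

theorem DatumRep.aemeasurable' : AEMeasurable u (volume.restrict s) :=
  hu.aemeasurable.congr hu.ae_eq.symm

theorem DatumRep.intervalIntegrable {c d : ℝ} (hcd : c ≤ d) (hsub : Ioo c d ⊆ s) :
    IntervalIntegrable u volume c d := by
  rw [intervalIntegrable_iff, uIoc_of_le hcd, integrableOn_Ioc_iff_integrableOn_Ioo]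
  refine Integrable.of_bound (C := D) ?_ ?_
  · have := hu.aemeasurable'.mono_measure (Measure.restrict_mono hsub le_rfl)
    exact this.aestronglyMeasurable
  · exact ae_mono (Measure.restrict_mono hsub le_rfl) hu.ae_abs_le

theorem DatumRep.integral_eq {c d : ℝ} (hcd : c ≤ d) (hsub : Ioo c d ⊆ s) :
    ∫ x in c..d, u x = ∫ x in c..d, v x :=
  intervalIntegral.integral_congr_ae_restrict (ae_restrict_uIoc_of_ae hcd hu.ae_eq hsub)

theorem DatumRep.intervalIntegrable_rep {c d : ℝ} (hcd : c ≤ d) (hsub : Ioo c d ⊆ s) :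
    IntervalIntegrable v volume c d :=
  (hu.intervalIntegrable hcd hsub).congr_ae (ae_restrict_uIoc_of_ae hcd hu.ae_eq hsub)

theorem DatumRep.mean_nonneg {ℓ c : ℝ} (hℓ : 0 < ℓ) (hsub : Ioo c (c + ℓ) ⊆ s) :
    0 ≤ mean u ℓ c := by
  refine mul_nonneg (by positivity) ?_
  refine intervalIntegral.integral_nonneg_of_ae_restrict (by linarith) ?_
  have := ae_restrict_uIoc_of_ae (show c ≤ c + ℓ by linarith) hu.ae_nonneg hsub
  rw [uIoc_of_le (by linarith), restrict_Ioc_eq_restrict_Icc] at this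
  exact this

theorem DatumRep.mean_le {ℓ c : ℝ} (hℓ : 0 < ℓ) (hsub : Ioo c (c + ℓ) ⊆ s) :
    mean u ℓ c ≤ D := by
  have h := intervalIntegral.norm_integral_le_of_norm_le_const_ae (f := u) (a := c) (b := c + ℓ)
    (C := D) ((ae_restrict_iff' measurableSet_uIoc).1
      (ae_restrict_uIoc_of_ae (show c ≤ c + ℓ by linarith) hu.ae_abs_le hsub))
  rw [add_sub_cancel_left, abs_of_pos hℓ, Real.norm_eq_abs] at h
  unfold mean
  rw [one_div, inv_mul_le_iff₀ hℓ]
  linarith [le_abs_self (∫ x in c..(c + ℓ), u x)]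

theorem DatumRep.sum_mean_le {ℓ c : ℝ} (hℓ : 0 < ℓ) (n : ℕ)
    (hsub : Ioo c (c + (n + 1 : ℕ) * ℓ) ⊆ s) :
    ∑ i ∈ Finset.range n, |mean u ℓ (c + (i + 1 : ℕ) * ℓ) - mean u ℓ (c + i * ℓ)| ≤ V := by
  have hsub' : ∀ i ≤ n, Ioo (c + i * ℓ) (c + i * ℓ + ℓ) ⊆ s := by
    intro i hi
    refine Subset.trans (Ioo_subset_Ioo ?_ ?_) hsub
    · have : (0 : ℝ) ≤ i := Nat.cast_nonneg i
      nlinarith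
    · have : (i : ℝ) ≤ n := Nat.cast_le.2 hi
      push_cast
      nlinarith
  have hm : ∀ i ≤ n, mean u ℓ (c + i * ℓ) = 1 / ℓ * ∫ y in (0 : ℝ)..ℓ, v (c + i * ℓ + y) := by
    intro i hi
    unfold mean
    rw [hu.integral_eq (by linarith) (hsub' i hi)]
    rw [intervalIntegral.integral_comp_add_left (fun y => v y), add_zero]
  have hint : ∀ i ≤ n, IntervalIntegrable (fun y => v (c + i * ℓ + y)) volume 0 ℓ := by
    intro i hi
    have := (hu.intervalIntegrable_rep (by linarith) (hsub' i hi)).comp_add_left (c + i * ℓ)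
    simpa using this
  have hle : ∀ i ∈ Finset.range n, |mean u ℓ (c + (i + 1 : ℕ) * ℓ) - mean u ℓ (c + i * ℓ)|
      ≤ 1 / ℓ * ∫ y in (0 : ℝ)..ℓ, |v (c + (i + 1 : ℕ) * ℓ + y) - v (c + i * ℓ + y)| := by
    intro i hi
    have hi' := Finset.mem_range.1 hi
    rw [hm (i + 1) (by omega), hm i (by omega), ← mul_sub,
      ← intervalIntegral.integral_sub (hint _ (by omega)) (hint _ (by omega)), abs_mul,
      abs_of_pos (by positivity : 0 < 1 / ℓ)]
    gcongr
    exact intervalIntegral.abs_integral_le_integral_abs hℓ.le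
  refine (Finset.sum_le_sum hle).trans ?_
  have hint' : ∀ i ∈ Finset.range n, IntervalIntegrable
      (fun y => |v (c + (i + 1 : ℕ) * ℓ + y) - v (c + i * ℓ + y)|) volume 0 ℓ := fun i hi => by
    have hi' := Finset.mem_range.1 hi
    exact ((hint (i + 1) (by omega)).sub (hint i (by omega))).abs
  rw [← Finset.mul_sum, ← intervalIntegral.integral_finsetSum hint', one_div,
    inv_mul_le_iff₀ hℓ]
  have hsum : ∫ y in (0 : ℝ)..ℓ, ∑ i ∈ Finset.range n,
      |v (c + (i + 1 : ℕ) * ℓ + y) - v (c + i * ℓ + y)| ≤ ∫ _ in (0 : ℝ)..ℓ, V := by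
    refine intervalIntegral.integral_mono_on_of_le_Ioo hℓ.le
      ((IntervalIntegrable.sum _ hint').congr (fun y _ => by simp only [Finset.sum_apply]))
      intervalIntegrable_const fun y hy => ?_
    refine hu.variation n (fun i => c + i * ℓ + y) (fun i _ j _ hij => ?_) (fun i hi => ?_)
    · have : (i : ℝ) ≤ j := Nat.cast_le.2 hij
      simp only
      nlinarith
    · exact hsub' i hi ⟨by linarith [hy.1], by linarith [hy.2]⟩
  simpa using hsum

/-- Lebesgue differentiation for the data. -/
theorem DatumRep.ae_tendsto_mean : ∀ᵐ x ∂(volume.restrict s), ∀ c ℓ : ℕ → ℝ,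
    (∀ m, 0 < ℓ m) → (∀ m, Ioo (c m) (c m + ℓ m) ⊆ s) → (∀ m, x ∈ Icc (c m) (c m + ℓ m)) →
    Tendsto ℓ atTop (𝓝 0) → Tendsto (fun m => mean u (ℓ m) (c m)) atTop (𝓝 (u x)) := by
  filter_upwards [hu.ae_continuousAt, hu.ae_eq] with x hx hxe c ℓ hℓ hsub hmem hlim
  rw [hxe, Metric.tendsto_atTop]
  intro ε hε
  obtain ⟨δ, hδ, hδ'⟩ := Metric.continuousAt_iff.1 hx (ε / 2) (by positivity)
  obtain ⟨m₀, hm₀⟩ := Metric.tendsto_atTop.1 hlim δ hδ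
  refine ⟨m₀, fun m hm => ?_⟩
  have hℓδ : ℓ m < δ := by simpa [abs_of_pos (hℓ m)] using hm₀ m hm
  have hle : c m ≤ c m + ℓ m := by linarith [hℓ m]
  have e : mean u (ℓ m) (c m) - v x = 1 / ℓ m * ∫ y in (c m)..(c m + ℓ m), (v y - v x) := by
    unfold mean
    rw [hu.integral_eq hle (hsub m), intervalIntegral.integral_sub
      (hu.intervalIntegrable_rep hle (hsub m)) intervalIntegrable_const,
      intervalIntegral.integral_const, add_sub_cancel_left, smul_eq_mul]
    have := (hℓ m).ne'
    field_simp
  have hb := intervalIntegral.norm_integral_le_of_norm_le_const (a := c m) (b := c m + ℓ m)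
    (f := fun y => v y - v x) (C := ε / 2) fun y hy => by
      rw [uIoc_of_le hle] at hy
      have hyx : dist y x < δ := by
        have hx' := hmem m
        rw [Real.dist_eq, abs_lt]
        constructor <;> linarith [hy.1, hy.2, hx'.1, hx'.2]
      rw [← dist_eq_norm]
      exact (hδ' hyx).le
  rw [Real.dist_eq, e, abs_mul, abs_of_pos (by have := hℓ m; positivity : 0 < 1 / ℓ m), one_div,
    inv_mul_lt_iff₀ (hℓ m)]
  rw [add_sub_cancel_left, abs_of_pos (hℓ m), Real.norm_eq_abs] at hb
  have := hℓ m
  nlinarith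

end DatumRep

theorem timeMean_eq (u : ℝ → ℝ) (τ : ℝ) (n : ℕ) : timeMean u τ n = mean u τ (n * τ) := by
  unfold timeMean mean
  rw [add_mul, one_mul]


/-! ### A priori estimates for the scheme -/

/-- The flux function `u ↦ f (t^n, x_{j+1/2}, u, R^n_{j+1/2})` at an interface -/
noncomputable def interfaceFlux (a : ℝ) (f : ℝ → ℝ → ℝ → ℝ → ℝ) (ω : ℝ → ℝ) (N : ℕ) (h τ : ℝ)
    (S : ℕ → ℕ → ℝ) (n j : ℕ) (u : ℝ) : ℝ :=
  f (n * τ) (a + j * h) u (discreteNonlocal ω N h (S n) j)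

/-- `S` solves the scheme on a mesh with `N` cells, with data bounded by `D` and of total variation
at most `V`. -/
structure IsScheme (a b : ℝ) (f : ℝ → ℝ → ℝ → ℝ → ℝ) (ω : ℝ → ℝ) (L α D V : ℝ) (N : ℕ) (h τ : ℝ)
    (S : ℕ → ℕ → ℝ) : Prop where
  N_pos : 1 ≤ N
  h_pos : 0 < h
  τ_pos : 0 < τ
  mesh : N * h = b - a
  L_le : L ≤ α
  lam_le : τ / h * α ≤ 1 / 3
  step : ∀ n j, j + 1 ≤ N → S (n + 1) (j + 1)
    = laxStep (τ / h) α (interfaceFlux a f ω N h τ S n j) (interfaceFlux a f ω N h τ S n (j + 1))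
        (S n j) (S n (j + 1)) (S n (j + 2))
  left : ∀ n, 0 ≤ S n 0 ∧ S n 0 ≤ D
  right : ∀ n, 0 ≤ S n (N + 1) ∧ S n (N + 1) ≤ D
  init : ∀ j ≤ N + 1, 0 ≤ S 0 j ∧ S 0 j ≤ D
  left_var : ∀ n, ∑ i ∈ Finset.range n, |S (i + 1) 0 - S i 0| ≤ V
  right_var : ∀ n, ∑ i ∈ Finset.range n, |S (i + 1) (N + 1) - S i (N + 1)| ≤ V
  init_var : ∑ j ∈ Finset.range (N + 1), |S 0 (j + 1) - S 0 j| ≤ V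

section IsScheme
variable {a b L C α D V h τ : ℝ} {f : ℝ → ℝ → ℝ → ℝ → ℝ} {ω : ℝ → ℝ} {N : ℕ} {S : ℕ → ℕ → ℝ}
  (hf : FluxAssumption a b L C f) (hS : IsScheme a b f ω L α D V N h τ S)
include hS

theorem IsScheme.interface_mem {j : ℕ} (hj : j ≤ N) : a + j * h ∈ Icc a b := by
  have h1 := hS.h_pos
  have h2 := hS.mesh
  have h3 : (0 : ℝ) ≤ j := Nat.cast_nonneg j
  have h4 : (j : ℝ) ≤ N := Nat.cast_le.2 hj
  constructor <;> nlinarith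

theorem IsScheme.time_nonneg (n : ℕ) : 0 ≤ n * τ :=
  mul_nonneg (Nat.cast_nonneg n) hS.τ_pos.le

theorem IsScheme.D_nonneg : 0 ≤ D := (hS.left 0).1.trans (hS.left 0).2

theorem IsScheme.lam_nonneg : 0 ≤ τ / h := (div_pos hS.τ_pos hS.h_pos).le

include hf

theorem IsScheme.interfaceFlux_lip (n : ℕ) {j : ℕ} (hj : j ≤ N) (u v : ℝ) :
    |interfaceFlux a f ω N h τ S n j u - interfaceFlux a f ω N h τ S n j v| ≤ L * |u - v| :=
  hf.abs_sub_le (hS.time_nonneg n) (hS.interface_mem hj) _ _ _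

theorem IsScheme.interfaceFlux_zero (n : ℕ) {j : ℕ} (hj : j ≤ N) :
    interfaceFlux a f ω N h τ S n j 0 = 0 :=
  hf.zero _ (hS.time_nonneg n) _ (hS.interface_mem hj) _

theorem IsScheme.mono (n : ℕ) {j : ℕ} (hj : j + 1 ≤ N) {u v w u' v' w' : ℝ} (hu : u ≤ u')
    (hv : v ≤ v') (hw : w ≤ w') :
    laxStep (τ / h) α (interfaceFlux a f ω N h τ S n j) (interfaceFlux a f ω N h τ S n (j + 1))
      u v w ≤ laxStep (τ / h) α (interfaceFlux a f ω N h τ S n j)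
        (interfaceFlux a f ω N h τ S n (j + 1)) u' v' w' :=
  laxStep_mono hS.lam_nonneg hS.L_le hS.lam_le (hS.interfaceFlux_lip hf n (by omega))
    (hS.interfaceFlux_lip hf n hj) hu hv hw

theorem IsScheme.nonneg (n : ℕ) : ∀ j ≤ N + 1, 0 ≤ S n j := by
  induction n with
  | zero => exact fun j hj => (hS.init j hj).1
  | succ n ih =>
    intro j hj
    rcases Nat.eq_zero_or_pos j with rfl | hj0
    · exact (hS.left _).1
    rcases Nat.lt_or_ge N j with hj1 | hj1
    · rw [show j = N + 1 by omega]; exact (hS.right _).1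
    obtain ⟨i, rfl⟩ : ∃ i, j = i + 1 := ⟨j - 1, by omega⟩
    rw [hS.step n i hj1]
    refine le_trans (le_of_eq ?_) (hS.mono hf n hj1 (ih i (by omega)) (ih (i + 1) (by omega))
      (ih (i + 2) (by omega)))
    simp [laxStep, laxFlux, hS.interfaceFlux_zero hf n hj1,
      hS.interfaceFlux_zero hf n (show i ≤ N by omega)]

theorem IsScheme.mass_le (n : ℕ) :
    h * ∑ k ∈ Finset.Icc 1 N, |S n k| ≤ (b - a) * D + 2 * α * D * (n * τ) := by
  have habs : ∀ n, ∑ k ∈ Finset.Icc 1 N, |S n k| = ∑ i ∈ Finset.range N, S n (i + 1) := by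
    intro n
    rw [sum_Icc_one_eq_range]
    refine Finset.sum_congr rfl fun i hi => abs_of_nonneg (hS.nonneg hf n _ ?_)
    have := Finset.mem_range.1 hi; omega
  rw [habs]
  have hα : 0 ≤ α := hf.L_pos.le.trans hS.L_le
  have hh := hS.h_pos
  induction n with
  | zero =>
    have : ∑ i ∈ Finset.range N, S 0 (i + 1) ≤ ∑ i ∈ Finset.range N, D :=
      Finset.sum_le_sum fun i hi => (hS.init _ (by have := Finset.mem_range.1 hi; omega)).2
    rw [Finset.sum_const, Finset.card_range, nsmul_eq_mul] at this
    have := mul_le_mul_of_nonneg_left this hh.le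
    have e : h * (N * D) = (b - a) * D := by rw [← hS.mesh]; ring
    simp only [Nat.cast_zero, zero_mul, mul_zero, add_zero]
    linarith
  | succ n ih =>
    set F : ℕ → ℝ := fun j => laxFlux α (interfaceFlux a f ω N h τ S n j) (S n j) (S n (j + 1))
      with hF
    have e : ∑ i ∈ Finset.range N, S (n + 1) (i + 1)
        = ∑ i ∈ Finset.range N, S n (i + 1) - τ / h * (F N - F 0) := by
      rw [← Finset.sum_range_sub F, Finset.mul_sum, ← Finset.sum_sub_distrib]
      refine Finset.sum_congr rfl fun i hi => ?_
      have := Finset.mem_range.1 hi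
      rw [hS.step n i (by omega)]
      rfl
    have hb : ∀ j ≤ N, ∀ r, |interfaceFlux a f ω N h τ S n j r| ≤ L * |r| := fun j hj r =>
      hf.abs_le (hS.time_nonneg n) (hS.interface_mem hj) _ _
    have b0 := (laxFlux_bounds hS.L_le (hb 0 (by omega)) (hS.nonneg hf n 0 (by omega))
      (hS.nonneg hf n 1 (by omega))).2
    have b1 := (laxFlux_bounds hS.L_le (hb N le_rfl) (hS.nonneg hf n N (by omega))
      (hS.nonneg hf n (N + 1) le_rfl)).1
    have b0' := mul_le_mul_of_nonneg_left (hS.left n).2 hα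
    have b1' := mul_le_mul_of_nonneg_left (hS.right n).2 hα
    have hFd : -(2 * α * D) ≤ F N - F 0 := by
      simp only [hF, zero_add]; linarith
    have := mul_le_mul_of_nonneg_left hFd hS.τ_pos.le
    have e2 : h * ∑ i ∈ Finset.range N, S (n + 1) (i + 1)
      = h * ∑ i ∈ Finset.range N, S n (i + 1) - τ * (F N - F 0) := by
      rw [e]; have := hh.ne'; field_simp
    rw [e2]
    push_cast
    linarith

theorem IsScheme.le_of_nonlocal_lip (hab : a < b) {R₁ : ℝ} (hR₁ : 0 ≤ R₁) (n : ℕ)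
    (hR : ∀ i < n, ∀ j, j + 1 ≤ N →
      |discreteNonlocal ω N h (S i) (j + 1) - discreteNonlocal ω N h (S i) j| ≤ R₁ * h) :
    ∀ j ≤ N + 1, S n j ≤ D * (1 + C * (1 + R₁) * τ) ^ n := by
  have hD := hS.D_nonneg
  have hC := hf.C_pos
  have hτ := hS.τ_pos
  have h1 : 1 ≤ 1 + C * (1 + R₁) * τ := by
    have : 0 ≤ C * (1 + R₁) * τ := by positivity
    linarith
  induction n with
  | zero => simpa using fun j hj => (hS.init j hj).2
  | succ n ih =>
    have ih := ih fun i hi => hR i (by omega)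
    have hDle : D ≤ D * (1 + C * (1 + R₁) * τ) ^ (n + 1) :=
      le_mul_of_one_le_right hD (one_le_pow₀ h1)
    intro j hj
    rcases Nat.eq_zero_or_pos j with rfl | hj0
    · exact (hS.left _).2.trans hDle
    rcases Nat.lt_or_ge N j with hj1 | hj1
    · rw [show j = N + 1 by omega]; exact (hS.right _).2.trans hDle
    obtain ⟨i, rfl⟩ : ∃ i, j = i + 1 := ⟨j - 1, by omega⟩
    set X := D * (1 + C * (1 + R₁) * τ) ^ n with hX
    have hX0 : 0 ≤ X := by positivity
    rw [hS.step n i hj1]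
    refine (hS.mono hf n hj1 (ih i (by omega)) (ih (i + 1) (by omega))
      (ih (i + 2) (by omega))).trans ?_
    have hd : |interfaceFlux a f ω N h τ S n (i + 1) X - interfaceFlux a f ω N h τ S n i X|
        ≤ C * X * (1 + R₁) * h := by
      refine (hf.abs_sub_le_xR hab (hS.time_nonneg n) (hS.interface_mem (show i ≤ N by omega))
        (hS.interface_mem hj1) _ _ _).trans ?_
      rw [abs_of_nonneg hX0]
      have e : |a + ((i + 1 : ℕ) : ℝ) * h - (a + i * h)| = h := by
        rw [show a + ((i + 1 : ℕ) : ℝ) * h - (a + i * h) = h by push_cast; ring,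
          abs_of_pos hS.h_pos]
      rw [e]
      calc C * X * (h + _) ≤ C * X * (h + R₁ * h) := by
            gcongr; exact hR n (by omega) i hj1
        _ = _ := by ring
    have e : laxStep (τ / h) α (interfaceFlux a f ω N h τ S n i)
        (interfaceFlux a f ω N h τ S n (i + 1)) X X X
        = X - τ / h * (interfaceFlux a f ω N h τ S n (i + 1) X
          - interfaceFlux a f ω N h τ S n i X) := by
      unfold laxStep laxFlux; ring
    rw [e]
    have := mul_le_mul_of_nonneg_left ((abs_le.1 hd).1) hS.lam_nonneg
    have e2 : τ / h * -(C * X * (1 + R₁) * h) = -(C * X * (1 + R₁) * τ) := by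
      have := hS.h_pos.ne'; field_simp
    rw [e2] at this
    rw [pow_succ, ← mul_assoc, ← hX]
    linarith

/-- Second differences of the flux along a row. -/
theorem IsScheme.flux_second_diff (hab : a < b) {R₀ R₁ R₂ M T Λ : ℝ}
    (hM : 0 ≤ M) (hR₀ : 0 ≤ R₀) (hR₁ : 0 ≤ R₁) (hΛ0 : 0 ≤ Λ) {n : ℕ} (hn : n * τ ≤ T)
    (hΛ : ∀ p e d : ℝ × ℝ × ℝ × ℝ,
      p ∈ Icc 0 T ×ˢ Icc a b ×ˢ Icc (-M) M ×ˢ Icc (-(3 * R₀ + 1)) (3 * R₀ + 1) →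
      p + e ∈ Icc 0 T ×ˢ Icc a b ×ˢ Icc (-M) M ×ˢ Icc (-(3 * R₀ + 1)) (3 * R₀ + 1) →
      p + d ∈ Icc 0 T ×ˢ Icc a b ×ˢ Icc (-M) M ×ˢ Icc (-(3 * R₀ + 1)) (3 * R₀ + 1) →
      p + e + d ∈ Icc 0 T ×ˢ Icc a b ×ˢ Icc (-M) M ×ˢ Icc (-(3 * R₀ + 1)) (3 * R₀ + 1) →
      |uncurryFlux f (p + e + d) - uncurryFlux f (p + e) - uncurryFlux f (p + d)
        + uncurryFlux f p| ≤ Λ * ‖e‖ * ‖d‖)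
    (b0 : ∀ j ≤ N, |discreteNonlocal ω N h (S n) j| ≤ R₀)
    (b1 : ∀ j, j + 1 ≤ N →
      |discreteNonlocal ω N h (S n) (j + 1) - discreteNonlocal ω N h (S n) j| ≤ R₁ * h)
    (b2 : ∀ j, j + 2 ≤ N → |discreteNonlocal ω N h (S n) (j + 2)
      - 2 * discreteNonlocal ω N h (S n) (j + 1) + discreteNonlocal ω N h (S n) j| ≤ R₂ * h ^ 2)
    {j : ℕ} (hj : j + 2 ≤ N) {u u' : ℝ} (hu : |u| ≤ M) (hu' : |u'| ≤ M) :
    |(interfaceFlux a f ω N h τ S n (j + 2) u' - interfaceFlux a f ω N h τ S n (j + 1) u')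
      - (interfaceFlux a f ω N h τ S n (j + 1) u - interfaceFlux a f ω N h τ S n j u)|
      ≤ Λ * (1 + R₁) * h * |u' - u| + (Λ * (1 + R₁) ^ 2 + C * M * R₂) * h ^ 2 := by
  have hh := hS.h_pos
  have ht : n * τ ∈ Icc 0 T := ⟨hS.time_nonneg n, hn⟩
  have m0 := hS.interface_mem (show j ≤ N by omega)
  have m1 := hS.interface_mem (show j + 1 ≤ N by omega)
  have m2 := hS.interface_mem hj
  have r0 := abs_le.1 (b0 j (by omega))
  have r1 := abs_le.1 (b0 (j + 1) (by omega))
  have r2 := abs_le.1 (b0 (j + 2) hj)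
  have u1 := abs_le.1 hu
  have u2 := abs_le.1 hu'
  have d0 := b1 j (by omega)
  have d1 := b1 (j + 1) (by omega)
  have d2 := b2 j hj
  have x1 : a + ((j + 1 : ℕ) : ℝ) * h = a + j * h + h := by push_cast; ring
  have x2 : a + ((j + 2 : ℕ) : ℝ) * h = a + j * h + h + h := by push_cast; ring
  unfold interfaceFlux
  rw [x1] at m1
  rw [x2] at m2
  rw [x1, x2]
  set R := discreteNonlocal ω N h (S n)
  set x := a + j * h
  set t := n * τ
  have k1 := hΛ (t, x + h, u, R (j + 1)) (0, h, 0, R (j + 2) - R (j + 1)) (0, 0, u' - u, 0)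
    ⟨ht, m1, u1, by constructor <;> simp only <;> linarith⟩
    ⟨by simpa using ht, by simpa using m2, by simpa using u1, by
      simp only [Prod.mk_add_mk, mem_Icc]; constructor <;> linarith⟩
    ⟨by simpa using ht, by simpa using m1, by simpa using u2, by
      simp only [Prod.mk_add_mk, mem_Icc]; constructor <;> linarith⟩
    ⟨by simpa using ht, by simpa using m2, by simpa using u2, by
      simp only [Prod.mk_add_mk, mem_Icc]; constructor <;> linarith⟩
  have k2 := hΛ (t, x, u, R j) (0, h, 0, R (j + 1) - R j) (0, h, 0, R (j + 2) - R (j + 1))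
    ⟨ht, m0, u1, by constructor <;> simp only <;> linarith⟩
    ⟨by simpa using ht, by simpa using m1, by simpa using u1, by
      simp only [Prod.mk_add_mk, mem_Icc]; constructor <;> linarith⟩
    ⟨by simpa using ht, by simpa using m1, by simpa using u1, by
      simp only [Prod.mk_add_mk, mem_Icc]; constructor <;> linarith⟩
    ⟨by simpa using ht, by simpa using m2, by simpa using u1, by
      simp only [Prod.mk_add_mk, mem_Icc]; constructor <;> linarith⟩
  have n1 : ‖((0 : ℝ), h, (0 : ℝ), R (j + 2) - R (j + 1))‖ ≤ (1 + R₁) * h := by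
    simp only [Prod.norm_mk, Real.norm_eq_abs, abs_of_pos hh, abs_zero]
    have : 0 ≤ R₁ * h := by positivity
    refine max_le (by positivity) (max_le (by linarith) (max_le (by positivity) (by linarith)))
  have n2 : ‖((0 : ℝ), h, (0 : ℝ), R (j + 1) - R j)‖ ≤ (1 + R₁) * h := by
    simp only [Prod.norm_mk, Real.norm_eq_abs, abs_of_pos hh, abs_zero]
    have : 0 ≤ R₁ * h := by positivity
    refine max_le (by positivity) (max_le (by linarith) (max_le (by positivity) (by linarith)))
  have n3 : ‖((0 : ℝ), (0 : ℝ), u' - u, (0 : ℝ))‖ ≤ |u' - u| := by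
    simp [Prod.norm_mk]
  have k1' := k1.trans (mul_le_mul (mul_le_mul_of_nonneg_left n1 hΛ0) n3 (norm_nonneg _)
    (by positivity))
  have k2' := k2.trans (mul_le_mul (mul_le_mul_of_nonneg_left n2 hΛ0) n1 (norm_nonneg _)
    (by positivity))
  have k3 := hf.abs_sub_le_xR hab ht.1 m1 m1 u (R (j + 1)) (R j + (R (j + 2) - R (j + 1)))
  rw [sub_self, abs_zero, zero_add] at k3
  have k3' : C * |u| * |R j + (R (j + 2) - R (j + 1)) - R (j + 1)| ≤ C * M * (R₂ * h ^ 2) := by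
    have hC := hf.C_pos
    gcongr
    rwa [show R j + (R (j + 2) - R (j + 1)) - R (j + 1) = R (j + 2) - 2 * R (j + 1) + R j by ring]
  have k3 := k3.trans k3'
  simp only [uncurryFlux, Prod.mk_add_mk, add_zero, add_sub_cancel] at k1' k2'
  set A1 := f t (x + h + h) u' (R (j + 2))
  set A2 := f t (x + h + h) u (R (j + 2))
  set A3 := f t (x + h) u' (R (j + 1))
  set A4 := f t (x + h) u (R (j + 1))
  set A5 := f t (x + h) u (R j + (R (j + 2) - R (j + 1)))
  set A6 := f t x u (R j)
  have e : A1 - A3 - (A4 - A6) = (A1 - A2 - A3 + A4) + (A2 - A4 - A5 + A6) + (A5 - A4) := by ring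
  rw [e]
  refine (abs_add_three _ _ _).trans ?_
  nlinarith [k1', k2', k3]

theorem IsScheme.row_step (hab : a < b) {R₀ R₁ R₂ M T Λ : ℝ}
    (hM : 0 ≤ M) (hR₀ : 0 ≤ R₀) (hR₁ : 0 ≤ R₁) (hR₂ : 0 ≤ R₂) (hΛ0 : 0 ≤ Λ) {n : ℕ}
    (hn : n * τ ≤ T)
    (hΛ : ∀ p e d : ℝ × ℝ × ℝ × ℝ,
      p ∈ Icc 0 T ×ˢ Icc a b ×ˢ Icc (-M) M ×ˢ Icc (-(3 * R₀ + 1)) (3 * R₀ + 1) →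
      p + e ∈ Icc 0 T ×ˢ Icc a b ×ˢ Icc (-M) M ×ˢ Icc (-(3 * R₀ + 1)) (3 * R₀ + 1) →
      p + d ∈ Icc 0 T ×ˢ Icc a b ×ˢ Icc (-M) M ×ˢ Icc (-(3 * R₀ + 1)) (3 * R₀ + 1) →
      p + e + d ∈ Icc 0 T ×ˢ Icc a b ×ˢ Icc (-M) M ×ˢ Icc (-(3 * R₀ + 1)) (3 * R₀ + 1) →
      |uncurryFlux f (p + e + d) - uncurryFlux f (p + e) - uncurryFlux f (p + d)
        + uncurryFlux f p| ≤ Λ * ‖e‖ * ‖d‖)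
    (hSM : ∀ j ≤ N + 1, |S n j| ≤ M)
    (b0 : ∀ j ≤ N, |discreteNonlocal ω N h (S n) j| ≤ R₀)
    (b1 : ∀ j, j + 1 ≤ N →
      |discreteNonlocal ω N h (S n) (j + 1) - discreteNonlocal ω N h (S n) j| ≤ R₁ * h)
    (b2 : ∀ j, j + 2 ≤ N → |discreteNonlocal ω N h (S n) (j + 2)
      - 2 * discreteNonlocal ω N h (S n) (j + 1) + discreteNonlocal ω N h (S n) j| ≤ R₂ * h ^ 2) :
    (∑ j ∈ Finset.range (N + 1), |S (n + 1) (j + 1) - S (n + 1) j|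
      ≤ (1 + Λ * (1 + R₁) * τ) * ∑ j ∈ Finset.range (N + 1), |S n (j + 1) - S n j|
        + (|S (n + 1) 0 - S n 0| + |S (n + 1) (N + 1) - S n (N + 1)|)
        + (2 * (C * M * (1 + R₁)) + (b - a) * (Λ * (1 + R₁) ^ 2 + C * M * R₂)) * τ) ∧
    h * ∑ j ∈ Finset.range N, |S (n + 1) (j + 1) - S n (j + 1)|
      ≤ 2 * α * τ * (∑ j ∈ Finset.range (N + 1), |S n (j + 1) - S n j|)
        + (b - a) * (C * M * (1 + R₁)) * τ := by
  have hh := hS.h_pos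
  have hC := hf.C_pos
  have hdiff : ∀ j, j + 1 ≤ N → |interfaceFlux a f ω N h τ S n (j + 1) (S n (j + 1))
      - interfaceFlux a f ω N h τ S n j (S n (j + 1))| ≤ C * M * (1 + R₁) * h := by
    intro j hj
    refine (hf.abs_sub_le_xR hab (hS.time_nonneg n) (hS.interface_mem (show j ≤ N by omega))
      (hS.interface_mem hj) _ _ _).trans ?_
    have e : |a + ((j + 1 : ℕ) : ℝ) * h - (a + j * h)| = h := by
      rw [show a + ((j + 1 : ℕ) : ℝ) * h - (a + j * h) = h by push_cast; ring, abs_of_pos hh]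
    rw [e]
    calc _ ≤ C * M * (h + R₁ * h) := by
          gcongr
          · exact hSM _ (by omega)
          · exact b1 j hj
      _ = _ := by ring
  have key := laxStep_variation (N := N) (lam := τ / h) (α := α) (L := L)
      (c₁ := C * M * (1 + R₁) * h) (c₂ := Λ * (1 + R₁) * h)
      (c₃ := (Λ * (1 + R₁) ^ 2 + C * M * R₂) * h ^ 2) (r := S n) (r' := S (n + 1))
      (fl := interfaceFlux a f ω N h τ S n)
      hS.N_pos hS.lam_nonneg hf.L_pos.le hS.L_le hS.lam_le
      (fun j hj => hS.interfaceFlux_lip hf n hj) (fun j hj => hS.step n j hj) hdiff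
      (fun j hj => hS.flux_second_diff hf hab hM hR₀ hR₁ hΛ0 hn hΛ b0 b1 b2 hj
        (hSM _ (by omega)) (hSM _ (by omega)))
      (by positivity) (by positivity) (by positivity)
  constructor
  · refine key.1.trans (le_of_eq ?_)
    rw [← hS.mesh]
    field_simp
    ring
  · refine (mul_le_mul_of_nonneg_left key.2 hh.le).trans (le_of_eq ?_)
    rw [← hS.mesh]
    field_simp

end IsScheme

theorem discrete_gronwall {x e : ℕ → ℝ} {q c : ℝ} (hq : 1 ≤ q) (hc : 0 ≤ c) (he : ∀ n, 0 ≤ e n)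
    (n : ℕ) (hx : ∀ i < n, x (i + 1) ≤ q * x i + e i + c) :
    x n ≤ q ^ n * (x 0 + ∑ i ∈ Finset.range n, e i + n * c) := by
  induction n with
  | zero => simp
  | succ n ih =>
    have ih := ih fun i hi => hx i (by omega)
    have h1 := hx n (by omega)
    have hqn : 1 ≤ q ^ (n + 1) := one_le_pow₀ hq
    have h2 := mul_le_mul_of_nonneg_left ih (zero_le_one.trans hq)
    have h3 : e n + c ≤ q ^ (n + 1) * (e n + c) :=
      le_mul_of_one_le_left (add_nonneg (he n) hc) hqn
    rw [Finset.sum_range_succ]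
    push_cast
    rw [pow_succ] at *
    nlinarith

theorem one_add_pow_le_exp {c τ T : ℝ} {n : ℕ} (hc : 0 ≤ c) (hτ : 0 ≤ τ) (hn : n * τ ≤ T) :
    (1 + c * τ) ^ n ≤ Real.exp (c * T) := by
  calc (1 + c * τ) ^ n ≤ (Real.exp (c * τ)) ^ n := by
        gcongr; linarith [Real.add_one_le_exp (c * τ)]
    _ = Real.exp (n * (c * τ)) := (Real.exp_nat_mul _ _).symm
    _ ≤ _ := Real.exp_le_exp.2 (by nlinarith)

/-- The a priori estimates for the row `n` of the scheme. -/
structure RowBounds (ω : ℝ → ℝ) (M V' K R₁ : ℝ) (N : ℕ) (h τ : ℝ) (S : ℕ → ℕ → ℝ) (n : ℕ) :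
    Prop where
  nonneg : ∀ j ≤ N + 1, 0 ≤ S n j
  le : ∀ j ≤ N + 1, S n j ≤ M
  variation : ∑ j ∈ Finset.range (N + 1), |S n (j + 1) - S n j| ≤ V'
  time : h * ∑ j ∈ Finset.range N, |S (n + 1) (j + 1) - S n (j + 1)| ≤ K * τ
  nonlocal : ∀ j, j + 1 ≤ N →
    |discreteNonlocal ω N h (S n) (j + 1) - discreteNonlocal ω N h (S n) j| ≤ R₁ * h

theorem exists_rowBounds {a b L C : ℝ} (hab : a < b) {f : ℝ → ℝ → ℝ → ℝ → ℝ}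
    (hf : FluxAssumption a b L C f) {ω : ℝ → ℝ} (hω : KernelAssumption a b ω) {α D V : ℝ}
    (hD : 0 ≤ D) (hV : 0 ≤ V) (hα : L ≤ α) :
    ∃ h₀ > 0, ∀ T > 0, ∃ M V' K R₁ : ℝ, 0 ≤ M ∧ 0 ≤ V' ∧ 0 ≤ K ∧ 0 ≤ R₁ ∧
      ∀ (N : ℕ) (h τ : ℝ) (S : ℕ → ℕ → ℝ), h ≤ h₀ → IsScheme a b f ω L α D V N h τ S →
        ∀ n : ℕ, n * τ ≤ T → RowBounds ω M V' K R₁ N h τ S n := by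
  obtain ⟨B, hB⟩ := hω.exists_bound
  obtain ⟨κ, hκ, h₀, hh₀, hmass⟩ := hω.exists_discreteMass_lower_bound hab
  refine ⟨h₀, hh₀, fun T hT => ?_⟩
  have hBp := hB.pos
  have hC := hf.C_pos
  have hα0 : 0 ≤ α := hf.L_pos.le.trans hα
  have hw : 0 ≤ b - a := (sub_pos.2 hab).le
  obtain ⟨ℓ, hℓ⟩ : ∃ ℓ, ℓ = (b - a) * D + 2 * α * D * T := ⟨_, rfl⟩
  have hℓ0 : 0 ≤ ℓ := by rw [hℓ]; positivity
  obtain ⟨R₀, R₁, R₂, hR₀, hR₁, hR₂, bounds⟩ : ∃ R₀ R₁ R₂ : ℝ, 0 ≤ R₀ ∧ 0 ≤ R₁ ∧ 0 ≤ R₂ ∧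
      ∀ (N : ℕ) (h τ : ℝ) (S : ℕ → ℕ → ℝ), h ≤ h₀ → IsScheme a b f ω L α D V N h τ S →
        ∀ n : ℕ, n * τ ≤ T → (∀ j ≤ N, |discreteNonlocal ω N h (S n) j| ≤ R₀) ∧
        (∀ j, j + 1 ≤ N →
          |discreteNonlocal ω N h (S n) (j + 1) - discreteNonlocal ω N h (S n) j| ≤ R₁ * h) ∧
        (∀ j, j + 2 ≤ N → |discreteNonlocal ω N h (S n) (j + 2)
          - 2 * discreteNonlocal ω N h (S n) (j + 1) + discreteNonlocal ω N h (S n) j|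
            ≤ R₂ * h ^ 2) := by
    refine ⟨B * ℓ / κ, (B * ℓ + B * ℓ / κ * (B * (b - a))) / κ,
      (B * ℓ + 2 * ((B * ℓ + B * ℓ / κ * (B * (b - a))) / κ) * (B * (b - a))
        + B * ℓ / κ * (B * (b - a))) / κ, by positivity, by positivity, by positivity, ?_⟩
    intro N h τ S hh hS n hn
    refine hB.discreteNonlocal_bounds hS.h_pos.le hκ (hmass h N hS.h_pos hh hS.mesh) hS.mesh
      ((hS.mass_le hf n).trans ?_)
    rw [hℓ]; gcongr
  obtain ⟨M, hM⟩ : ∃ M, M = D * Real.exp (C * (1 + R₁) * T) + 1 := ⟨_, rfl⟩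
  have hM0 : 0 < M := by rw [hM]; positivity
  obtain ⟨Λ, hΛ0, hΛ⟩ := hf.exists_four_point hab T M (3 * R₀ + 1) hT hM0 (by positivity)
  obtain ⟨k, hk⟩ : ∃ k, k = 2 * (C * M * (1 + R₁))
    + (b - a) * (Λ * (1 + R₁) ^ 2 + C * M * R₂) := ⟨_, rfl⟩
  have hk0 : 0 ≤ k := by rw [hk]; positivity
  obtain ⟨V', hV'⟩ : ∃ V', V' = Real.exp (Λ * (1 + R₁) * T) * (V + (V + V) + T * k) := ⟨_, rfl⟩
  have hV'0 : 0 ≤ V' := by rw [hV']; positivity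
  refine ⟨M, V', 2 * α * V' + (b - a) * (C * M * (1 + R₁)), R₁, hM0.le, hV'0, by positivity,
    hR₁, ?_⟩
  intro N h τ S hh hS
  have bounds := bounds N h τ S hh hS
  have hτ := hS.τ_pos
  have mono : ∀ {i n : ℕ}, i ≤ n → n * τ ≤ T → i * τ ≤ T := fun {i n} hi hn => by
    have : (i : ℝ) ≤ n := Nat.cast_le.2 hi
    nlinarith
  have hle : ∀ n : ℕ, n * τ ≤ T → ∀ j ≤ N + 1, S n j ≤ M := fun n hn j hj => by
    refine (hS.le_of_nonlocal_lip hf hab hR₁ n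
      (fun i hi => (bounds i (mono hi.le hn)).2.1) j hj).trans ?_
    have h1 := one_add_pow_le_exp (show 0 ≤ C * (1 + R₁) by positivity) hτ.le hn
    have h2 := mul_le_mul_of_nonneg_left h1 hD
    linarith
  have habs : ∀ n : ℕ, n * τ ≤ T → ∀ j ≤ N + 1, |S n j| ≤ M := fun n hn j hj => by
    rw [abs_of_nonneg (hS.nonneg hf n j hj)]; exact hle n hn j hj
  have hvar := fun (n : ℕ) (hn : n * τ ≤ T) =>
    hS.row_step hf hab hM0.le hR₀ hR₁ hR₂ hΛ0 hn hΛ (habs n hn) (bounds n hn).1 (bounds n hn).2.1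
      (bounds n hn).2.2
  have hV'n : ∀ n : ℕ, n * τ ≤ T →
      ∑ j ∈ Finset.range (N + 1), |S n (j + 1) - S n j| ≤ V' := by
    intro n hn
    have hq : 0 ≤ Λ * (1 + R₁) * τ := by positivity
    have g := discrete_gronwall (x := fun n => ∑ j ∈ Finset.range (N + 1), |S n (j + 1) - S n j|)
      (e := fun n => |S (n + 1) 0 - S n 0| + |S (n + 1) (N + 1) - S n (N + 1)|)
      (q := 1 + Λ * (1 + R₁) * τ) (c := k * τ) (by linarith) (by positivity)
      (fun n => by positivity) n
      (fun i hi => by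
        have := (hvar i (mono hi.le hn)).1
        rwa [← hk] at this)
    refine g.trans ?_
    rw [hV', Finset.sum_add_distrib]
    have h1 := one_add_pow_le_exp (show 0 ≤ Λ * (1 + R₁) by positivity) hτ.le hn
    have h2 : (n : ℝ) * (k * τ) ≤ T * k := by
      calc (n : ℝ) * (k * τ) = n * τ * k := by ring
        _ ≤ _ := by gcongr
    have h3 : 0 ≤ (n : ℝ) * (k * τ) := by positivity
    have h4 : 0 ≤ ∑ j ∈ Finset.range (N + 1), |S 0 (j + 1) - S 0 j| := by positivity
    have h5 : 0 ≤ ∑ i ∈ Finset.range n, |S (i + 1) 0 - S i 0| := by positivity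
    have h6 : 0 ≤ ∑ i ∈ Finset.range n, |S (i + 1) (N + 1) - S i (N + 1)| := by positivity
    exact mul_le_mul h1 (add_le_add (add_le_add hS.init_var
      (add_le_add (hS.left_var n) (hS.right_var n))) h2) (by linarith) (Real.exp_pos _).le
  intro n hn
  refine ⟨hS.nonneg hf n, hle n hn, hV'n n hn, ?_, (bounds n hn).2.1⟩
  have ht := (hvar n hn).2
  have hv := mul_le_mul_of_nonneg_left (hV'n n hn) (show 0 ≤ 2 * α * τ by positivity)
  linarith


/-! ### The scheme of the theorem -/

theorem scheme_left (a b : ℝ) (f : ℝ → ℝ → ℝ → ℝ → ℝ) (ω ρo ρa ρb : ℝ → ℝ) (α : ℝ) (N : ℕ)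
    (Δt : ℝ) (n : ℕ) : scheme a b f ω ρo ρa ρb α N Δt n 0 = timeMean ρa Δt n := by
  cases n <;> simp [scheme]

theorem scheme_right (a b : ℝ) (f : ℝ → ℝ → ℝ → ℝ → ℝ) (ω ρo ρa ρb : ℝ → ℝ) (α : ℝ) (N : ℕ)
    (Δt : ℝ) (n : ℕ) : scheme a b f ω ρo ρa ρb α N Δt n (N + 1) = timeMean ρb Δt n := by
  cases n <;> simp [scheme]

theorem scheme_init (a b : ℝ) (f : ℝ → ℝ → ℝ → ℝ → ℝ) (ω ρo ρa ρb : ℝ → ℝ) (α : ℝ) (N : ℕ)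
    (Δt : ℝ) {j : ℕ} (hj : j < N) : scheme a b f ω ρo ρa ρb α N Δt 0 (j + 1)
      = mean ρo ((b - a) / N) (a + j * ((b - a) / N)) := by
  have h1 : ¬ (j + 1 = 0) := by omega
  have h2 : ¬ (N < j + 1) := by omega
  simp only [scheme, if_neg h1, if_neg h2, mean]
  congr 2 <;> push_cast <;> ring

theorem scheme_step (a b : ℝ) (f : ℝ → ℝ → ℝ → ℝ → ℝ) (ω ρo ρa ρb : ℝ → ℝ) (α : ℝ) (N : ℕ)
    (Δt : ℝ) (n : ℕ) {j : ℕ} (hj : j + 1 ≤ N) :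
    scheme a b f ω ρo ρa ρb α N Δt (n + 1) (j + 1)
      = laxStep (Δt / ((b - a) / N)) α
        (interfaceFlux a f ω N ((b - a) / N) Δt (scheme a b f ω ρo ρa ρb α N Δt) n j)
        (interfaceFlux a f ω N ((b - a) / N) Δt (scheme a b f ω ρo ρa ρb α N Δt) n (j + 1))
        (scheme a b f ω ρo ρa ρb α N Δt n j) (scheme a b f ω ρo ρa ρb α N Δt n (j + 1))
        (scheme a b f ω ρo ρa ρb α N Δt n (j + 2)) := by
  have h1 : ¬ (j + 1 = 0) := by omega
  have h2 : ¬ (N < j + 1) := by omega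
  rw [scheme, if_neg h1, if_neg h2]
  rfl

theorem isScheme_scheme {a b L C α : ℝ} (hab : a < b) {f : ℝ → ℝ → ℝ → ℝ → ℝ}
    (ω : ℝ → ℝ) {ρo ρa ρb vo va vb : ℝ → ℝ} {Do Vo Da Va Db Vb D V : ℝ}
    (ho : DatumRep ρo (Ioo a b) vo Do Vo) (ha : DatumRep ρa (Ioi 0) va Da Va)
    (hb : DatumRep ρb (Ioi 0) vb Db Vb) (hDo : Do ≤ D) (hDa : Da ≤ D) (hDb : Db ≤ D)
    (hVo : Vo + 2 * D ≤ V) (hVa : Va ≤ V) (hVb : Vb ≤ V) (hα : 1 ≤ α)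
    {N : ℕ} {Δt : ℝ} (hN : 0 < N) (hΔt : 0 < Δt) (hCFL : CFL L C α ((b - a) / N) Δt) :
    IsScheme a b f ω L α D V N ((b - a) / N) Δt (scheme a b f ω ρo ρa ρb α N Δt) := by
  have hN' : (0 : ℝ) < N := Nat.cast_pos.2 hN
  have hh : 0 < (b - a) / N := div_pos (sub_pos.2 hab) hN'
  have hmesh : N * ((b - a) / N) = b - a := by field_simp
  have tm : ∀ n : ℕ, Ioo (n * Δt) (n * Δt + Δt) ⊆ Ioi 0 := fun n x hx =>
    lt_of_le_of_lt (mul_nonneg (Nat.cast_nonneg n) hΔt.le) hx.1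
  have sm : ∀ j < N, Ioo (a + j * ((b - a) / N)) (a + j * ((b - a) / N) + (b - a) / N)
      ⊆ Ioo a b := fun j hj => by
    have h0 : (0 : ℝ) ≤ j := Nat.cast_nonneg j
    have h1 : (j : ℝ) + 1 ≤ N := by exact_mod_cast hj
    refine Ioo_subset_Ioo ?_ ?_
    · have := mul_nonneg h0 hh.le; linarith
    · have := mul_le_mul_of_nonneg_right h1 hh.le; linarith
  have left : ∀ n, 0 ≤ scheme a b f ω ρo ρa ρb α N Δt n 0 ∧
      scheme a b f ω ρo ρa ρb α N Δt n 0 ≤ D := fun n => by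
    rw [scheme_left, timeMean_eq]
    exact ⟨ha.mean_nonneg hΔt (tm n), (ha.mean_le hΔt (tm n)).trans hDa⟩
  have right : ∀ n, 0 ≤ scheme a b f ω ρo ρa ρb α N Δt n (N + 1) ∧
      scheme a b f ω ρo ρa ρb α N Δt n (N + 1) ≤ D := fun n => by
    rw [scheme_right, timeMean_eq]
    exact ⟨hb.mean_nonneg hΔt (tm n), (hb.mean_le hΔt (tm n)).trans hDb⟩
  have init : ∀ j ≤ N + 1, 0 ≤ scheme a b f ω ρo ρa ρb α N Δt 0 j ∧
      scheme a b f ω ρo ρa ρb α N Δt 0 j ≤ D := fun j hj => by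
    rcases Nat.eq_zero_or_pos j with rfl | hj0
    · exact left 0
    rcases Nat.lt_or_ge N j with hj1 | hj1
    · rw [show j = N + 1 by omega]; exact right 0
    obtain ⟨i, rfl⟩ : ∃ i, j = i + 1 := ⟨j - 1, by omega⟩
    rw [scheme_init _ _ _ _ _ _ _ _ _ _ hj1]
    exact ⟨ho.mean_nonneg hh (sm i hj1), (ho.mean_le hh (sm i hj1)).trans hDo⟩
  refine ⟨hN, hh, hΔt, hmesh, hCFL.1, ?_, fun n j hj => scheme_step _ _ _ _ _ _ _ _ _ _ n hj,
    left, right, init, ?_, ?_, ?_⟩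
  · have h1 := hCFL.2.trans (mul_le_mul_of_nonneg_left (min_le_left (1 / α) _) (by norm_num))
    have := mul_le_mul_of_nonneg_right h1 (zero_le_one.trans hα)
    refine this.trans (le_of_eq ?_)
    have : α ≠ 0 := by linarith
    field_simp
  · intro n
    simp only [scheme_left, timeMean_eq]
    have := ha.sum_mean_le (c := 0) hΔt n Ioo_subset_Ioi_self
    simp only [zero_add] at this
    exact this.trans hVa
  · intro n
    simp only [scheme_right, timeMean_eq]
    have := hb.sum_mean_le (c := 0) hΔt n Ioo_subset_Ioi_self
    simp only [zero_add] at this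
    exact this.trans hVb
  · obtain ⟨n, rfl⟩ : ∃ n, N = n + 1 := ⟨N - 1, by omega⟩
    rw [Finset.sum_range_succ, Finset.sum_range_succ']
    have h0 := init 0 (by omega)
    have h1 := init (0 + 1) (by omega)
    have h2 := init (n + 1) (by omega)
    have h3 := init (n + 1 + 1) (by omega)
    have e : ∑ j ∈ Finset.range n, |scheme a b f ω ρo ρa ρb α (n + 1) Δt 0 (j + 1 + 1)
        - scheme a b f ω ρo ρa ρb α (n + 1) Δt 0 (j + 1)| ≤ Vo := by
      have := ho.sum_mean_le (c := a) hh n (by rw [hmesh, add_sub_cancel])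
      refine le_trans (le_of_eq (Finset.sum_congr rfl fun j hj => ?_)) this
      have := Finset.mem_range.1 hj
      rw [scheme_init _ _ _ _ _ _ _ _ _ _ (show j + 1 < n + 1 by omega),
        scheme_init _ _ _ _ _ _ _ _ _ _ (show j < n + 1 by omega)]
    have a1 := abs_sub_le_of_nonneg_of_le h1.1 h1.2 h0.1 h0.2
    have a2 := abs_sub_le_of_nonneg_of_le h3.1 h3.2 h2.1 h2.2
    linarith


/-! ### Compactness of the approximate solutions -/

theorem measurable_cells (c : ℕ → ℕ → ℝ) (a h τ : ℝ) :
    Measurable fun p : ℝ × ℝ => c ⌊p.1 / τ⌋₊ ⌊(p.2 - a) / h⌋₊ := by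
  have h1 : Measurable fun q : ℕ × ℕ => c q.1 q.2 := measurable_of_countable _
  have h2 : Measurable fun p : ℝ × ℝ => (⌊p.1 / τ⌋₊, ⌊(p.2 - a) / h⌋₊) :=
    (Nat.measurable_floor.comp (by fun_prop)).prodMk (Nat.measurable_floor.comp (by fun_prop))
  exact h1.comp h2

/-- The piecewise constant function with the values `S n (j + 1)` in the cells. -/
noncomputable def cellFn (S : ℕ → ℕ → ℝ) (a h τ : ℝ) (p : ℝ × ℝ) : ℝ :=
  S ⌊p.1 / τ⌋₊ (⌊(p.2 - a) / h⌋₊ + 1)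

theorem measurable_cellFn (S : ℕ → ℕ → ℝ) (a h τ : ℝ) : Measurable (cellFn S a h τ) :=
  measurable_cells (fun n j => S n (j + 1)) a h τ

theorem floor_cell_lt {a b h x : ℝ} {N : ℕ} (hh : 0 < h) (hN : N * h = b - a) (hx : x ∈ Ico a b) :
    ⌊(x - a) / h⌋₊ < N := by
  rw [Nat.floor_lt (div_nonneg (by linarith [hx.1]) hh.le), div_lt_iff₀ hh]
  linarith [hx.2]

theorem floor_mul_le {t τ : ℝ} (hτ : 0 < τ) (ht : 0 ≤ t) : ⌊t / τ⌋₊ * τ ≤ t := by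
  have := Nat.floor_le (div_nonneg ht hτ.le)
  rwa [le_div_iff₀ hτ] at this

theorem abs_row_sub_le (r : ℕ → ℝ) {m n : ℕ} (hmn : m ≤ n) :
    |r (n + 1) - r (m + 1)| ≤ ∑ j ∈ Finset.range n, |r (j + 2) - r (j + 1)|
      - ∑ j ∈ Finset.range m, |r (j + 2) - r (j + 1)| := by
  induction n, hmn using Nat.le_induction with
  | base => simp
  | succ n _ ih =>
    rw [Finset.sum_range_succ]
    have := abs_add_le (r (n + 2) - r (n + 1)) (r (n + 1) - r (m + 1))
    rw [sub_add_sub_cancel] at this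
    linarith

theorem integral_abs_sub_sample_le {a b h δ V' : ℝ} {N Q : ℕ} (hab : a ≤ b) (hh : 0 < h)
    (hN : N * h = b - a) (hδ : 0 < δ) (hQ : Q * δ = b - a) {r : ℕ → ℝ}
    (hr : ∑ j ∈ Finset.range (N + 1), |r (j + 1) - r j| ≤ V') :
    ∫ x in a..b, |r (⌊(x - a) / h⌋₊ + 1) - r (⌊(a + ⌊(x - a) / δ⌋₊ * δ - a) / h⌋₊ + 1)|
      ≤ δ * V' := by
  set W : ℕ → ℝ := fun n => ∑ j ∈ Finset.range n, |r (j + 2) - r (j + 1)| with hW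
  set P : ℕ → ℕ := fun l => ⌊(a + l * δ - a) / h⌋₊ with hP
  have hmono : ∀ x y : ℝ, x ≤ y → ⌊(x - a) / h⌋₊ ≤ ⌊(y - a) / h⌋₊ := fun x y hxy =>
    Nat.floor_mono (div_le_div_of_nonneg_right (by linarith) hh.le)
  have hWm : Monotone W := fun m n hmn => by
    have := abs_row_sub_le r hmn
    have h0 := abs_nonneg (r (n + 1) - r (m + 1))
    simp only [hW]; linarith
  have i1 := (integral_comp_floor hδ hQ fun l => W (P (l + 1)) - W (P l))
  have i0 : IntervalIntegrable (fun x => |r (⌊(x - a) / h⌋₊ + 1) - r (P ⌊(x - a) / δ⌋₊ + 1)|)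
      volume a b :=
    ((intervalIntegrable_comp_floor_succ hh hN r).sub
      (integral_comp_floor hδ hQ fun l => r (P l + 1)).1).abs
  have hle : ∫ x in a..b, |r (⌊(x - a) / h⌋₊ + 1) - r (P ⌊(x - a) / δ⌋₊ + 1)|
      ≤ ∫ x in a..b, (W (P (⌊(x - a) / δ⌋₊ + 1)) - W (P ⌊(x - a) / δ⌋₊)) := by
    refine intervalIntegral.integral_mono_on hab i0 i1.1 fun x hx => ?_
    obtain ⟨h1, h2⟩ := floor_cell_bounds hδ hx.1
    refine (abs_row_sub_le r (hmono _ _ h1)).trans ?_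
    have h3 : W ⌊(x - a) / h⌋₊ ≤ W (P (⌊(x - a) / δ⌋₊ + 1)) := by
      refine hWm (hmono _ _ ?_)
      push_cast; exact h2.le
    simp only [hW, hP] at h3 ⊢
    linarith
  refine hle.trans ?_
  rw [i1.2, Finset.sum_range_sub (fun l => W (P l))]
  refine mul_le_mul_of_nonneg_left ?_ hδ.le
  have e1 : P Q = N := by
    simp only [hP]
    rw [add_sub_cancel_left, hQ, ← hN, mul_div_assoc, div_self hh.ne', mul_one, Nat.floor_natCast]
  rw [e1]
  have e2 : 0 ≤ W (P 0) := Finset.sum_nonneg fun _ _ => abs_nonneg _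
  rw [Finset.sum_range_succ'] at hr
  have := abs_nonneg (r (0 + 1) - r 0)
  simp only [hW] at *
  linarith

theorem integral_abs_time_sub_le {a b h τ K T : ℝ} {N : ℕ} (hh : 0 < h) (hN : N * h = b - a)
    {S : ℕ → ℕ → ℝ}
    (hS : ∀ n : ℕ, n * τ ≤ T →
      h * ∑ j ∈ Finset.range N, |S (n + 1) (j + 1) - S n (j + 1)| ≤ K * τ) (hτ : 0 ≤ τ)
    {m n : ℕ} (hmn : m ≤ n) (hn : n * τ ≤ T) :
    ∫ x in a..b, |S n (⌊(x - a) / h⌋₊ + 1) - S m (⌊(x - a) / h⌋₊ + 1)| ≤ K * (n * τ - m * τ) := by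
  rw [(integral_comp_floor hh hN fun j => |S n (j + 1) - S m (j + 1)|).2]
  induction n, hmn using Nat.le_induction with
  | base => simp
  | succ n _ ih =>
    have hn' : n * τ ≤ T := by push_cast at hn; linarith
    have h1 := hS n hn'
    have h2 : ∑ j ∈ Finset.range N, |S (n + 1) (j + 1) - S m (j + 1)|
        ≤ ∑ j ∈ Finset.range N, |S (n + 1) (j + 1) - S n (j + 1)|
          + ∑ j ∈ Finset.range N, |S n (j + 1) - S m (j + 1)| := by
      rw [← Finset.sum_add_distrib]
      refine Finset.sum_le_sum fun j _ => ?_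
      have := abs_add_le (S (n + 1) (j + 1) - S n (j + 1)) (S n (j + 1) - S m (j + 1))
      rwa [sub_add_sub_cancel] at this
    have h3 := mul_le_mul_of_nonneg_left h2 hh.le
    have h4 := ih hn'
    push_cast
    linarith

theorem setIntegral_prod_le {a b T c : ℝ} (hab : a ≤ b) (hT : 0 ≤ T) {g : ℝ × ℝ → ℝ}
    (hg : IntegrableOn g (Ioo 0 T ×ˢ Ioo a b))
    (hc : ∀ t ∈ Ioo 0 T, ∫ x in a..b, g (t, x) ≤ c) :
    ∫ p in Ioo 0 T ×ˢ Ioo a b, g p ≤ T * c := by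
  rw [Measure.volume_eq_prod, setIntegral_prod _ (by rwa [← Measure.volume_eq_prod])]
  have h1 : IntegrableOn (fun t => ∫ x in Ioo a b, g (t, x)) (Ioo 0 T) := by
    have : Integrable g ((volume.restrict (Ioo 0 T)).prod (volume.restrict (Ioo a b))) := by
      rw [Measure.prod_restrict, ← Measure.volume_eq_prod]; exact hg
    exact this.integral_prod_left
  refine (setIntegral_mono_on (g := fun _ => c) h1 (integrableOn_const measure_Ioo_lt_top.ne)
    measurableSet_Ioo fun t ht => ?_).trans (le_of_eq ?_)
  · rw [← integral_Ioc_eq_integral_Ioo, ← intervalIntegral.integral_of_le hab]; exact hc t ht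
  · rw [setIntegral_const, smul_eq_mul, Real.volume_real_Ioo_of_le hT, sub_zero]

theorem integrableOn_of_abs_le {T a b M : ℝ} {g : ℝ × ℝ → ℝ} (hg : Measurable g)
    (hM : ∀ p ∈ Ioo 0 T ×ˢ Ioo a b, |g p| ≤ M) : IntegrableOn g (Ioo 0 T ×ˢ Ioo a b) := by
  have hfin : volume (Ioo 0 T ×ˢ Ioo a b) < ⊤ := by
    rw [Measure.volume_eq_prod, Measure.prod_prod]
    exact ENNReal.mul_lt_top measure_Ioo_lt_top measure_Ioo_lt_top
  refine Measure.integrableOn_of_bounded (M := M) hfin.ne hg.aestronglyMeasurable ?_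
  exact (ae_restrict_iff' (measurableSet_Ioo.prod measurableSet_Ioo)).2 (Eventually.of_forall hM)

section Rows
variable {a b M V' K R₁ h τ T L α D V : ℝ} {f : ℝ → ℝ → ℝ → ℝ → ℝ} {ω : ℝ → ℝ} {N : ℕ}
  {S : ℕ → ℕ → ℝ} (hS : IsScheme a b f ω L α D V N h τ S)
  (hR : ∀ n : ℕ, n * τ ≤ T → RowBounds ω M V' K R₁ N h τ S n)
include hS hR

theorem cellFn_mem {t x : ℝ} (ht : t ∈ Icc 0 T) (hx : x ∈ Ico a b) :
    cellFn S a h τ (t, x) ∈ Icc 0 M := by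
  have h1 := hR _ ((floor_mul_le hS.τ_pos ht.1).trans ht.2)
  have h2 := floor_cell_lt hS.h_pos hS.mesh hx
  exact ⟨h1.nonneg _ (Nat.succ_le_succ h2.le), h1.le _ (Nat.succ_le_succ h2.le)⟩

theorem abs_cellFn_le {t x : ℝ} (ht : t ∈ Icc 0 T) (hx : x ∈ Ico a b) :
    |cellFn S a h τ (t, x)| ≤ M := by
  have := cellFn_mem hS hR ht hx
  rw [abs_of_nonneg this.1]; exact this.2

theorem integrableOn_cellFn : IntegrableOn (cellFn S a h τ) (Ioo 0 T ×ˢ Ioo a b) :=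
  integrableOn_of_abs_le (measurable_cellFn S a h τ) fun _ hp =>
    abs_cellFn_le hS hR (Ioo_subset_Icc_self hp.1) (Ioo_subset_Ico_self hp.2)

/-- The error made in sampling the approximate solution on a coarse mesh. -/
theorem integral_sample_error_le (hab : a < b) {η δ : ℝ} {Q : ℕ} (hK : 0 ≤ K)
    (hT : 0 < T) (hη : 0 < η) (hδ : 0 < δ) (hQ : Q * δ = b - a) :
    ∫ p in Ioo 0 T ×ˢ Ioo a b, |cellFn S a h τ p
        - cellFn S a h τ (⌊p.1 / η⌋₊ * η, a + ⌊(p.2 - a) / δ⌋₊ * δ)|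
      ≤ T * (K * (η + τ) + δ * V') := by
  have hτ := hS.τ_pos
  have hmeas : Measurable fun p : ℝ × ℝ =>
      cellFn S a h τ (⌊p.1 / η⌋₊ * η, a + ⌊(p.2 - a) / δ⌋₊ * δ) :=
    measurable_cells (fun i l => cellFn S a h τ (i * η, a + l * δ)) a δ η
  have hmem : ∀ p ∈ Ioo 0 T ×ˢ Ioo a b, |cellFn S a h τ p
        - cellFn S a h τ (⌊p.1 / η⌋₊ * η, a + ⌊(p.2 - a) / δ⌋₊ * δ)| ≤ M := by
    intro p hp
    have m1 := cellFn_mem hS hR (Ioo_subset_Icc_self hp.1) (Ioo_subset_Ico_self hp.2)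
    have m2 := cellFn_mem hS hR (t := ⌊p.1 / η⌋₊ * η) (x := a + ⌊(p.2 - a) / δ⌋₊ * δ)
      ⟨by positivity, (floor_mul_le hη hp.1.1.le).trans hp.1.2.le⟩
      ⟨by have : 0 ≤ (⌊(p.2 - a) / δ⌋₊ : ℝ) * δ := by positivity
          linarith, by linarith [(floor_cell_bounds hδ hp.2.1.le).1, hp.2.2]⟩
    exact abs_sub_le_of_nonneg_of_le m1.1 m1.2 m2.1 m2.2
  refine setIntegral_prod_le hab.le hT.le (integrableOn_of_abs_le (M := M)
    ((measurable_cellFn S a h τ).sub hmeas).abs fun p hp => by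
      rw [abs_abs]; exact hmem p hp) fun t ht => ?_
  set n := ⌊t / τ⌋₊ with hn
  set m := ⌊(⌊t / η⌋₊ * η) / τ⌋₊ with hm
  have hmn : m ≤ n := Nat.floor_mono (div_le_div_of_nonneg_right (floor_mul_le hη ht.1.le) hτ.le)
  have hnT : n * τ ≤ T := (floor_mul_le hτ ht.1.le).trans ht.2.le
  have hmT : m * τ ≤ T := le_trans (mul_le_mul_of_nonneg_right (Nat.cast_le.2 hmn) hτ.le) hnT
  have t1 := integral_abs_time_sub_le hS.h_pos hS.mesh (fun n hn => (hR n hn).time) hτ.le hmn hnT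
  have t2 := integral_abs_sub_sample_le hab.le hS.h_pos hS.mesh hδ hQ (hR m hmT).variation
  have i1 := intervalIntegrable_comp_floor_succ hS.h_pos hS.mesh (S n)
  have i2 := intervalIntegrable_comp_floor_succ hS.h_pos hS.mesh (S m)
  have i3 := (integral_comp_floor hδ hQ fun l => S m (⌊(a + l * δ - a) / h⌋₊ + 1)).1
  have e : ∀ x, |cellFn S a h τ (t, x)
        - cellFn S a h τ (⌊t / η⌋₊ * η, a + ⌊(x - a) / δ⌋₊ * δ)|
      ≤ |S n (⌊(x - a) / h⌋₊ + 1) - S m (⌊(x - a) / h⌋₊ + 1)|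
        + |S m (⌊(x - a) / h⌋₊ + 1) - S m (⌊(a + ⌊(x - a) / δ⌋₊ * δ - a) / h⌋₊ + 1)| :=
    fun x => abs_sub_le _ _ _
  have key := intervalIntegral.integral_mono_on hab.le (i1.sub i3).abs
    ((i1.sub i2).abs.add (i2.sub i3).abs) (fun x _ => e x)
  rw [intervalIntegral.integral_add (i1.sub i2).abs (i2.sub i3).abs] at key
  have hb : n * τ - m * τ ≤ η + τ := by
    have h1 := floor_mul_le hτ ht.1.le
    have h2 := Nat.lt_floor_add_one ((⌊t / η⌋₊ * η) / τ)
    have h3 := Nat.lt_floor_add_one (t / η)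
    rw [div_lt_iff₀ hη] at h3
    rw [div_lt_iff₀ hτ] at h2
    simp only [hn, hm]
    linarith
  have := mul_le_mul_of_nonneg_left hb hK
  refine key.trans ?_
  linarith

end Rows

theorem abs_sub_le_of_floor_eq {v w ε : ℝ} (hε : 0 < ε) (hv : 0 ≤ v) (hw : 0 ≤ w)
    (h : ⌊v / ε⌋₊ = ⌊w / ε⌋₊) : |v - w| ≤ ε := by
  have h1 := floor_mul_le hε hv
  have h2 := floor_mul_le hε hw
  have h3 := Nat.lt_floor_add_one (v / ε)
  have h4 := Nat.lt_floor_add_one (w / ε)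
  rw [div_lt_iff₀ hε] at h3 h4
  rw [h] at h1 h3
  rw [abs_le]; constructor <;> linarith

theorem integral_abs_sub_le_three {X : Type*} [MeasurableSpace X] {μ : Measure X}
    {u u' v v' : X → ℝ} (hu : Integrable u μ) (hu' : Integrable u' μ) (hv : Integrable v μ)
    (hv' : Integrable v' μ) : ∫ p, |u p - u' p| ∂μ
      ≤ (∫ p, |u p - v p| ∂μ) + (∫ p, |v p - v' p| ∂μ) + ∫ p, |u' p - v' p| ∂μ := by
  have i1 : Integrable (fun p => |u p - v p|) μ := (hu.sub hv).abs
  have i2 : Integrable (fun p => |v p - v' p|) μ := (hv.sub hv').abs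
  have i3 : Integrable (fun p => |u' p - v' p|) μ := (hu'.sub hv').abs
  have i4 : Integrable (fun p => |u p - v p| + |v p - v' p|) μ := i1.add i2
  rw [← integral_add i1 i2, ← integral_add i4 i3]
  refine integral_mono (hu.sub hu').abs (i4.add i3) fun p => ?_
  have := abs_sub_le (u p) (v p) (u' p)
  have := abs_sub_le (v p) (v' p) (u' p)
  have := abs_sub_comm (u' p) (v' p)
  beta_reduce
  linarith

section Sequence
variable {a b L α D V : ℝ} {f : ℝ → ℝ → ℝ → ℝ → ℝ} {ω : ℝ → ℝ} {N : ℕ → ℕ} {h τ : ℕ → ℝ}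
  {S : ℕ → ℕ → ℕ → ℝ}

theorem exists_finite_sampling (hab : a < b)
    (hS : ∀ m, IsScheme a b f ω L α D V (N m) (h m) (τ m) (S m))
    (hτ : Tendsto τ atTop (𝓝 0)) {T M V' K R₁ : ℝ} (hT : 0 < T) (hV' : 0 ≤ V')
    (hK : 0 ≤ K)
    (hR : ∀ m (n : ℕ), n * τ m ≤ T → RowBounds ω M V' K R₁ (N m) (h m) (τ m) (S m) n)
    {ε : ℝ} (hε : 0 < ε) : ∃ (β : Type) (_ : Fintype β) (F : ℕ → β) (m₀ : ℕ), ∀ m ≥ m₀, ∀ m' ≥ m₀,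
      F m = F m' → ∫ p in Ioo 0 T ×ˢ Ioo a b,
        |cellFn (S m) a (h m) (τ m) p - cellFn (S m') a (h m') (τ m') p| < ε := by
  have hw : 0 < b - a := sub_pos.2 hab
  obtain ⟨I, hI⟩ := exists_nat_gt (10 * T * K * T / ε)
  obtain ⟨Q, hQ⟩ := exists_nat_gt (10 * T * V' * (b - a) / ε)
  have hI0 : (0 : ℝ) < I := lt_of_le_of_lt (by positivity) hI
  have hQ0 : (0 : ℝ) < Q := lt_of_le_of_lt (by positivity) hQ
  obtain ⟨η, hη⟩ : ∃ η, η = T / I := ⟨_, rfl⟩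
  obtain ⟨δ, hδ⟩ : ∃ δ, δ = (b - a) / Q := ⟨_, rfl⟩
  have hη0 : 0 < η := by rw [hη]; positivity
  have hδ0 : 0 < δ := by rw [hδ]; positivity
  have hIη : I * η = T - 0 := by rw [hη]; field_simp; ring
  have hQδ : Q * δ = b - a := by rw [hδ]; field_simp
  have e1 : T * (K * η) ≤ ε / 10 := by
    rw [div_lt_iff₀ hε] at hI
    rw [hη, ← mul_div_assoc, ← mul_div_assoc, div_le_iff₀ hI0]; linarith
  have e2 : T * (δ * V') ≤ ε / 10 := by
    rw [div_lt_iff₀ hε] at hQ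
    rw [hδ, div_mul_eq_mul_div, ← mul_div_assoc, div_le_iff₀ hQ0]; linarith
  obtain ⟨ε', hε'⟩ : ∃ ε', ε' = ε / 10 / (T * (b - a)) := ⟨_, rfl⟩
  have hε'0 : 0 < ε' := by rw [hε']; positivity
  have e3 : T * (ε' * (b - a)) = ε / 10 := by rw [hε']; field_simp
  have hlim : Tendsto (fun m => T * (K * τ m)) atTop (𝓝 0) := by
    simpa using (hτ.const_mul K).const_mul T
  obtain ⟨m₀, hm₀⟩ := eventually_atTop.1
    (hlim.eventually (gt_mem_nhds (show 0 < ε / 10 by positivity)))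
  set P := ⌊M / ε'⌋₊ with hP
  refine ⟨Fin I × Fin Q → Fin (P + 1), inferInstance, fun m q =>
    ⟨min ⌊cellFn (S m) a (h m) (τ m) (q.1 * η, a + q.2 * δ) / ε'⌋₊ P,
      Nat.lt_succ_of_le (min_le_right _ _)⟩, m₀, fun m hm m' hm' hF => ?_⟩
  have hmem : ∀ m, ∀ p ∈ Ioo 0 T ×ˢ Ioo a b, cellFn (S m) a (h m) (τ m)
      (⌊p.1 / η⌋₊ * η, a + ⌊(p.2 - a) / δ⌋₊ * δ) ∈ Icc 0 M := fun m p hp =>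
    cellFn_mem (hS m) (hR m) ⟨by positivity, (floor_mul_le hη0 hp.1.1.le).trans hp.1.2.le⟩
      ⟨by have : 0 ≤ (⌊(p.2 - a) / δ⌋₊ : ℝ) * δ := by positivity
          linarith, by linarith [(floor_cell_bounds hδ0 hp.2.1.le).1, hp.2.2]⟩
  have hmeas : ∀ m, Measurable fun p : ℝ × ℝ =>
      cellFn (S m) a (h m) (τ m) (⌊p.1 / η⌋₊ * η, a + ⌊(p.2 - a) / δ⌋₊ * δ) := fun m =>
    measurable_cells (fun i l => cellFn (S m) a (h m) (τ m) (i * η, a + l * δ)) a δ η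
  have hint : ∀ m, IntegrableOn (fun p : ℝ × ℝ =>
      cellFn (S m) a (h m) (τ m) (⌊p.1 / η⌋₊ * η, a + ⌊(p.2 - a) / δ⌋₊ * δ))
      (Ioo 0 T ×ˢ Ioo a b) := fun m =>
    integrableOn_of_abs_le (hmeas m) fun p hp => by
      have := hmem m p hp
      rw [abs_of_nonneg this.1]; exact this.2
  have hcell := fun m => integrableOn_cellFn (hS m) (hR m)
  have hsamp := fun m => integral_sample_error_le (hS m) (hR m) hab hK hT hη0 hδ0 hQδ
  have hdiff : ∫ p in Ioo 0 T ×ˢ Ioo a b,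
      |cellFn (S m) a (h m) (τ m) (⌊p.1 / η⌋₊ * η, a + ⌊(p.2 - a) / δ⌋₊ * δ)
        - cellFn (S m') a (h m') (τ m') (⌊p.1 / η⌋₊ * η, a + ⌊(p.2 - a) / δ⌋₊ * δ)|
      ≤ T * (ε' * (b - a)) := by
    refine setIntegral_prod_le hab.le hT.le ((hint m).sub (hint m')).abs fun t ht => ?_
    have hle : ∀ x ∈ Ioo a b,
        |cellFn (S m) a (h m) (τ m) (⌊t / η⌋₊ * η, a + ⌊(x - a) / δ⌋₊ * δ)
        - cellFn (S m') a (h m') (τ m') (⌊t / η⌋₊ * η, a + ⌊(x - a) / δ⌋₊ * δ)| ≤ ε' := by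
      intro x hx
      have b1 := hmem m (t, x) ⟨ht, hx⟩
      have b2 := hmem m' (t, x) ⟨ht, hx⟩
      refine abs_sub_le_of_floor_eq hε'0 b1.1 b2.1 ?_
      have q1 : ⌊t / η⌋₊ < I := by
        simpa using floor_cell_lt hη0 hIη (Ioo_subset_Ico_self ht)
      have q2 : ⌊(x - a) / δ⌋₊ < Q := floor_cell_lt hδ0 hQδ (Ioo_subset_Ico_self hx)
      have := congrArg Fin.val (congrFun hF (⟨_, q1⟩, ⟨_, q2⟩))
      simp only at this
      rwa [min_eq_left, min_eq_left] at this
      · exact Nat.floor_mono (div_le_div_of_nonneg_right b2.2 hε'0.le)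
      · exact Nat.floor_mono (div_le_div_of_nonneg_right b1.2 hε'0.le)
    have ii : ∀ m, IntervalIntegrable (fun x =>
        cellFn (S m) a (h m) (τ m) (⌊t / η⌋₊ * η, a + ⌊(x - a) / δ⌋₊ * δ)) volume a b := fun m =>
      (integral_comp_floor hδ0 hQδ
        fun l => cellFn (S m) a (h m) (τ m) (⌊t / η⌋₊ * η, a + l * δ)).1
    refine (intervalIntegral.integral_mono_on_of_le_Ioo hab.le ((ii m).sub (ii m')).abs
      intervalIntegrable_const hle).trans (le_of_eq ?_)
    simp [mul_comm]
  have key := integral_abs_sub_le_three (hcell m) (hcell m') (hint m) (hint m')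
  have s1 := hsamp m
  have s2 := hsamp m'
  have z1 := hm₀ m hm
  have z2 := hm₀ m' hm'
  have x1 : T * (K * (η + τ m) + δ * V') = T * (K * η) + T * (K * τ m) + T * (δ * V') := by ring
  have x2 : T * (K * (η + τ m') + δ * V') = T * (K * η) + T * (K * τ m') + T * (δ * V') := by ring
  rw [x1] at s1
  rw [x2] at s2
  linarith

end Sequence


theorem lintegral_biUnion_finset_le {X ι : Type*} [MeasurableSpace X] {μ : Measure X}
    (s : Finset ι) (A : ι → Set X) (g : X → ENNReal) :
    ∫⁻ x in ⋃ i ∈ s, A i, g x ∂μ ≤ ∑ i ∈ s, ∫⁻ x in A i, g x ∂μ := by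
  classical
  induction s using Finset.induction_on with
  | empty => simp
  | insert i s hi ih =>
    rw [Finset.sum_insert hi, Finset.set_biUnion_insert]
    exact (lintegral_union_le _ _ _).trans (add_le_add_right ih _)

section Sequence
variable {a b L α D V : ℝ} {f : ℝ → ℝ → ℝ → ℝ → ℝ} {ω : ℝ → ℝ} {N : ℕ → ℕ} {h τ : ℕ → ℝ}
  {S : ℕ → ℕ → ℕ → ℝ}

theorem totallyBounded_range_toL1 (hab : a < b)
    (hS : ∀ m, IsScheme a b f ω L α D V (N m) (h m) (τ m) (S m))
    (hτ : Tendsto τ atTop (𝓝 0)) {T M V' K R₁ : ℝ} (hT : 0 < T) (hV' : 0 ≤ V')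
    (hK : 0 ≤ K)
    (hR : ∀ m (n : ℕ), n * τ m ≤ T → RowBounds ω M V' K R₁ (N m) (h m) (τ m) (S m) n) :
    TotallyBounded (range fun m => (integrableOn_cellFn (hS m) (hR m)).toL1) := by
  refine Metric.totallyBounded_of_finite_discretization fun ε hε => ?_
  obtain ⟨β, hβ, F, m₀, hF⟩ := exists_finite_sampling hab hS hτ hT hV' hK hR hε
  set z := fun m => (integrableOn_cellFn (hS m) (hR m)).toL1
  choose ι hι using fun x : range z => x.2
  refine ⟨Fin m₀ ⊕ β, inferInstance, fun x =>
    if hx : ι x < m₀ then Sum.inl ⟨ι x, hx⟩ else Sum.inr (F (ι x)), fun x y hxy => ?_⟩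
  by_cases hx : ι x < m₀ <;> by_cases hy : ι y < m₀ <;> simp [hx, hy] at hxy
  · have : (x : _) = y := Subtype.ext (by rw [← hι x, ← hι y, hxy])
    rw [this, dist_self]; exact hε
  · have := hF (ι x) (not_lt.1 hx) (ι y) (not_lt.1 hy) hxy
    rw [← hι x, ← hι y, dist_eq_norm]
    simp only [z]
    have hi : ∀ m, Integrable (cellFn (S m) a (h m) (τ m))
      (volume.restrict (Ioo 0 T ×ˢ Ioo a b)) := fun m => integrableOn_cellFn (hS m) (hR m)
    rw [show (integrableOn_cellFn (hS (ι x)) (hR (ι x))).toL1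
      - (integrableOn_cellFn (hS (ι y)) (hR (ι y))).toL1 = ((hi (ι x)).sub (hi (ι y))).toL1 from
      (Integrable.toL1_sub _ _ (hi _) (hi _)).symm, L1.norm_of_fun_eq_integral_norm]
    exact this

theorem exists_limit (hab : a < b)
    (hS : ∀ m, IsScheme a b f ω L α D V (N m) (h m) (τ m) (S m))
    (hτ : Tendsto τ atTop (𝓝 0))
    (hR : ∀ T > 0, ∃ M V' K R₁ : ℝ, 0 ≤ M ∧ 0 ≤ V' ∧ 0 ≤ K ∧ 0 ≤ R₁ ∧
      ∀ m (n : ℕ), n * τ m ≤ T → RowBounds ω M V' K R₁ (N m) (h m) (τ m) (S m) n) :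
    ∃ (ρ : ℝ → ℝ → ℝ) (s : ℕ → ℕ), StrictMono s ∧ (Measurable fun p : ℝ × ℝ => ρ p.1 p.2) ∧
      (∀ T, ∃ M, ∀ t ≤ T, ∀ x, |ρ t x| ≤ M) ∧
      ∀ T > 0, Tendsto (fun m => eLpNorm (fun p : ℝ × ℝ =>
        cellFn (S (s m)) a (h (s m)) (τ (s m)) p - ρ p.1 p.2) 1
          (volume.restrict (Ioo 0 T ×ˢ Ioo a b))) atTop (𝓝 0) := by
  have hpos : ∀ k : ℕ, (0 : ℝ) < k + 1 := fun k => by positivity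
  choose M V' K R₁ hM hV' hK _ hRk using fun k : ℕ => hR (k + 1) (hpos k)
  set z : ∀ k : ℕ, ℕ → Lp ℝ 1 (volume.restrict (Ioo (0 : ℝ) (k + 1) ×ˢ Ioo a b)) :=
    fun k m => (integrableOn_cellFn (hS m) (hRk k m)).toL1 with hz
  have hcomp : ∀ k, IsCompact (closure (range (z k))) := fun k =>
    (totallyBounded_range_toL1 hab hS hτ (hpos k) (hV' k) (hK k) (hRk k)).closure.isCompact_of_isClosed
      isClosed_closure
  obtain ⟨g, -, s, hs, hg⟩ := (isCompact_univ_pi hcomp).tendsto_subseq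
    (x := fun m k => z k m) (fun m k _ => subset_closure (mem_range_self m))
  have hgk : ∀ k, Tendsto (fun m => z k (s m)) atTop (𝓝 (g k)) := fun k =>
    (tendsto_pi_nhds.1 hg) k
  set G : ℕ → ℝ × ℝ → ℝ := fun k p => max 0 (min (M k) (g k p)) with hG
  have hGm : ∀ k, Measurable (G k) := fun k =>
    measurable_const.max (measurable_const.min (Lp.stronglyMeasurable (g k)).measurable)
  have hGb : ∀ k p, |G k p| ≤ M k := fun k p => by
    rw [abs_of_nonneg (le_max_left _ _)]
    exact max_le (hM k) (min_le_left _ _)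
  refine ⟨fun t x => G ⌊t⌋₊ (t, x), s, hs, ?_, fun T => ?_, fun T hT => ?_⟩
  · have h1 : Measurable fun q : ℕ × (ℝ × ℝ) => G q.1 q.2 :=
      measurable_from_prod_countable_right fun k => hGm k
    exact h1.comp ((Nat.measurable_floor.comp measurable_fst).prodMk measurable_id)
  · refine ⟨∑ k ∈ Finset.range (⌊T⌋₊ + 1), M k, fun t ht x => (hGb _ _).trans ?_⟩
    exact Finset.single_le_sum (f := M) (fun k _ => hM k)
      (Finset.mem_range.2 (Nat.lt_succ_of_le (Nat.floor_mono ht)))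
  · have hle : ∀ m, eLpNorm (fun p : ℝ × ℝ =>
        cellFn (S (s m)) a (h (s m)) (τ (s m)) p - G ⌊p.1⌋₊ (p.1, p.2)) 1
          (volume.restrict (Ioo 0 T ×ˢ Ioo a b))
        ≤ ∑ k ∈ Finset.range (⌊T⌋₊ + 1), ‖z k (s m) - g k‖ₑ := by
      intro m
      rw [eLpNorm_one_eq_lintegral_enorm]
      have hcover : Ioo 0 T ×ˢ Ioo a b ⊆ ⋃ k ∈ Finset.range (⌊T⌋₊ + 1),
          {p : ℝ × ℝ | ⌊p.1⌋₊ = k} ∩ (Ioo (0 : ℝ) (k + 1) ×ˢ Ioo a b) := by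
        intro p hp
        simp only [mem_iUnion, Finset.mem_range]
        exact ⟨⌊p.1⌋₊, Nat.lt_succ_of_le (Nat.floor_mono hp.1.2.le), rfl,
          ⟨hp.1.1, Nat.lt_floor_add_one _⟩, hp.2⟩
      refine (lintegral_mono_set hcover).trans ((lintegral_biUnion_finset_le _ _ _).trans
        (Finset.sum_le_sum fun k _ => ?_))
      have hset : MeasurableSet {p : ℝ × ℝ | ⌊p.1⌋₊ = k} :=
        (Nat.measurable_floor.comp measurable_fst) (measurableSet_singleton k)
      have e1 : ‖z k (s m) - g k‖ₑ = ∫⁻ p in Ioo (0 : ℝ) (k + 1) ×ˢ Ioo a b,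
          ‖cellFn (S (s m)) a (h (s m)) (τ (s m)) p - g k p‖ₑ := by
        rw [Lp.enorm_def, eLpNorm_one_eq_lintegral_enorm]
        refine lintegral_congr_ae ?_
        filter_upwards [Lp.coeFn_sub (z k (s m)) (g k),
          Integrable.coeFn_toL1 (integrableOn_cellFn (hS (s m)) (hRk k (s m)))] with p h1 h2
        rw [h1, Pi.sub_apply, h2]
      rw [e1]
      have hmeas : MeasurableSet (Ioo (0 : ℝ) (k + 1) ×ˢ Ioo a b) :=
        measurableSet_Ioo.prod measurableSet_Ioo
      refine (setLIntegral_mono' (hset.inter hmeas) fun p hp => ?_).trans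
        (lintegral_mono_set inter_subset_right)
      have hk : ⌊p.1⌋₊ = k := hp.1
      rw [hk, Real.enorm_eq_ofReal_abs, Real.enorm_eq_ofReal_abs]
      refine ENNReal.ofReal_le_ofReal ?_
      have hc := cellFn_mem (hS (s m)) (hRk k (s m)) (Ioo_subset_Icc_self hp.2.1)
        (Ioo_subset_Ico_self hp.2.2)
      change cellFn (S (s m)) a (h (s m)) (τ (s m)) p ∈ _ at hc
      have e2 : cellFn (S (s m)) a (h (s m)) (τ (s m)) p
          = max 0 (min (M k) (cellFn (S (s m)) a (h (s m)) (τ (s m)) p)) := by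
        rw [min_eq_right hc.2, max_eq_right hc.1]
      conv_lhs => rw [e2]
      simp only [hG]
      rw [max_comm 0, max_comm 0, min_comm (M k), min_comm (M k)]
      refine (abs_max_sub_max_le_abs _ _ _).trans ?_
      exact (abs_min_sub_min_le_max _ _ _ _).trans (by simp)
    refine tendsto_of_tendsto_of_tendsto_of_le_of_le tendsto_const_nhds ?_ (fun _ => zero_le) hle
    rw [show (0 : ENNReal) = ∑ k ∈ Finset.range (⌊T⌋₊ + 1), 0 by simp]
    refine tendsto_finsetSum _ fun k _ => ?_
    have := (tendsto_iff_edist_tendsto_0.1 (hgk k))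
    simpa [edist_eq_enorm_sub] using this

end Sequence


/-! ### Test functions -/

/-- The time derivative of a function of `(t, x)` -/
noncomputable def dTime (φ : ℝ × ℝ → ℝ) (p : ℝ × ℝ) : ℝ := deriv (fun t => φ (t, p.2)) p.1

/-- The space derivative of a function of `(t, x)` -/
noncomputable def dSpace (φ : ℝ × ℝ → ℝ) (p : ℝ × ℝ) : ℝ := deriv (fun x => φ (p.1, x)) p.2

section Test
variable {φ : ℝ × ℝ → ℝ} (hφ : ContDiff ℝ 1 φ)
include hφ

theorem hasDerivAt_time_fderiv (p : ℝ × ℝ) :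
    HasDerivAt (fun t => φ (t, p.2)) (fderiv ℝ φ p (1, 0)) p.1 :=
  HasFDerivAt.comp_hasDerivAt (f := fun t : ℝ => (t, p.2)) p.1
    (hφ.differentiable one_ne_zero p).hasFDerivAt ((hasDerivAt_id _).prodMk (hasDerivAt_const _ _))

theorem hasDerivAt_space_fderiv (p : ℝ × ℝ) :
    HasDerivAt (fun x => φ (p.1, x)) (fderiv ℝ φ p (0, 1)) p.2 :=
  HasFDerivAt.comp_hasDerivAt (f := fun x : ℝ => (p.1, x)) p.2
    (hφ.differentiable one_ne_zero p).hasFDerivAt ((hasDerivAt_const _ _).prodMk (hasDerivAt_id _))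

theorem dTime_eq : dTime φ = fun p => fderiv ℝ φ p (1, 0) :=
  funext fun p => (hasDerivAt_time_fderiv hφ p).deriv

theorem dSpace_eq : dSpace φ = fun p => fderiv ℝ φ p (0, 1) :=
  funext fun p => (hasDerivAt_space_fderiv hφ p).deriv

theorem hasDerivAt_dTime (p : ℝ × ℝ) : HasDerivAt (fun t => φ (t, p.2)) (dTime φ p) p.1 := by
  rw [dTime_eq hφ]; exact hasDerivAt_time_fderiv hφ p

theorem hasDerivAt_dSpace (p : ℝ × ℝ) : HasDerivAt (fun x => φ (p.1, x)) (dSpace φ p) p.2 := by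
  rw [dSpace_eq hφ]; exact hasDerivAt_space_fderiv hφ p

theorem continuous_dTime : Continuous (dTime φ) := by
  rw [dTime_eq hφ]; exact (hφ.continuous_fderiv one_ne_zero).clm_apply continuous_const

theorem continuous_dSpace : Continuous (dSpace φ) := by
  rw [dSpace_eq hφ]; exact (hφ.continuous_fderiv one_ne_zero).clm_apply continuous_const

theorem exists_time_slope {t t' : ℝ} (h : t < t') (x : ℝ) :
    ∃ ξ ∈ Ioo t t', (φ (t', x) - φ (t, x)) / (t' - t) = dTime φ (ξ, x) := by
  obtain ⟨ξ, hξ, e⟩ := exists_hasDerivAt_eq_slope (fun s => φ (s, x)) (fun s => dTime φ (s, x)) h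
    (hφ.continuous.comp (by fun_prop)).continuousOn fun s _ => hasDerivAt_dTime hφ (s, x)
  exact ⟨ξ, hξ, e.symm⟩

theorem exists_space_slope {x x' : ℝ} (h : x < x') (t : ℝ) :
    ∃ ξ ∈ Ioo x x', (φ (t, x') - φ (t, x)) / (x' - x) = dSpace φ (t, ξ) := by
  obtain ⟨ξ, hξ, e⟩ := exists_hasDerivAt_eq_slope (fun s => φ (t, s)) (fun s => dSpace φ (t, s)) h
    (hφ.continuous.comp (by fun_prop)).continuousOn fun s _ => hasDerivAt_dSpace hφ (t, s)
  exact ⟨ξ, hξ, e.symm⟩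

theorem exists_test_bound (hc : HasCompactSupport φ) : ∃ T > 0, ∃ Λ ≥ 0,
    (∀ p : ℝ × ℝ, T ≤ p.1 → φ p = 0 ∧ dTime φ p = 0 ∧ dSpace φ p = 0) ∧
    ∀ p, |φ p| ≤ Λ ∧ |dTime φ p| ≤ Λ ∧ |dSpace φ p| ≤ Λ := by
  obtain ⟨B, hB⟩ := (hc.isCompact.image continuous_fst).bddAbove
  have h0 : ∀ p : ℝ × ℝ, max B 0 + 1 ≤ p.1 → p ∉ tsupport φ := fun p hp hmem => by
    have := hB (mem_image_of_mem Prod.fst hmem)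
    linarith [le_max_left B 0]
  obtain ⟨c₀, h1⟩ := hφ.continuous.bounded_above_of_compact_support hc
  obtain ⟨c₁, h2⟩ := (hφ.continuous_fderiv one_ne_zero).bounded_above_of_compact_support
    (hc.fderiv (𝕜 := ℝ))
  have hc0 : 0 ≤ c₀ := (norm_nonneg _).trans (h1 0)
  have hc1 : 0 ≤ c₁ := (norm_nonneg _).trans (h2 0)
  refine ⟨max B 0 + 1, by positivity, c₀ + c₁, by positivity, fun p hp => ?_, fun p => ?_⟩
  · have h3 : fderiv ℝ φ p = 0 := by
      by_contra h
      exact h0 p hp (support_fderiv_subset ℝ h)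
    refine ⟨image_eq_zero_of_notMem_tsupport (h0 p hp), ?_, ?_⟩
    · rw [dTime_eq hφ]; simp [h3]
    · rw [dSpace_eq hφ]; simp [h3]
  · have hn : ∀ v : ℝ × ℝ, ‖v‖ ≤ 1 → |fderiv ℝ φ p v| ≤ c₁ := fun v hv =>
      ((fderiv ℝ φ p).le_opNorm v).trans ((mul_le_mul (h2 p) hv (norm_nonneg _) hc1).trans
        (mul_one _).le)
    refine ⟨(h1 p).trans (by linarith), ?_, ?_⟩
    · rw [dTime_eq hφ]; exact (hn _ (by simp [Prod.norm_def])).trans (by linarith)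
    · rw [dSpace_eq hφ]; exact (hn _ (by simp [Prod.norm_def])).trans (by linarith)

theorem abs_time_slope_le {Λ : ℝ} (hΛ : ∀ p, |dTime φ p| ≤ Λ) {t s : ℝ} (hs : 0 < s) (x : ℝ) :
    |(φ (t + s, x) - φ (t, x)) / s| ≤ Λ := by
  obtain ⟨ξ, -, e⟩ := exists_time_slope hφ (show t < t + s by linarith) x
  rw [add_sub_cancel_left] at e
  rw [e]; exact hΛ _

theorem abs_space_slope_le {Λ : ℝ} (hΛ : ∀ p, |dSpace φ p| ≤ Λ) {x s : ℝ} (hs : 0 < s) (t : ℝ) :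
    |(φ (t, x + s) - φ (t, x)) / s| ≤ Λ := by
  obtain ⟨ξ, -, e⟩ := exists_space_slope hφ (show x < x + s by linarith) t
  rw [add_sub_cancel_left] at e
  rw [e]; exact hΛ _

theorem tendsto_time_slope {T X s : ℕ → ℝ} {t x : ℝ} (hT : Tendsto T atTop (𝓝 t))
    (hX : Tendsto X atTop (𝓝 x)) (hs : ∀ i, 0 < s i) (hs0 : Tendsto s atTop (𝓝 0)) :
    Tendsto (fun i => (φ (T i + s i, X i) - φ (T i, X i)) / s i) atTop (𝓝 (dTime φ (t, x))) := by
  choose ξ hξ e using fun i => exists_time_slope hφ (show T i < T i + s i by linarith [hs i]) (X i)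
  simp only [add_sub_cancel_left] at e
  simp only [e]
  have h1 : Tendsto (fun i => T i + s i) atTop (𝓝 t) := by simpa using hT.add hs0
  have h2 : Tendsto ξ atTop (𝓝 t) :=
    tendsto_of_tendsto_of_tendsto_of_le_of_le hT h1 (fun i => (hξ i).1.le) fun i => (hξ i).2.le
  exact ((continuous_dTime hφ).tendsto (t, x)).comp (h2.prodMk_nhds hX)

theorem tendsto_space_slope {T X s : ℕ → ℝ} {t x : ℝ} (hT : Tendsto T atTop (𝓝 t))
    (hX : Tendsto X atTop (𝓝 x)) (hs : ∀ i, 0 < s i) (hs0 : Tendsto s atTop (𝓝 0)) :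
    Tendsto (fun i => (φ (T i, X i + s i) - φ (T i, X i)) / s i) atTop (𝓝 (dSpace φ (t, x))) := by
  choose ξ hξ e using fun i => exists_space_slope hφ (show X i < X i + s i by linarith [hs i]) (T i)
  simp only [add_sub_cancel_left] at e
  simp only [e]
  have h1 : Tendsto (fun i => X i + s i) atTop (𝓝 x) := by simpa using hX.add hs0
  have h2 : Tendsto ξ atTop (𝓝 x) :=
    tendsto_of_tendsto_of_tendsto_of_le_of_le hX h1 (fun i => (hξ i).1.le) fun i => (hξ i).2.le
  exact ((continuous_dSpace hφ).tendsto (t, x)).comp (hT.prodMk_nhds h2)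

end Test

/-! ### The discrete entropy inequality against a test function -/

/-- The numerical entropy flux at an interface -/
noncomputable def entropyFlux (a : ℝ) (f : ℝ → ℝ → ℝ → ℝ → ℝ) (ω : ℝ → ℝ) (α σ k : ℝ) (N : ℕ)
    (h τ : ℝ) (S : ℕ → ℕ → ℝ) (n j : ℕ) : ℝ :=
  σ * (laxFlux α (interfaceFlux a f ω N h τ S n j) (clip σ k (S n j)) (clip σ k (S n (j + 1)))
    - interfaceFlux a f ω N h τ S n j k)

/-- The numerical entropy source in a cell -/
noncomputable def entropySource (a : ℝ) (f : ℝ → ℝ → ℝ → ℝ → ℝ) (ω : ℝ → ℝ) (σ k : ℝ) (N : ℕ)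
    (h τ : ℝ) (S : ℕ → ℕ → ℝ) (n i : ℕ) : ℝ :=
  sgnSemi σ (S (n + 1) (i + 1) - k)
    * ((interfaceFlux a f ω N h τ S n (i + 1) k - interfaceFlux a f ω N h τ S n i k) / h)

/-- The numerical entropy production tested against `φ`, in a cell -/
noncomputable def entropyCell (a : ℝ) (f : ℝ → ℝ → ℝ → ℝ → ℝ) (ω : ℝ → ℝ) (α σ k : ℝ) (N : ℕ)
    (h τ : ℝ) (S : ℕ → ℕ → ℝ) (φ : ℝ × ℝ → ℝ) (n i : ℕ) : ℝ :=
  semi σ (S (n + 1) (i + 1) - k) * ((φ (n * τ + τ, a + i * h) - φ (n * τ, a + i * h)) / τ)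
    + entropyFlux a f ω α σ k N h τ S n (i + 1)
      * ((φ (n * τ, a + i * h + h) - φ (n * τ, a + i * h)) / h)
    - entropySource a f ω σ k N h τ S n i * φ (n * τ, a + i * h)

theorem IsScheme.discrete_entropy {a b L C α D V h τ : ℝ} {f : ℝ → ℝ → ℝ → ℝ → ℝ} {ω : ℝ → ℝ}
    {N : ℕ} {S : ℕ → ℕ → ℝ} (hf : FluxAssumption a b L C f) (hS : IsScheme a b f ω L α D V N h τ S)
    {σ : ℝ} (hσ : σ = 1 ∨ σ = -1) (k : ℝ) {φ : ℝ × ℝ → ℝ} (hφ : ∀ p, 0 ≤ φ p) {n₀ : ℕ}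
    (hn₀ : ∀ x, φ (n₀ * τ, x) = 0) :
    0 ≤ ∑ n ∈ Finset.range n₀, ∑ i ∈ Finset.range N, τ * h * entropyCell a f ω α σ k N h τ S φ n i
      + ∑ i ∈ Finset.range N, h * (semi σ (S 0 (i + 1) - k) * φ (0, a + i * h))
      + α * (∑ n ∈ Finset.range n₀, τ * (semi σ (S n 0 - k) * φ (n * τ, a))
        + ∑ n ∈ Finset.range n₀, τ * (semi σ (S n (N + 1) - k) * φ (n * τ, b))) := by
  have hh := hS.h_pos
  have hτ := hS.τ_pos
  set E : ℕ → ℕ → ℝ := fun n i => semi σ (S n (i + 1) - k) * φ (n * τ, a + i * h) with hE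
  set G : ℕ → ℕ → ℝ := fun n i =>
    entropyFlux a f ω α σ k N h τ S n i * φ (n * τ, a + i * h) with hG
  have hcell : ∀ n, ∀ i ∈ Finset.range N, h * (E (n + 1) i - E n i) + τ * (G n (i + 1) - G n i)
      ≤ τ * h * entropyCell a f ω α σ k N h τ S φ n i := by
    intro n i hi
    have hi' : i + 1 ≤ N := Finset.mem_range.1 hi
    have key := laxStep_entropy hS.lam_nonneg hS.L_le hS.lam_le
      (hS.interfaceFlux_lip hf n (show i ≤ N by omega)) (hS.interfaceFlux_lip hf n hi') hσ k
      (S n i) (S n (i + 1)) (S n (i + 2))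
    rw [← hS.step n i hi'] at key
    have key2 := mul_nonneg (mul_nonneg hh.le (hφ (n * τ, a + i * h))) (neg_nonneg.2 key)
    refine le_of_sub_nonneg (key2.trans (le_of_eq ?_))
    have e1 : a + ((i + 1 : ℕ) : ℝ) * h = a + i * h + h := by push_cast; ring
    have e2 : ((n + 1 : ℕ) : ℝ) * τ = n * τ + τ := by push_cast; ring
    simp only [hE, hG, e1, e2, entropyCell, entropySource, entropyFlux]
    field_simp
    ring
  have hsum : ∑ n ∈ Finset.range n₀, ∑ i ∈ Finset.range N,
      (h * (E (n + 1) i - E n i) + τ * (G n (i + 1) - G n i))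
      = ∑ i ∈ Finset.range N, h * (E n₀ i - E 0 i)
        + ∑ n ∈ Finset.range n₀, τ * (G n N - G n 0) := by
    simp_rw [Finset.sum_add_distrib]
    congr 1
    · rw [Finset.sum_comm]
      refine Finset.sum_congr rfl fun i _ => ?_
      rw [← Finset.mul_sum, Finset.sum_range_sub (fun n => E n i)]
    · refine Finset.sum_congr rfl fun n _ => ?_
      rw [← Finset.mul_sum, Finset.sum_range_sub (fun i => G n i)]
  have hle := Finset.sum_le_sum fun n (_ : n ∈ Finset.range n₀) =>
    Finset.sum_le_sum (hcell n)
  rw [hsum] at hle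
  have hinit : ∑ i ∈ Finset.range N, h * (E n₀ i - E 0 i)
      = -∑ i ∈ Finset.range N, h * (semi σ (S 0 (i + 1) - k) * φ (0, a + i * h)) := by
    rw [← Finset.sum_neg_distrib]
    refine Finset.sum_congr rfl fun i _ => ?_
    simp only [hE, hn₀, Nat.cast_zero, zero_mul]
    ring
  have hbdry : -(α * (∑ n ∈ Finset.range n₀, τ * (semi σ (S n 0 - k) * φ (n * τ, a))
        + ∑ n ∈ Finset.range n₀, τ * (semi σ (S n (N + 1) - k) * φ (n * τ, b))))
      ≤ ∑ n ∈ Finset.range n₀, τ * (G n N - G n 0) := by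
    rw [← Finset.sum_add_distrib, Finset.mul_sum, ← Finset.sum_neg_distrib]
    refine Finset.sum_le_sum fun n _ => ?_
    have b1 := (laxFlux_entropy_bounds hS.L_le (hS.interfaceFlux_lip hf n le_rfl) hσ k
      (S n N) (S n (N + 1))).1
    have b2 := (laxFlux_entropy_bounds hS.L_le (hS.interfaceFlux_lip hf n (Nat.zero_le N)) hσ k
      (S n 0) (S n (0 + 1))).2
    have eN : a + N * h = b := by rw [hS.mesh]; ring
    have c1 := mul_le_mul_of_nonneg_right b1 (hφ (n * τ, b))
    have c2 := mul_le_mul_of_nonneg_right b2 (hφ (n * τ, a))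
    have := mul_le_mul_of_nonneg_left (add_le_add c1 (neg_le_neg c2)) hτ.le
    simp only [hG, entropyFlux, eN, Nat.cast_zero, zero_mul, add_zero] at this ⊢
    linarith
  linarith

theorem integral_time_cells {τ T : ℝ} (hτ : 0 < τ) {n₀ : ℕ} (hn₀ : n₀ * τ ≤ T) {c : ℕ → ℝ}
    (hc : ∀ n ≥ n₀, c n = 0) :
    IntegrableOn (fun t => c ⌊t / τ⌋₊) (Ioo 0 T) ∧
    ∫ t in Ioo 0 T, c ⌊t / τ⌋₊ = ∑ n ∈ Finset.range n₀, τ * c n := by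
  have h0 : (0 : ℝ) ≤ n₀ * τ := by positivity
  obtain ⟨i1, e1⟩ := integral_comp_floor (a := 0) (b := n₀ * τ) (N := n₀) hτ (by ring) c
  simp only [sub_zero] at i1 e1
  have hz : EqOn (fun _ => (0 : ℝ)) (fun t => c ⌊t / τ⌋₊) (Ioc (n₀ * τ) T) := by
    intro t ht
    refine (hc _ ?_).symm
    rw [ge_iff_le, Nat.le_floor_iff (div_nonneg (h0.trans ht.1.le) hτ.le), le_div_iff₀ hτ]
    exact ht.1.le
  have i2 : IntervalIntegrable (fun t => c ⌊t / τ⌋₊) volume (n₀ * τ) T := by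
    rw [intervalIntegrable_iff_integrableOn_Ioc_of_le hn₀]
    exact integrableOn_zero.congr_fun hz measurableSet_Ioc
  have e2 : ∫ t in (n₀ * τ)..T, c ⌊t / τ⌋₊ = 0 := by
    rw [intervalIntegral.integral_of_le hn₀, ← setIntegral_congr_fun measurableSet_Ioc hz]
    simp
  constructor
  · rw [← integrableOn_Ioc_iff_integrableOn_Ioo,
      ← intervalIntegrable_iff_integrableOn_Ioc_of_le (h0.trans hn₀)]
    exact i1.trans i2
  · rw [← integral_Ioc_eq_integral_Ioo, ← intervalIntegral.integral_of_le (h0.trans hn₀),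
      ← intervalIntegral.integral_add_adjacent_intervals i1 i2, e1, e2, add_zero, Finset.mul_sum]

theorem integral_cells {a b h τ T : ℝ} {N n₀ : ℕ} (hab : a ≤ b) (hh : 0 < h) (hN : N * h = b - a)
    (hτ : 0 < τ) (hn₀ : n₀ * τ ≤ T) {c : ℕ → ℕ → ℝ} (hc : ∀ n ≥ n₀, ∀ i, c n i = 0) :
    ∫ p in Ioo 0 T ×ˢ Ioo a b, c ⌊p.1 / τ⌋₊ ⌊(p.2 - a) / h⌋₊
      = ∑ n ∈ Finset.range n₀, ∑ i ∈ Finset.range N, τ * h * c n i := by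
  have hint : IntegrableOn (fun p : ℝ × ℝ => c ⌊p.1 / τ⌋₊ ⌊(p.2 - a) / h⌋₊)
      (Ioo 0 T ×ˢ Ioo a b) := by
    refine integrableOn_of_abs_le (M := ∑ n ∈ Finset.range n₀, ∑ i ∈ Finset.range N, |c n i|)
      (measurable_cells c a h τ) fun p hp => ?_
    have hi := floor_cell_lt hh hN (Ioo_subset_Ico_self hp.2)
    by_cases hn : ⌊p.1 / τ⌋₊ < n₀
    · refine le_trans ?_ (Finset.single_le_sum
        (f := fun n => ∑ i ∈ Finset.range N, |c n i|)
        (fun n _ => Finset.sum_nonneg fun i _ => abs_nonneg _) (Finset.mem_range.2 hn))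
      exact Finset.single_le_sum (f := fun i => |c ⌊p.1 / τ⌋₊ i|) (fun i _ => abs_nonneg _)
        (Finset.mem_range.2 hi)
    · rw [hc _ (not_lt.1 hn), abs_zero]
      exact Finset.sum_nonneg fun n _ => Finset.sum_nonneg fun i _ => abs_nonneg _
  rw [Measure.volume_eq_prod, setIntegral_prod _ (by rwa [← Measure.volume_eq_prod])]
  have e : ∀ t : ℝ, ∫ x in Ioo a b, c ⌊t / τ⌋₊ ⌊(x - a) / h⌋₊
      = (fun n => h * ∑ i ∈ Finset.range N, c n i) ⌊t / τ⌋₊ := fun t => by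
    rw [← integral_Ioc_eq_integral_Ioo, ← intervalIntegral.integral_of_le hab,
      (integral_comp_floor hh hN _).2]
  simp only [e]
  rw [(integral_time_cells hτ hn₀ (c := fun n => h * ∑ i ∈ Finset.range N, c n i)
    fun n hn => by simp [hc n hn]).2]
  refine Finset.sum_congr rfl fun n _ => ?_
  rw [Finset.mul_sum, Finset.mul_sum]
  exact Finset.sum_congr rfl fun i _ => by ring


/-! ### Almost everywhere convergence along a subsequence -/

theorem exists_seq_tendsto_ae_of_integral {X : Type*} [MeasurableSpace X] {μ : Measure X}
    {w : ℕ → X → ℝ} (hw : ∀ m, Integrable (w m) μ) (h0 : ∀ m p, 0 ≤ w m p)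
    (h : Tendsto (fun m => ∫ p, w m p ∂μ) atTop (𝓝 0)) :
    ∃ s : ℕ → ℕ, StrictMono s ∧ ∀ᵐ p ∂μ, Tendsto (fun m => w (s m) p) atTop (𝓝 0) := by
  have h1 : Tendsto (fun m => eLpNorm (w m - 0) 1 μ) atTop (𝓝 0) := by
    have e : ∀ m, eLpNorm (w m - 0) 1 μ = ENNReal.ofReal (∫ p, w m p ∂μ) := fun m => by
      rw [sub_zero, eLpNorm_one_eq_lintegral_enorm, ← ofReal_integral_norm_eq_lintegral_enorm (hw m)]
      congr 1
      exact integral_congr_ae (Eventually.of_forall fun p => by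
        simp [Real.norm_eq_abs, abs_of_nonneg (h0 m p)])
    simp only [e]
    simpa using ENNReal.tendsto_ofReal h
  exact (tendstoInMeasure_of_tendsto_eLpNorm one_ne_zero (fun m => (hw m).1)
    aestronglyMeasurable_zero h1).exists_seq_tendsto_ae

section Rows
variable {a b M V' K R₁ h τ T L α D V : ℝ} {f : ℝ → ℝ → ℝ → ℝ → ℝ} {ω : ℝ → ℝ} {N : ℕ}
  {S : ℕ → ℕ → ℝ} (hS : IsScheme a b f ω L α D V N h τ S)
  (hR : ∀ n : ℕ, n * τ ≤ T + τ → RowBounds ω M V' K R₁ N h τ S n)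
include hS hR

theorem rowBounds_floor {t : ℝ} (ht : t ∈ Icc 0 T) :
    RowBounds ω M V' K R₁ N h τ S ⌊t / τ⌋₊ ∧ RowBounds ω M V' K R₁ N h τ S (⌊t / τ⌋₊ + 1) := by
  have h1 := floor_mul_le hS.τ_pos ht.1
  have h2 := hS.τ_pos
  refine ⟨hR _ (by linarith [ht.2]), hR _ ?_⟩
  push_cast
  linarith [ht.2]

theorem integral_right_neighbour_le (hab : a < b) (hT : 0 < T) :
    IntegrableOn (fun p : ℝ × ℝ => |S ⌊p.1 / τ⌋₊ (⌊(p.2 - a) / h⌋₊ + 2)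
      - S ⌊p.1 / τ⌋₊ (⌊(p.2 - a) / h⌋₊ + 1)|) (Ioo 0 T ×ˢ Ioo a b) ∧
    ∫ p in Ioo 0 T ×ˢ Ioo a b, |S ⌊p.1 / τ⌋₊ (⌊(p.2 - a) / h⌋₊ + 2)
      - S ⌊p.1 / τ⌋₊ (⌊(p.2 - a) / h⌋₊ + 1)| ≤ T * (h * V') := by
  have i : IntegrableOn (fun p : ℝ × ℝ => |S ⌊p.1 / τ⌋₊ (⌊(p.2 - a) / h⌋₊ + 2)
      - S ⌊p.1 / τ⌋₊ (⌊(p.2 - a) / h⌋₊ + 1)|) (Ioo 0 T ×ˢ Ioo a b) := by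
    refine integrableOn_of_abs_le (M := M)
      (measurable_cells (fun n i => |S n (i + 2) - S n (i + 1)|) a h τ) fun p hp => ?_
    have h1 := (rowBounds_floor hS hR (Ioo_subset_Icc_self hp.1)).1
    have h2 := floor_cell_lt hS.h_pos hS.mesh (Ioo_subset_Ico_self hp.2)
    have a1 := h1.nonneg (⌊(p.2 - a) / h⌋₊ + 1) (by omega)
    have a2 := h1.nonneg (⌊(p.2 - a) / h⌋₊ + 2) (by omega)
    have a3 := h1.le (⌊(p.2 - a) / h⌋₊ + 1) (by omega)
    have a4 := h1.le (⌊(p.2 - a) / h⌋₊ + 2) (by omega)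
    rw [abs_abs, abs_le]; constructor <;> linarith
  refine ⟨i, setIntegral_prod_le hab.le hT.le i fun t ht => ?_⟩
  have h1 := (rowBounds_floor hS hR (Ioo_subset_Icc_self ht)).1
  rw [(integral_comp_floor hS.h_pos hS.mesh
    (fun i => |S ⌊t / τ⌋₊ (i + 2) - S ⌊t / τ⌋₊ (i + 1)|)).2]
  refine mul_le_mul_of_nonneg_left ?_ hS.h_pos.le
  have := h1.variation
  rw [Finset.sum_range_succ'] at this
  have h3 := abs_nonneg (S ⌊t / τ⌋₊ (0 + 1) - S ⌊t / τ⌋₊ 0)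
  linarith

theorem integral_time_shift_le (hab : a < b) (hT : 0 < T) :
    IntegrableOn (fun p : ℝ × ℝ => |S (⌊p.1 / τ⌋₊ + 1) (⌊(p.2 - a) / h⌋₊ + 1)
      - S ⌊p.1 / τ⌋₊ (⌊(p.2 - a) / h⌋₊ + 1)|) (Ioo 0 T ×ˢ Ioo a b) ∧
    ∫ p in Ioo 0 T ×ˢ Ioo a b, |S (⌊p.1 / τ⌋₊ + 1) (⌊(p.2 - a) / h⌋₊ + 1)
      - S ⌊p.1 / τ⌋₊ (⌊(p.2 - a) / h⌋₊ + 1)| ≤ T * (K * τ) := by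
  have i : IntegrableOn (fun p : ℝ × ℝ => |S (⌊p.1 / τ⌋₊ + 1) (⌊(p.2 - a) / h⌋₊ + 1)
      - S ⌊p.1 / τ⌋₊ (⌊(p.2 - a) / h⌋₊ + 1)|) (Ioo 0 T ×ˢ Ioo a b) := by
    refine integrableOn_of_abs_le (M := M)
      (measurable_cells (fun n i => |S (n + 1) (i + 1) - S n (i + 1)|) a h τ) fun p hp => ?_
    obtain ⟨h1, h1'⟩ := rowBounds_floor hS hR (Ioo_subset_Icc_self hp.1)
    have h2 := floor_cell_lt hS.h_pos hS.mesh (Ioo_subset_Ico_self hp.2)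
    have a1 := h1.nonneg (⌊(p.2 - a) / h⌋₊ + 1) (by omega)
    have a2 := h1'.nonneg (⌊(p.2 - a) / h⌋₊ + 1) (by omega)
    have a3 := h1.le (⌊(p.2 - a) / h⌋₊ + 1) (by omega)
    have a4 := h1'.le (⌊(p.2 - a) / h⌋₊ + 1) (by omega)
    rw [abs_abs, abs_le]; constructor <;> linarith
  refine ⟨i, setIntegral_prod_le hab.le hT.le i fun t ht => ?_⟩
  have h1 := (rowBounds_floor hS hR (Ioo_subset_Icc_self ht)).1
  rw [(integral_comp_floor hS.h_pos hS.mesh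
    (fun i => |S (⌊t / τ⌋₊ + 1) (i + 1) - S ⌊t / τ⌋₊ (i + 1)|)).2]
  exact h1.time

end Rows

theorem integral_spatial_mean {a b T : ℝ} (hab : a < b) {g : ℝ × ℝ → ℝ}
    (hg : IntegrableOn g (Ioo 0 T ×ˢ Ioo a b)) :
    IntegrableOn (fun p : ℝ × ℝ => ∫ y in Ioo a b, g (p.1, y)) (Ioo 0 T ×ˢ Ioo a b) ∧
    ∫ p in Ioo 0 T ×ˢ Ioo a b, ∫ y in Ioo a b, g (p.1, y)
      = (b - a) * ∫ p in Ioo 0 T ×ˢ Ioo a b, g p := by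
  have h1 : IntegrableOn (fun t => ∫ x in Ioo a b, g (t, x)) (Ioo 0 T) := by
    have : Integrable g ((volume.restrict (Ioo 0 T)).prod (volume.restrict (Ioo a b))) := by
      rw [Measure.prod_restrict, ← Measure.volume_eq_prod]; exact hg
    exact this.integral_prod_left
  have h2 : IntegrableOn (fun p : ℝ × ℝ => ∫ y in Ioo a b, g (p.1, y)) (Ioo 0 T ×ˢ Ioo a b) := by
    have h3 : IntegrableOn (fun _ : ℝ => (1 : ℝ)) (Ioo a b) :=
      integrableOn_const measure_Ioo_lt_top.ne
    have := Integrable.mul_prod h1 h3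
    rw [Measure.prod_restrict, ← Measure.volume_eq_prod] at this
    simp only [mul_one] at this
    exact this
  refine ⟨h2, ?_⟩
  rw [Measure.volume_eq_prod, setIntegral_prod _ (by rwa [← Measure.volume_eq_prod]),
    setIntegral_prod _ (by rwa [← Measure.volume_eq_prod]), ← integral_const_mul]
  refine integral_congr_ae (Eventually.of_forall fun t => ?_)
  simp only
  rw [setIntegral_const, smul_eq_mul, Real.volume_real_Ioo_of_le hab.le]

theorem exists_subseq_ae {a b L α D V M V' K R₁ T Mρ : ℝ} {f : ℝ → ℝ → ℝ → ℝ → ℝ} {ω : ℝ → ℝ}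
    {N : ℕ → ℕ} {h τ : ℕ → ℝ} {S : ℕ → ℕ → ℕ → ℝ} (hab : a < b) (hT : 0 < T)
    (hS : ∀ m, IsScheme a b f ω L α D V (N m) (h m) (τ m) (S m))
    (hh : Tendsto h atTop (𝓝 0)) (hτ : Tendsto τ atTop (𝓝 0))
    (hR : ∀ m (n : ℕ), n * τ m ≤ T + τ m → RowBounds ω M V' K R₁ (N m) (h m) (τ m) (S m) n)
    {ρ : ℝ → ℝ → ℝ} (hρm : Measurable fun p : ℝ × ℝ => ρ p.1 p.2)
    (hρb : ∀ t ≤ T, ∀ x, |ρ t x| ≤ Mρ)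
    (hlim : Tendsto (fun m => eLpNorm (fun p : ℝ × ℝ =>
      cellFn (S m) a (h m) (τ m) p - ρ p.1 p.2) 1 (volume.restrict (Ioo 0 T ×ˢ Ioo a b)))
      atTop (𝓝 0)) :
    ∃ s : ℕ → ℕ, StrictMono s ∧ ∀ᵐ p ∂(volume.restrict (Ioo 0 T ×ˢ Ioo a b)),
      Tendsto (fun m => S (s m) (⌊p.1 / τ (s m)⌋₊ + 1) (⌊(p.2 - a) / h (s m)⌋₊ + 1)) atTop
        (𝓝 (ρ p.1 p.2)) ∧
      Tendsto (fun m => S (s m) ⌊p.1 / τ (s m)⌋₊ (⌊(p.2 - a) / h (s m)⌋₊ + 1)) atTop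
        (𝓝 (ρ p.1 p.2)) ∧
      Tendsto (fun m => S (s m) ⌊p.1 / τ (s m)⌋₊ (⌊(p.2 - a) / h (s m)⌋₊ + 2)) atTop
        (𝓝 (ρ p.1 p.2)) ∧
      Tendsto (fun m => ∫ y in a..b,
        |S (s m) ⌊p.1 / τ (s m)⌋₊ (⌊(y - a) / h (s m)⌋₊ + 1) - ρ p.1 y|) atTop (𝓝 0) := by
  have hR' : ∀ m (n : ℕ), n * τ m ≤ T → RowBounds ω M V' K R₁ (N m) (h m) (τ m) (S m) n :=
    fun m n hn => hR m n (by linarith [(hS m).τ_pos])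
  have hρi : IntegrableOn (fun p : ℝ × ℝ => ρ p.1 p.2) (Ioo 0 T ×ˢ Ioo a b) :=
    integrableOn_of_abs_le hρm fun p hp => hρb _ hp.1.2.le _
  set d : ℕ → ℝ × ℝ → ℝ := fun m p => |cellFn (S m) a (h m) (τ m) p - ρ p.1 p.2| with hd
  have hdm : ∀ m, Measurable (d m) := fun m =>
    ((measurable_cellFn (S m) a (h m) (τ m)).sub hρm).abs
  have hdi : ∀ m, IntegrableOn (d m) (Ioo 0 T ×ˢ Ioo a b) := fun m =>
    ((integrableOn_cellFn (hS m) (hR' m)).sub hρi).abs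
  have hd0 : Tendsto (fun m => ∫ p in Ioo 0 T ×ˢ Ioo a b, d m p) atTop (𝓝 0) := by
    have e : ∀ m, eLpNorm (fun p : ℝ × ℝ => cellFn (S m) a (h m) (τ m) p - ρ p.1 p.2) 1
        (volume.restrict (Ioo 0 T ×ˢ Ioo a b))
        = ENNReal.ofReal (∫ p in Ioo 0 T ×ˢ Ioo a b, d m p) := fun m => by
      rw [eLpNorm_one_eq_lintegral_enorm]
      exact (ofReal_integral_norm_eq_lintegral_enorm
        ((integrableOn_cellFn (hS m) (hR' m)).sub hρi)).symm
    simp only [e] at hlim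
    have := (ENNReal.tendsto_toReal ENNReal.zero_ne_top).comp hlim
    simp only [Function.comp_def, ENNReal.toReal_zero] at this
    refine this.congr fun m => ENNReal.toReal_ofReal (integral_nonneg fun p => abs_nonneg _)
  have hN := fun m => integral_right_neighbour_le (hS m) (hR m) hab hT
  have hP := fun m => integral_time_shift_le (hS m) (hR m) hab hT
  have hG := fun m => integral_spatial_mean hab (hdi m)
  set w : ℕ → ℝ × ℝ → ℝ := fun m p => (d m p + |S m ⌊p.1 / τ m⌋₊ (⌊(p.2 - a) / h m⌋₊ + 2)
      - S m ⌊p.1 / τ m⌋₊ (⌊(p.2 - a) / h m⌋₊ + 1)|)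
      + (|S m (⌊p.1 / τ m⌋₊ + 1) (⌊(p.2 - a) / h m⌋₊ + 1)
      - S m ⌊p.1 / τ m⌋₊ (⌊(p.2 - a) / h m⌋₊ + 1)| + ∫ y in Ioo a b, d m (p.1, y)) with hw
  have hwi : ∀ m, IntegrableOn (w m) (Ioo 0 T ×ˢ Ioo a b) := fun m =>
    ((hdi m).add (hN m).1).add ((hP m).1.add (hG m).1)
  have n1 : ∀ m p, 0 ≤ d m p := fun m p => abs_nonneg _
  have n2 : ∀ m (p : ℝ × ℝ), 0 ≤ ∫ y in Ioo a b, d m (p.1, y) := fun m p =>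
    integral_nonneg fun y => n1 m _
  have hwint : ∀ m, ∫ p in Ioo 0 T ×ˢ Ioo a b, w m p
      ≤ (∫ p in Ioo 0 T ×ˢ Ioo a b, d m p) + T * (h m * V') + (T * (K * τ m)
        + (b - a) * ∫ p in Ioo 0 T ×ˢ Ioo a b, d m p) := fun m => by
    have e1 : ∫ p in Ioo 0 T ×ˢ Ioo a b, w m p = _ :=
      integral_add ((hdi m).add (hN m).1) ((hP m).1.add (hG m).1)
    have e2 := integral_add (hdi m) (hN m).1
    have e3 := integral_add (hP m).1 (hG m).1
    have e4 := (hG m).2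
    have e5 := (hN m).2
    have e6 := (hP m).2
    refine e1.trans_le (le_trans (add_le_add e2.le e3.le) ?_)
    linarith
  have hw0 : ∀ m p, 0 ≤ w m p := fun m p =>
    add_nonneg (add_nonneg (n1 m p) (abs_nonneg _)) (add_nonneg (abs_nonneg _) (n2 m p))
  have hlimw : Tendsto (fun m => ∫ p in Ioo 0 T ×ˢ Ioo a b, w m p) atTop (𝓝 0) := by
    refine squeeze_zero (fun m => integral_nonneg (hw0 m)) hwint ?_
    have := (hd0.add ((hh.mul_const V').const_mul T)).add
      (((hτ.const_mul K).const_mul T).add (hd0.const_mul (b - a)))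
    simpa using this
  obtain ⟨s, hs, hae⟩ := exists_seq_tendsto_ae_of_integral hwi hw0 hlimw
  refine ⟨s, hs, hae.mono fun p hp => ?_⟩
  have q1 : Tendsto (fun m => d (s m) p) atTop (𝓝 0) :=
    squeeze_zero (fun m => n1 _ _) (fun m => by
      have := n2 (s m) p; simp only [hw]; linarith [abs_nonneg (S (s m) ⌊p.1 / τ (s m)⌋₊ (⌊(p.2 - a) / h (s m)⌋₊ + 2)
      - S (s m) ⌊p.1 / τ (s m)⌋₊ (⌊(p.2 - a) / h (s m)⌋₊ + 1)), abs_nonneg (S (s m) (⌊p.1 / τ (s m)⌋₊ + 1) (⌊(p.2 - a) / h (s m)⌋₊ + 1)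
      - S (s m) ⌊p.1 / τ (s m)⌋₊ (⌊(p.2 - a) / h (s m)⌋₊ + 1))]) hp
  have q2 := squeeze_zero (fun m => abs_nonneg (S (s m) ⌊p.1 / τ (s m)⌋₊
      (⌊(p.2 - a) / h (s m)⌋₊ + 2) - S (s m) ⌊p.1 / τ (s m)⌋₊ (⌊(p.2 - a) / h (s m)⌋₊ + 1)))
    (fun m => by
      have := n2 (s m) p; have := n1 (s m) p
      show _ ≤ w (s m) p
      simp only [hw]; linarith [abs_nonneg (S (s m) (⌊p.1 / τ (s m)⌋₊ + 1) (⌊(p.2 - a) / h (s m)⌋₊ + 1)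
      - S (s m) ⌊p.1 / τ (s m)⌋₊ (⌊(p.2 - a) / h (s m)⌋₊ + 1))]) hp
  have q3 := squeeze_zero (fun m => abs_nonneg (S (s m) (⌊p.1 / τ (s m)⌋₊ + 1)
      (⌊(p.2 - a) / h (s m)⌋₊ + 1) - S (s m) ⌊p.1 / τ (s m)⌋₊ (⌊(p.2 - a) / h (s m)⌋₊ + 1)))
    (fun m => by
      have := n2 (s m) p; have := n1 (s m) p
      show _ ≤ w (s m) p
      simp only [hw]; linarith [abs_nonneg (S (s m) ⌊p.1 / τ (s m)⌋₊ (⌊(p.2 - a) / h (s m)⌋₊ + 2)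
      - S (s m) ⌊p.1 / τ (s m)⌋₊ (⌊(p.2 - a) / h (s m)⌋₊ + 1))]) hp
  have q4 : Tendsto (fun m => ∫ y in Ioo a b, d (s m) (p.1, y)) atTop (𝓝 0) :=
    squeeze_zero (fun m => n2 _ _) (fun m => by
      have := n1 (s m) p
      simp only [hw]; linarith [abs_nonneg (S (s m) ⌊p.1 / τ (s m)⌋₊ (⌊(p.2 - a) / h (s m)⌋₊ + 2)
      - S (s m) ⌊p.1 / τ (s m)⌋₊ (⌊(p.2 - a) / h (s m)⌋₊ + 1)), abs_nonneg (S (s m) (⌊p.1 / τ (s m)⌋₊ + 1) (⌊(p.2 - a) / h (s m)⌋₊ + 1)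
      - S (s m) ⌊p.1 / τ (s m)⌋₊ (⌊(p.2 - a) / h (s m)⌋₊ + 1))]) hp
  have r1 : Tendsto (fun m => S (s m) ⌊p.1 / τ (s m)⌋₊ (⌊(p.2 - a) / h (s m)⌋₊ + 1)) atTop
      (𝓝 (ρ p.1 p.2)) := by
    have := ((tendsto_zero_iff_abs_tendsto_zero _).2 q1).add_const (ρ p.1 p.2)
    simpa [cellFn] using this
  refine ⟨?_, r1, ?_, ?_⟩
  · simpa using ((tendsto_zero_iff_abs_tendsto_zero _).2 q3).add r1
  · simpa using ((tendsto_zero_iff_abs_tendsto_zero _).2 q2).add r1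
  · refine q4.congr fun m => ?_
    rw [intervalIntegral.integral_of_le hab.le, integral_Ioc_eq_integral_Ioo]
    rfl


/-! ### Passage to the limit in the discrete entropy inequality -/

/-- The interior part of the entropy functional, with entropy `E`, entropy flux `F` and
source `G` -/
noncomputable def bulk (a b : ℝ) (E F G : ℝ × ℝ → ℝ) (φ : ℝ × ℝ → ℝ) : ℝ :=
  ∫ p in Ioi (0 : ℝ) ×ˢ Ioo a b, (E p * dTime φ p + F p * dSpace φ p - G p * φ p)

/-- The semi-entropy of `ρ` -/
noncomputable def entE (σ : ℝ) (ρ : ℝ → ℝ → ℝ) (k : ℝ) (p : ℝ × ℝ) : ℝ := semi σ (ρ p.1 p.2 - k)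

/-- The entropy flux of `ρ` -/
noncomputable def entF (f : ℝ → ℝ → ℝ → ℝ → ℝ) (σ : ℝ) (ρ R : ℝ → ℝ → ℝ) (k : ℝ) (p : ℝ × ℝ) : ℝ :=
  sgnSemi σ (ρ p.1 p.2 - k) * (f p.1 p.2 (ρ p.1 p.2) (R p.1 p.2) - f p.1 p.2 k (R p.1 p.2))

/-- The entropy source of `ρ`, where `R'` stands for `∂_x R` -/
noncomputable def entG (a b : ℝ) (f : ℝ → ℝ → ℝ → ℝ → ℝ) (σ : ℝ) (ρ R R' : ℝ → ℝ → ℝ) (k : ℝ)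
    (p : ℝ × ℝ) : ℝ :=
  sgnSemi σ (ρ p.1 p.2 - k)
    * (dX a b f p.1 p.2 k (R p.1 p.2) + dR f p.1 p.2 k (R p.1 p.2) * R' p.1 p.2)

theorem tendsto_floor_mul {t : ℝ} {τ : ℕ → ℝ} (ht : 0 ≤ t) (hτ : ∀ m, 0 < τ m)
    (h0 : Tendsto τ atTop (𝓝 0)) : Tendsto (fun m => ⌊t / τ m⌋₊ * τ m) atTop (𝓝 t) := by
  have h1 : Tendsto (fun m => t - τ m) atTop (𝓝 t) := by simpa using h0.const_sub t
  refine tendsto_of_tendsto_of_tendsto_of_le_of_le h1 tendsto_const_nhds (fun m => ?_)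
    fun m => floor_mul_le (hτ m) ht
  have := Nat.lt_floor_add_one (t / τ m)
  rw [div_lt_iff₀ (hτ m)] at this
  simp only; linarith

theorem semi_sub_le {σ : ℝ} (hσ : σ = 1 ∨ σ = -1) {u k M : ℝ} (h0 : 0 ≤ u) (hM : u ≤ M) :
    semi σ (u - k) ≤ M + |k| := by
  refine (semi_le_abs hσ _).trans ((abs_sub _ _).trans ?_)
  rw [abs_of_nonneg h0]; linarith

theorem tendsto_sgnSemi {σ u k : ℝ} (hσ : σ = 1 ∨ σ = -1) (hne : u ≠ k) {v : ℕ → ℝ}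
    (hv : Tendsto v atTop (𝓝 u)) :
    Tendsto (fun m => sgnSemi σ (v m - k)) atTop (𝓝 (sgnSemi σ (u - k))) := by
  have h0 : σ * (u - k) ≠ 0 := mul_ne_zero (by rcases hσ with rfl | rfl <;> norm_num)
    (sub_ne_zero.2 hne)
  have h1 : Tendsto (fun m => σ * (v m - k)) atTop (𝓝 (σ * (u - k))) :=
    (hv.sub_const k).const_mul σ
  refine Tendsto.congr' ?_ tendsto_const_nhds
  rcases lt_or_gt_of_ne h0 with h | h
  · filter_upwards [h1.eventually_lt_const h] with m hm
    simp [sgnSemi, not_lt.2 hm.le, not_lt.2 h.le]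
  · filter_upwards [h1.eventually_const_lt h] with m hm
    simp [sgnSemi, hm, h]

theorem tendsto_setIntegral_of_bounded {X : Type*} [MeasurableSpace X] {μ : Measure X} {s : Set X}
    (hs : MeasurableSet s) (hμ : μ s ≠ ⊤) {g : ℕ → X → ℝ} {g₀ : X → ℝ} {c : ℝ}
    (hm : ∀ m, Measurable (g m)) (hc : ∀ m, ∀ p ∈ s, |g m p| ≤ c)
    (hlim : ∀ᵐ p ∂(μ.restrict s), Tendsto (fun m => g m p) atTop (𝓝 (g₀ p))) :
    Tendsto (fun m => ∫ p in s, g m p ∂μ) atTop (𝓝 (∫ p in s, g₀ p ∂μ)) :=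
  tendsto_integral_of_dominated_convergence (fun _ => c) (fun m => (hm m).aestronglyMeasurable)
    (integrableOn_const hμ)
    (fun m => (ae_restrict_iff' hs).2 (Eventually.of_forall fun p hp => hc m p hp)) hlim

section Single
variable {a b L C α D V h τ : ℝ} {f : ℝ → ℝ → ℝ → ℝ → ℝ} {ω : ℝ → ℝ}
  {N : ℕ} {S : ℕ → ℕ → ℝ} (hf : FluxAssumption a b L C f) (hS : IsScheme a b f ω L α D V N h τ S)
  {σ : ℝ} (hσ : σ = 1 ∨ σ = -1) (k : ℝ) {φ : ℝ × ℝ → ℝ}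
include hf hS hσ

theorem IsScheme.integral_entropy (hab : a < b) (hφ : ∀ p, 0 ≤ φ p) {T : ℝ} (hT : 0 < T)
    (hφT : ∀ p : ℝ × ℝ, T ≤ p.1 → φ p = 0) (hτ1 : τ ≤ 1) :
    0 ≤ (∫ p in Ioo 0 (T + 1) ×ˢ Ioo a b,
        entropyCell a f ω α σ k N h τ S φ ⌊p.1 / τ⌋₊ ⌊(p.2 - a) / h⌋₊)
      + (∫ x in Ioo a b, semi σ (S 0 (⌊(x - a) / h⌋₊ + 1) - k) * φ (0, a + ⌊(x - a) / h⌋₊ * h))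
      + α * ((∫ t in Ioo 0 (T + 1), semi σ (S ⌊t / τ⌋₊ 0 - k) * φ (⌊t / τ⌋₊ * τ, a))
        + ∫ t in Ioo 0 (T + 1), semi σ (S ⌊t / τ⌋₊ (N + 1) - k) * φ (⌊t / τ⌋₊ * τ, b)) := by
  have hτ := hS.τ_pos
  have hT1 : T ≤ ⌈T / τ⌉₊ * τ := by
    have := Nat.le_ceil (T / τ)
    rwa [div_le_iff₀ hτ] at this
  have hT2 : ⌈T / τ⌉₊ * τ ≤ T + 1 := by
    have := Nat.ceil_lt_add_one (div_pos hT hτ).le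
    have := mul_lt_mul_of_pos_right this hτ
    rw [add_mul, div_mul_cancel₀ _ hτ.ne'] at this
    linarith
  have hz : ∀ n ≥ ⌈T / τ⌉₊, ∀ x, φ (n * τ, x) = 0 ∧ φ (n * τ + τ, x) = 0 := by
    intro n hn x
    have : (⌈T / τ⌉₊ : ℝ) * τ ≤ n * τ := mul_le_mul_of_nonneg_right (Nat.cast_le.2 hn) hτ.le
    exact ⟨hφT _ (by simp only; linarith), hφT _ (by simp only; linarith)⟩
  have key := hS.discrete_entropy hf hσ k hφ (n₀ := ⌈T / τ⌉₊) fun x => (hz _ le_rfl x).1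
  rw [integral_cells hab.le hS.h_pos hS.mesh hτ hT2 (c := entropyCell a f ω α σ k N h τ S φ)
    fun n hn i => by simp [entropyCell, hz n hn]]
  rw [(integral_time_cells hτ hT2 (c := fun n => semi σ (S n 0 - k) * φ (n * τ, a))
    fun n hn => by simp [hz n hn]).2]
  rw [(integral_time_cells hτ hT2 (c := fun n => semi σ (S n (N + 1) - k) * φ (n * τ, b))
    fun n hn => by simp [hz n hn]).2]
  rw [← integral_Ioc_eq_integral_Ioo, ← intervalIntegral.integral_of_le hab.le,
    (integral_comp_floor hS.h_pos hS.mesh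
      fun i => semi σ (S 0 (i + 1) - k) * φ (0, a + i * h)).2, Finset.mul_sum]
  exact key

theorem IsScheme.abs_entropyCell_le (hab : a < b) (hφ : ContDiff ℝ 1 φ) {Λ M V' K R₁ T : ℝ}
    (hΛ : ∀ p, |φ p| ≤ Λ ∧ |dTime φ p| ≤ Λ ∧ |dSpace φ p| ≤ Λ)
    (hR : ∀ n : ℕ, n * τ ≤ T + τ → RowBounds ω M V' K R₁ N h τ S n)
    {p : ℝ × ℝ} (hp : p ∈ Ioo 0 T ×ˢ Ioo a b) :
    |entropyCell a f ω α σ k N h τ S φ ⌊p.1 / τ⌋₊ ⌊(p.2 - a) / h⌋₊|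
      ≤ ((M + |k|) + α * (M + |k|) + C * |k| * (1 + R₁)) * Λ := by
  have hh := hS.h_pos
  obtain ⟨h1, h1'⟩ := rowBounds_floor hS hR (Ioo_subset_Icc_self hp.1)
  have h2 := floor_cell_lt hS.h_pos hS.mesh (Ioo_subset_Ico_self hp.2)
  set n := ⌊p.1 / τ⌋₊
  set i := ⌊(p.2 - a) / h⌋₊
  have hα : 0 ≤ α := hf.L_pos.le.trans hS.L_le
  have hΛ0 : 0 ≤ Λ := (abs_nonneg _).trans (hΛ 0).1
  have b1 : |semi σ (S (n + 1) (i + 1) - k)| ≤ M + |k| := by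
    rw [abs_of_nonneg (semi_nonneg _ _)]
    exact semi_sub_le hσ (h1'.nonneg _ (by omega)) (h1'.le _ (by omega))
  have hM : 0 ≤ M + |k| := (abs_nonneg _).trans b1
  have b2 : |entropyFlux a f ω α σ k N h τ S n (i + 1)| ≤ α * (M + |k|) := by
    obtain ⟨l, u⟩ := laxFlux_entropy_bounds hS.L_le (hS.interfaceFlux_lip hf n (show i + 1 ≤ N from h2))
      hσ k (S n (i + 1)) (S n (i + 1 + 1))
    have e1 := mul_le_mul_of_nonneg_left (semi_sub_le hσ (k := k) (h1.nonneg (i + 1) (by omega))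
      (h1.le (i + 1) (by omega))) hα
    have e2 := mul_le_mul_of_nonneg_left (semi_sub_le hσ (k := k) (h1.nonneg (i + 1 + 1) (by omega))
      (h1.le (i + 1 + 1) (by omega))) hα
    exact abs_le.2 ⟨by unfold entropyFlux; linarith, by unfold entropyFlux; linarith⟩
  have b3 : |entropySource a f ω σ k N h τ S n i| ≤ C * |k| * (1 + R₁) := by
    unfold entropySource
    rw [abs_mul, abs_div, abs_of_pos hh]
    have hd := hf.abs_sub_le_xR hab (hS.time_nonneg n) (hS.interface_mem (show i ≤ N by omega))
      (hS.interface_mem (show i + 1 ≤ N from h2)) k (discreteNonlocal ω N h (S n) i)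
      (discreteNonlocal ω N h (S n) (i + 1))
    have hd2 := h1.nonlocal i h2
    have e1 : |a + ((i + 1 : ℕ) : ℝ) * h - (a + i * h)| = h := by
      rw [show a + ((i + 1 : ℕ) : ℝ) * h - (a + i * h) = h by push_cast; ring, abs_of_pos hh]
    rw [e1] at hd
    have hC : 0 ≤ C * |k| := mul_nonneg hf.C_pos.le (abs_nonneg _)
    have e3 : |interfaceFlux a f ω N h τ S n (i + 1) k - interfaceFlux a f ω N h τ S n i k| / h
        ≤ C * |k| * (1 + R₁) := by
      rw [div_le_iff₀ hh]
      refine hd.trans ?_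
      rw [mul_assoc (C * |k|)]
      exact mul_le_mul_of_nonneg_left (by linarith) hC
    calc _ ≤ 1 * (|interfaceFlux a f ω N h τ S n (i + 1) k - interfaceFlux a f ω N h τ S n i k| / h) :=
          mul_le_mul_of_nonneg_right (abs_sgnSemi_le hσ _) (by positivity)
      _ ≤ _ := by rw [one_mul]; exact e3
  have d1 := abs_time_slope_le hφ (fun p => (hΛ p).2.1) (t := n * τ) hS.τ_pos (a + i * h)
  have d2 := abs_space_slope_le hφ (fun p => (hΛ p).2.2) (x := a + i * h) hh (n * τ)
  have d3 := (hΛ (n * τ, a + i * h)).1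
  unfold entropyCell
  refine (abs_sub _ _).trans ((add_le_add_left (abs_add_le _ _) _).trans ?_)
  simp only [abs_mul (semi _ _), abs_mul (entropyFlux _ _ _ _ _ _ _ _ _ _ _ _),
    abs_mul (entropySource _ _ _ _ _ _ _ _ _ _ _)]
  have m1 := mul_le_mul b1 d1 (abs_nonneg _) hM
  have m2 := mul_le_mul b2 d2 (abs_nonneg _) (mul_nonneg hα hM)
  have m3 := mul_le_mul b3 d3 (abs_nonneg _) ((abs_nonneg _).trans b3)
  linarith

end Single

section Limit
variable {a b L C α D V M V' K R₁ T Mρ : ℝ} {f : ℝ → ℝ → ℝ → ℝ → ℝ} {ω : ℝ → ℝ}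
  {N : ℕ → ℕ} {h τ : ℕ → ℝ} {S : ℕ → ℕ → ℕ → ℝ} (hab : a < b)
  (hf : FluxAssumption a b L C f) (hω : KernelAssumption a b ω)
  (hS : ∀ m, IsScheme a b f ω L α D V (N m) (h m) (τ m) (S m))
  (hh : Tendsto h atTop (𝓝 0)) (hτ : Tendsto τ atTop (𝓝 0))
  {ρ : ℝ → ℝ → ℝ} {σ : ℝ} (hσ : σ = 1 ∨ σ = -1) {k : ℝ} {φ : ℝ × ℝ → ℝ} (hφ : ContDiff ℝ 1 φ)
include hab hf hω hS hh hτ hσ hφ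

theorem tendsto_entropyCell {p : ℝ × ℝ} (hp : p ∈ Ioo 0 T ×ˢ Ioo a b) (hk : ρ p.1 p.2 ≠ k)
    (hρi : IntervalIntegrable (ρ p.1) volume a b)
    (h1 : Tendsto (fun m => S m (⌊p.1 / τ m⌋₊ + 1) (⌊(p.2 - a) / h m⌋₊ + 1)) atTop
      (𝓝 (ρ p.1 p.2)))
    (h2 : Tendsto (fun m => S m ⌊p.1 / τ m⌋₊ (⌊(p.2 - a) / h m⌋₊ + 1)) atTop (𝓝 (ρ p.1 p.2)))
    (h3 : Tendsto (fun m => S m ⌊p.1 / τ m⌋₊ (⌊(p.2 - a) / h m⌋₊ + 2)) atTop (𝓝 (ρ p.1 p.2)))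
    (h4 : Tendsto (fun m => ∫ y in a..b,
      |S m ⌊p.1 / τ m⌋₊ (⌊(y - a) / h m⌋₊ + 1) - ρ p.1 y|) atTop (𝓝 0)) :
    Tendsto (fun m => entropyCell a f ω α σ k (N m) (h m) (τ m) (S m) φ ⌊p.1 / τ m⌋₊
      ⌊(p.2 - a) / h m⌋₊) atTop (𝓝 (entE σ ρ k p * dTime φ p
        + entF f σ ρ (nonlocalTerm a b ω ρ) k p * dSpace φ p
        - entG a b f σ ρ (nonlocalTerm a b ω ρ) (nonlocalDeriv a b ω ρ) k p * φ p)) := by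
  obtain ⟨t, x⟩ := p
  obtain ⟨ht, hx⟩ := hp
  simp only at *
  obtain ⟨B, hB⟩ := hω.exists_bound
  obtain ⟨κ, hκ, hmass⟩ := hω.mass_lower_bound
  have hxI := Ioo_subset_Icc_self hx
  have hW : kernelMass a b ω x ≠ 0 := (hκ.trans_le (hmass x hxI)).ne'
  have hh0 := fun m => (hS m).h_pos
  have hN := fun m => (hS m).mesh
  have lt : Tendsto (fun m => ⌊t / τ m⌋₊ * τ m) atTop (𝓝 t) :=
    tendsto_floor_mul ht.1.le (fun m => (hS m).τ_pos) hτ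
  have lx : Tendsto (fun m => a + ⌊(x - a) / h m⌋₊ * h m) atTop (𝓝 x) := by
    have := (tendsto_floor_mul (sub_nonneg.2 hxI.1) hh0 hh).const_add a
    rwa [add_sub_cancel] at this
  have lx' : Tendsto (fun m => a + (⌊(x - a) / h m⌋₊ + 1 : ℕ) * h m) atTop (𝓝 x) := by
    have := lx.add hh
    rw [add_zero] at this
    refine this.congr fun m => ?_
    push_cast; ring
  have lR := hB.tendsto_discreteNonlocal hab hh0 hN hh lx hW hρi h4
  have lR' := hB.tendsto_discreteNonlocal hab hh0 hN hh lx' hW hρi h4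
  have lD := hB.tendsto_discreteNonlocal_diff hab hh0 hN hh lx hW hρi h4
  have hcell : ∀ m, ⌊(x - a) / h m⌋₊ < N m := fun m =>
    floor_cell_lt (hh0 m) (hN m) (Ioo_subset_Ico_self hx)
  have mX : ∀ m, a + ⌊(x - a) / h m⌋₊ * h m ∈ Icc a b := fun m =>
    (hS m).interface_mem (hcell m).le
  have mX' : ∀ m, a + (⌊(x - a) / h m⌋₊ + 1 : ℕ) * h m ∈ Icc a b := fun m =>
    (hS m).interface_mem (hcell m)
  have mT : ∀ m, (0 : ℝ) ≤ ⌊t / τ m⌋₊ * τ m := fun m => (hS m).time_nonneg _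
  have lE : Tendsto (fun m => semi σ (S m (⌊t / τ m⌋₊ + 1) (⌊(x - a) / h m⌋₊ + 1) - k)) atTop
      (𝓝 (entE σ ρ k (t, x))) :=
    ((continuous_semi σ).tendsto _).comp (h1.sub_const k)
  have lsrc : Tendsto (fun m => entropySource a f ω σ k (N m) (h m) (τ m) (S m) ⌊t / τ m⌋₊
      ⌊(x - a) / h m⌋₊) atTop
      (𝓝 (entG a b f σ ρ (nonlocalTerm a b ω ρ) (nonlocalDeriv a b ω ρ) k (t, x))) :=
    (tendsto_sgnSemi hσ hk h1).mul (hf.tendsto_diffQuotient hab (k := k) mT mX mX' ht.1.le hxI lt lx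
      lx' lR lR' (fun m => by push_cast; ring) hh0 lD)
  have lg : ∀ {r : ℕ → ℝ} {u : ℝ}, Tendsto r atTop (𝓝 u) → Tendsto (fun m =>
      interfaceFlux a f ω (N m) (h m) (τ m) (S m) ⌊t / τ m⌋₊ (⌊(x - a) / h m⌋₊ + 1) (r m)) atTop
      (𝓝 (f t x u (nonlocalTerm a b ω ρ t x))) := fun hr =>
    tendsto_of_continuous_clamp (hf.continuous_clamp hab) mT mX' ht.1.le hxI lt lx' hr lR'
  have lv := ((continuous_clip σ k).tendsto _).comp h2
  have lw := ((continuous_clip σ k).tendsto _).comp h3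
  have lF : Tendsto (fun m => entropyFlux a f ω α σ k (N m) (h m) (τ m) (S m) ⌊t / τ m⌋₊
      (⌊(x - a) / h m⌋₊ + 1)) atTop (𝓝 (entF f σ ρ (nonlocalTerm a b ω ρ) k (t, x))) := by
    have := (((((lg lv).add (lg lw)).sub ((lw.sub lv).const_mul α)).const_mul (1 / 2)).sub
      (lg (tendsto_const_nhds (x := k)))).const_mul σ
    unfold entF
    rw [sgnSemi_mul_sub hσ fun r => f t x r (nonlocalTerm a b ω ρ t x)]
    have half : ∀ A B : ℝ, 1 / 2 * (A + A - α * (B - B)) = A := fun A B => by ring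
    rw [half] at this
    exact this
  have q1 := tendsto_time_slope hφ lt lx (fun m => (hS m).τ_pos) hτ
  have q2 := tendsto_space_slope hφ lt lx hh0 hh
  have q3 := (hφ.continuous.tendsto (t, x)).comp (lt.prodMk_nhds lx)
  exact ((lE.mul q1).add (lF.mul q2)).sub (lsrc.mul q3)

theorem entropy_inequality_of_ae_ne (hφ0 : ∀ p, 0 ≤ φ p) {Λ : ℝ} (hT : 0 < T)
    (hφT : ∀ p : ℝ × ℝ, T ≤ p.1 → φ p = 0 ∧ dTime φ p = 0 ∧ dSpace φ p = 0)
    (hΛ : ∀ p, |φ p| ≤ Λ ∧ |dTime φ p| ≤ Λ ∧ |dSpace φ p| ≤ Λ) (hτ1 : ∀ m, τ m ≤ 1)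
    (hR : ∀ m (n : ℕ), n * τ m ≤ T + 1 + τ m → RowBounds ω M V' K R₁ (N m) (h m) (τ m) (S m) n)
    (hρm : Measurable fun p : ℝ × ℝ => ρ p.1 p.2) (hρb : ∀ t ≤ T + 1, ∀ x, |ρ t x| ≤ Mρ)
    (hae : ∀ᵐ p ∂(volume.restrict (Ioo 0 (T + 1) ×ˢ Ioo a b)),
      Tendsto (fun m => S m (⌊p.1 / τ m⌋₊ + 1) (⌊(p.2 - a) / h m⌋₊ + 1)) atTop (𝓝 (ρ p.1 p.2)) ∧
      Tendsto (fun m => S m ⌊p.1 / τ m⌋₊ (⌊(p.2 - a) / h m⌋₊ + 1)) atTop (𝓝 (ρ p.1 p.2)) ∧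
      Tendsto (fun m => S m ⌊p.1 / τ m⌋₊ (⌊(p.2 - a) / h m⌋₊ + 2)) atTop (𝓝 (ρ p.1 p.2)) ∧
      Tendsto (fun m => ∫ y in a..b,
        |S m ⌊p.1 / τ m⌋₊ (⌊(y - a) / h m⌋₊ + 1) - ρ p.1 y|) atTop (𝓝 0))
    (hk : ∀ᵐ p ∂(volume.restrict (Ioo 0 (T + 1) ×ˢ Ioo a b)), ρ p.1 p.2 ≠ k)
    {ρo ρa ρb : ℝ → ℝ}
    (ho : ∀ᵐ x ∂(volume.restrict (Ioo a b)),
      Tendsto (fun m => S m 0 (⌊(x - a) / h m⌋₊ + 1)) atTop (𝓝 (ρo x)))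
    (ha : ∀ᵐ t ∂(volume.restrict (Ioi 0)),
      Tendsto (fun m => S m ⌊t / τ m⌋₊ 0) atTop (𝓝 (ρa t)))
    (hb : ∀ᵐ t ∂(volume.restrict (Ioi 0)),
      Tendsto (fun m => S m ⌊t / τ m⌋₊ (N m + 1)) atTop (𝓝 (ρb t))) :
    0 ≤ bulk a b (entE σ ρ k) (entF f σ ρ (nonlocalTerm a b ω ρ) k)
        (entG a b f σ ρ (nonlocalTerm a b ω ρ) (nonlocalDeriv a b ω ρ) k) φ
      + (∫ x in Ioo a b, semi σ (ρo x - k) * φ (0, x))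
      + α * ((∫ t in Ioi (0 : ℝ), semi σ (ρa t - k) * φ (t, a))
        + ∫ t in Ioi (0 : ℝ), semi σ (ρb t - k) * φ (t, b)) := by
  have hh0 := fun m => (hS m).h_pos
  have hτ0 := fun m => (hS m).τ_pos
  have hvol : volume (Ioo 0 (T + 1) ×ˢ Ioo a b) ≠ ⊤ := by
    rw [Measure.volume_eq_prod, Measure.prod_prod]
    exact (ENNReal.mul_lt_top measure_Ioo_lt_top measure_Ioo_lt_top).ne
  have hρi : ∀ t ≤ T + 1, IntervalIntegrable (ρ t) volume a b := fun t ht => by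
    rw [intervalIntegrable_iff, uIoc_of_le hab.le]
    exact Measure.integrableOn_of_bounded (M := Mρ) measure_Ioc_lt_top.ne
      (hρm.comp measurable_prodMk_left).aestronglyMeasurable (Eventually.of_forall fun x => hρb t ht x)
  have hmem := ae_restrict_mem (μ := (volume : Measure (ℝ × ℝ)))
    (measurableSet_Ioo.prod measurableSet_Ioo : MeasurableSet (Ioo 0 (T + 1) ×ˢ Ioo a b))
  have l1 := tendsto_setIntegral_of_bounded (measurableSet_Ioo.prod measurableSet_Ioo) hvol
    (fun m => measurable_cells (entropyCell a f ω α σ k (N m) (h m) (τ m) (S m) φ) a (h m) (τ m))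
    (fun m p hp => (hS m).abs_entropyCell_le hf hσ k hab hφ hΛ (hR m) hp)
    (by
      filter_upwards [hae, hk, hmem] with p q1 q2 q3
      exact tendsto_entropyCell hab hf hω hS hh hτ hσ hφ q3 q2 (hρi _ q3.1.2.le) q1.1 q1.2.1
        q1.2.2.1 q1.2.2.2)
  have hΛ0 : 0 ≤ Λ := (abs_nonneg _).trans (hΛ 0).1
  have hb2 : ∀ {u : ℝ}, 0 ≤ u → u ≤ M → ∀ p, |semi σ (u - k) * φ p| ≤ (M + |k|) * Λ := by
    intro u h0 hM p
    have := semi_sub_le hσ (k := k) h0 hM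
    rw [abs_mul, abs_of_nonneg (semi_nonneg _ _)]
    exact mul_le_mul this (hΛ p).1 (abs_nonneg _) ((semi_nonneg _ _).trans this)
  have l2 := tendsto_setIntegral_of_bounded (μ := volume) (s := Ioo a b)
    (g := fun m x => semi σ (S m 0 (⌊(x - a) / h m⌋₊ + 1) - k)
      * φ (0, a + ⌊(x - a) / h m⌋₊ * h m)) (g₀ := fun x => semi σ (ρo x - k) * φ (0, x))
    (c := (M + |k|) * Λ) measurableSet_Ioo measure_Ioo_lt_top.ne
    (fun m => (measurable_from_nat (f := fun i => semi σ (S m 0 (i + 1) - k)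
      * φ (0, a + i * h m))).comp (Nat.measurable_floor.comp (by fun_prop)))
    (fun m x hx => by
      have h1 := hR m 0 (by simp; linarith [hτ0 m])
      have h2 := floor_cell_lt (hh0 m) (hS m).mesh (Ioo_subset_Ico_self hx)
      exact hb2 (h1.nonneg _ (by omega)) (h1.le _ (by omega)) _)
    (by
      filter_upwards [ho, ae_restrict_mem measurableSet_Ioo] with x hx hxm
      have lx : Tendsto (fun m => a + ⌊(x - a) / h m⌋₊ * h m) atTop (𝓝 x) := by
        have := (tendsto_floor_mul (sub_nonneg.2 hxm.1.le) hh0 hh).const_add a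
        rwa [add_sub_cancel] at this
      exact (((continuous_semi σ).tendsto _).comp (hx.sub_const k)).mul
        ((hφ.continuous.tendsto (0, x)).comp (tendsto_const_nhds.prodMk_nhds lx)))
  have l3 : ∀ (j : ℕ → ℕ) (c : ℝ) (u : ℝ → ℝ), (∀ m, j m ≤ N m + 1) →
      (∀ᵐ t ∂(volume.restrict (Ioi 0)), Tendsto (fun m => S m ⌊t / τ m⌋₊ (j m)) atTop (𝓝 (u t))) →
      Tendsto (fun m => ∫ t in Ioo 0 (T + 1), semi σ (S m ⌊t / τ m⌋₊ (j m) - k)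
        * φ (⌊t / τ m⌋₊ * τ m, c)) atTop (𝓝 (∫ t in Ioi (0 : ℝ), semi σ (u t - k) * φ (t, c))) := by
    intro j c u hj hu
    have e : ∫ t in Ioi (0 : ℝ), semi σ (u t - k) * φ (t, c)
        = ∫ t in Ioo 0 (T + 1), semi σ (u t - k) * φ (t, c) := by
      refine setIntegral_eq_of_subset_of_forall_sdiff_eq_zero measurableSet_Ioi Ioo_subset_Ioi_self ?_
      rintro t ⟨ht, ht'⟩
      have : T + 1 ≤ t := not_lt.1 fun hlt => ht' ⟨ht, hlt⟩
      rw [(hφT (t, c) (by simp only; linarith)).1, mul_zero]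
    rw [e]
    refine tendsto_setIntegral_of_bounded (c := (M + |k|) * Λ) measurableSet_Ioo
      measure_Ioo_lt_top.ne (fun m => (measurable_from_nat (f := fun n => semi σ (S m n (j m) - k)
        * φ (n * τ m, c))).comp (Nat.measurable_floor.comp (by fun_prop))) (fun m t ht => ?_) ?_
    · have h1 := (rowBounds_floor (hS m) (hR m) (Ioo_subset_Icc_self ht)).1
      exact hb2 (h1.nonneg _ (hj m)) (h1.le _ (hj m)) _
    · filter_upwards [ae_mono (Measure.restrict_mono Ioo_subset_Ioi_self le_rfl) hu,
        ae_restrict_mem measurableSet_Ioo] with t h1 h2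
      exact (((continuous_semi σ).tendsto _).comp (h1.sub_const k)).mul
        ((hφ.continuous.tendsto (t, c)).comp
          ((tendsto_floor_mul h2.1.le hτ0 hτ).prodMk_nhds tendsto_const_nhds))
  have l4 := (l1.add l2).add (((l3 (fun _ => 0) a ρa (fun m => Nat.zero_le _) ha).add
    (l3 (fun m => N m + 1) b ρb (fun m => le_rfl) hb)).const_mul α)
  have eb : bulk a b (entE σ ρ k) (entF f σ ρ (nonlocalTerm a b ω ρ) k)
      (entG a b f σ ρ (nonlocalTerm a b ω ρ) (nonlocalDeriv a b ω ρ) k) φ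
      = ∫ p in Ioo 0 (T + 1) ×ˢ Ioo a b, (entE σ ρ k p * dTime φ p
        + entF f σ ρ (nonlocalTerm a b ω ρ) k p * dSpace φ p
        - entG a b f σ ρ (nonlocalTerm a b ω ρ) (nonlocalDeriv a b ω ρ) k p * φ p) := by
    refine setIntegral_eq_of_subset_of_forall_sdiff_eq_zero
      (measurableSet_Ioi.prod measurableSet_Ioo) (prod_mono Ioo_subset_Ioi_self le_rfl) ?_
    rintro p ⟨hp, hp'⟩
    have : T + 1 ≤ p.1 := not_lt.1 fun hlt => hp' ⟨⟨hp.1, hlt⟩, hp.2⟩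
    obtain ⟨z1, z2, z3⟩ := hφT p (by linarith)
    rw [z1, z2, z3]; ring
  rw [eb]
  exact ge_of_tendsto' l4 fun m => (hS m).integral_entropy hf hσ k hab hφ0 hT
    (fun p hp => (hφT p hp).1) (hτ1 m)

end Limit


/-! ### Localisation of the entropy functional near a boundary point -/

structure IsTest (φ : ℝ × ℝ → ℝ) : Prop where
  contDiff : ContDiff ℝ 1 φ
  compact : HasCompactSupport φ

/-- Locally bounded measurable coefficients of an entropy functional -/
structure Coeffs (a b : ℝ) (E F G : ℝ × ℝ → ℝ) (I : ℝ → ℝ) : Prop where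
  measE : AEStronglyMeasurable E (volume.restrict (Ioi (0 : ℝ) ×ˢ Ioo a b))
  measF : AEStronglyMeasurable F (volume.restrict (Ioi (0 : ℝ) ×ˢ Ioo a b))
  measG : AEStronglyMeasurable G (volume.restrict (Ioi (0 : ℝ) ×ˢ Ioo a b))
  measI : AEStronglyMeasurable I (volume.restrict (Ioo a b))
  bound : ∀ T, ∃ c, ∀ p ∈ Ioo 0 T ×ˢ Ioo a b, |E p| ≤ c ∧ |F p| ≤ c ∧ |G p| ≤ c
  boundI : ∃ c, ∀ᵐ x ∂(volume.restrict (Ioo a b)), |I x| ≤ c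

/-- The entropy functional without its boundary terms -/
noncomputable def lin (a b : ℝ) (E F G : ℝ × ℝ → ℝ) (I : ℝ → ℝ) (φ : ℝ × ℝ → ℝ) : ℝ :=
  bulk a b E F G φ + ∫ x in Ioo a b, I x * φ (0, x)

/-- A cutoff function that vanishes in `(a, b)` at distance `δ` from `c` -/
structure Cutoff (a b c δ : ℝ) (ζ : ℝ → ℝ) : Prop where
  contDiff : ContDiff ℝ 1 ζ
  nonneg : ∀ x, 0 ≤ ζ x
  le_one : ∀ x, ζ x ≤ 1
  at_center : ζ c = 1
  zero : ∀ x ∈ Icc a b, δ ≤ |x - c| → ζ x = 0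
  variation : ∫ x in Ioo a b, |deriv ζ x| ≤ 1

theorem exists_cutoff_left {a b δ : ℝ} (hab : a < b) (hδ : 0 < δ) (hδb : δ < b - a) :
    ∃ ζ, Cutoff a b a δ ζ := by
  have hc : ContDiff ℝ 1 fun x : ℝ => 1 - Real.smoothTransition ((x - a) / δ) :=
    contDiff_const.sub (Real.smoothTransition.contDiff.comp (by fun_prop))
  have hanti : Antitone fun x : ℝ => 1 - Real.smoothTransition ((x - a) / δ) := fun x y hxy =>
    sub_le_sub_left (Real.smoothTransition.monotone
      (div_le_div_of_nonneg_right (by linarith) hδ.le)) _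
  refine ⟨fun x => 1 - Real.smoothTransition ((x - a) / δ), hc,
    fun x => sub_nonneg.2 (Real.smoothTransition.le_one _),
    fun x => by linarith [Real.smoothTransition.nonneg ((x - a) / δ)], by simp,
    fun x hx hxδ => ?_, ?_⟩
  · rw [abs_of_nonneg (by linarith [hx.1])] at hxδ
    rw [Real.smoothTransition.one_of_one_le ((one_le_div hδ).2 hxδ), sub_self]
  · have e : ∀ x, |deriv (fun x : ℝ => 1 - Real.smoothTransition ((x - a) / δ)) x|
        = -deriv (fun x : ℝ => 1 - Real.smoothTransition ((x - a) / δ)) x := fun x =>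
      abs_of_nonpos hanti.deriv_nonpos
    simp only [e]
    rw [integral_neg, ← integral_Ioc_eq_integral_Ioo, ← intervalIntegral.integral_of_le hab.le,
      intervalIntegral.integral_deriv_eq_sub (fun x _ => (hc.differentiable one_ne_zero) x)
        ((hc.continuous_deriv le_rfl).intervalIntegrable _ _)]
    rw [Real.smoothTransition.one_of_one_le ((one_le_div hδ).2 hδb.le)]
    simp

theorem exists_cutoff_right {a b δ : ℝ} (hab : a < b) (hδ : 0 < δ) (hδb : δ < b - a) :
    ∃ ζ, Cutoff a b b δ ζ := by
  have hc : ContDiff ℝ 1 fun x : ℝ => 1 - Real.smoothTransition ((b - x) / δ) :=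
    contDiff_const.sub (Real.smoothTransition.contDiff.comp (by fun_prop))
  have hmono : Monotone fun x : ℝ => 1 - Real.smoothTransition ((b - x) / δ) := fun x y hxy =>
    sub_le_sub_left (Real.smoothTransition.monotone
      (div_le_div_of_nonneg_right (by linarith) hδ.le)) _
  refine ⟨fun x => 1 - Real.smoothTransition ((b - x) / δ), hc,
    fun x => sub_nonneg.2 (Real.smoothTransition.le_one _),
    fun x => by linarith [Real.smoothTransition.nonneg ((b - x) / δ)], by simp,
    fun x hx hxδ => ?_, ?_⟩
  · rw [abs_of_nonpos (by linarith [hx.2])] at hxδ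
    rw [Real.smoothTransition.one_of_one_le ((one_le_div hδ).2 (by linarith)), sub_self]
  · have e : ∀ x, |deriv (fun x : ℝ => 1 - Real.smoothTransition ((b - x) / δ)) x|
        = deriv (fun x : ℝ => 1 - Real.smoothTransition ((b - x) / δ)) x := fun x =>
      abs_of_nonneg hmono.deriv_nonneg
    simp only [e]
    rw [← integral_Ioc_eq_integral_Ioo, ← intervalIntegral.integral_of_le hab.le,
      intervalIntegral.integral_deriv_eq_sub (fun x _ => (hc.differentiable one_ne_zero) x)
        ((hc.continuous_deriv le_rfl).intervalIntegrable _ _)]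
    rw [Real.smoothTransition.one_of_one_le ((one_le_div hδ).2 hδb.le)]
    simp

theorem Cutoff.deriv_eq_zero {a b c δ : ℝ} {ζ : ℝ → ℝ} (h : Cutoff a b c δ ζ) {x : ℝ}
    (hx : ζ x = 0) : deriv ζ x = 0 :=
  IsLocalMin.deriv_eq_zero (Eventually.of_forall fun y => by rw [hx]; exact h.nonneg y)

section Products
variable {φ : ℝ × ℝ → ℝ} {ζ : ℝ → ℝ}

theorem IsTest.mul_space (hφ : IsTest φ) (hζ : ContDiff ℝ 1 ζ) :
    IsTest fun p => φ p * ζ p.2 :=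
  ⟨hφ.contDiff.mul (hζ.comp contDiff_snd), hφ.compact.mul_right⟩

theorem IsTest.mul_time (hφ : IsTest φ) (hζ : ContDiff ℝ 1 ζ) :
    IsTest fun p => φ p * ζ p.1 :=
  ⟨hφ.contDiff.mul (hζ.comp contDiff_fst), hφ.compact.mul_right⟩

theorem dTime_mul_space (hφ : IsTest φ) (p : ℝ × ℝ) :
    dTime (fun p => φ p * ζ p.2) p = dTime φ p * ζ p.2 :=
  ((hasDerivAt_dTime hφ.contDiff p).mul_const (ζ p.2)).deriv

theorem dSpace_mul_space (hφ : IsTest φ) (hζ : ContDiff ℝ 1 ζ) (p : ℝ × ℝ) :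
    dSpace (fun p => φ p * ζ p.2) p = dSpace φ p * ζ p.2 + φ p * deriv ζ p.2 :=
  ((hasDerivAt_dSpace hφ.contDiff p).mul
    ((hζ.differentiable one_ne_zero) p.2).hasDerivAt).deriv

theorem IsTest.add {ψ : ℝ × ℝ → ℝ} (hφ : IsTest φ) (hψ : IsTest ψ) : IsTest (φ + ψ) :=
  ⟨hφ.contDiff.add hψ.contDiff, hφ.compact.add hψ.compact⟩

theorem isTest_zero : IsTest 0 := ⟨contDiff_const, HasCompactSupport.zero⟩

theorem IsTest.sum {ι : Type*} (s : Finset ι) {ψ : ι → ℝ × ℝ → ℝ} (h : ∀ i ∈ s, IsTest (ψ i)) :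
    IsTest (∑ i ∈ s, ψ i) := by
  classical
  induction s using Finset.induction_on with
  | empty => simpa using isTest_zero
  | insert i s hi ih =>
    rw [Finset.sum_insert hi]
    exact (h i (Finset.mem_insert_self _ _)).add (ih fun j hj => h j (Finset.mem_insert_of_mem hj))

theorem abs_space_sub_le (hφ : ContDiff ℝ 1 φ) {Λ : ℝ} (hΛ : ∀ p, |dSpace φ p| ≤ Λ) (t x x' : ℝ) :
    |φ (t, x) - φ (t, x')| ≤ Λ * |x - x'| := by
  have := convex_univ.norm_image_sub_le_of_norm_hasDerivWithin_le (f := fun y => φ (t, y))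
    (f' := fun y => dSpace φ (t, y)) (C := Λ) (x := x') (y := x)
    (fun s _ => (hasDerivAt_dSpace hφ (t, s)).hasDerivWithinAt) (fun s _ => hΛ _) trivial trivial
  simpa using this

end Products

section Coeffs
variable {a b : ℝ} {E F G E' F' G' : ℝ × ℝ → ℝ} {I I' : ℝ → ℝ} {φ ψ : ℝ × ℝ → ℝ}

theorem Coeffs.integrableOn (hc : Coeffs a b E F G I) (hφ : IsTest φ) :
    IntegrableOn (fun p => E p * dTime φ p + F p * dSpace φ p - G p * φ p)
      (Ioi (0 : ℝ) ×ˢ Ioo a b) := by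
  obtain ⟨T, hT, Λ, hΛ0, hz, hΛ⟩ := exists_test_bound hφ.contDiff hφ.compact
  obtain ⟨c, hcb⟩ := hc.bound T
  have hmeas : AEStronglyMeasurable (fun p => E p * dTime φ p + F p * dSpace φ p - G p * φ p)
      (volume.restrict (Ioi (0 : ℝ) ×ˢ Ioo a b)) :=
    ((hc.measE.mul (continuous_dTime hφ.contDiff).aestronglyMeasurable).add
      (hc.measF.mul (continuous_dSpace hφ.contDiff).aestronglyMeasurable)).sub
      (hc.measG.mul hφ.contDiff.continuous.aestronglyMeasurable)
  have hsub : Ioo 0 T ×ˢ Ioo a b ⊆ Ioi (0 : ℝ) ×ˢ Ioo a b := prod_mono Ioo_subset_Ioi_self le_rfl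
  have hfin : volume (Ioo 0 T ×ˢ Ioo a b) ≠ ⊤ := by
    rw [Measure.volume_eq_prod, Measure.prod_prod]
    exact (ENNReal.mul_lt_top measure_Ioo_lt_top measure_Ioo_lt_top).ne
  have h1 : IntegrableOn (fun p => E p * dTime φ p + F p * dSpace φ p - G p * φ p)
      (Ioo 0 T ×ˢ Ioo a b) := by
    have : IsFiniteMeasure (volume.restrict (Ioo 0 T ×ˢ Ioo a b)) :=
      ⟨by rw [Measure.restrict_apply_univ]; exact hfin.lt_top⟩
    refine Integrable.of_bound (C := c * Λ + c * Λ + c * Λ)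
      (hmeas.mono_measure (Measure.restrict_mono hsub le_rfl)) ?_
    filter_upwards [ae_restrict_mem (measurableSet_Ioo.prod measurableSet_Ioo)] with p hp
    obtain ⟨e1, e2, e3⟩ := hcb p hp
    obtain ⟨d1, d2, d3⟩ := hΛ p
    have hc0 : 0 ≤ c := (abs_nonneg _).trans e1
    rw [Real.norm_eq_abs]
    refine (abs_sub _ _).trans ((add_le_add_left (abs_add_le _ _) _).trans ?_)
    rw [abs_mul, abs_mul, abs_mul]
    have m1 := mul_le_mul e1 d2 (abs_nonneg _) hc0
    have m2 := mul_le_mul e2 d3 (abs_nonneg _) hc0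
    have m3 := mul_le_mul e3 d1 (abs_nonneg _) hc0
    linarith
  refine h1.of_forall_sdiff_eq_zero (measurableSet_Ioi.prod measurableSet_Ioo) ?_
  rintro p ⟨hp, hp'⟩
  obtain ⟨z1, z2, z3⟩ := hz p (not_lt.1 fun hlt => hp' ⟨⟨hp.1, hlt⟩, hp.2⟩)
  rw [z1, z2, z3]; ring

theorem Coeffs.integrableOn_init (hc : Coeffs a b E F G I) (hφ : IsTest φ) :
    IntegrableOn (fun x => I x * φ (0, x)) (Ioo a b) := by
  obtain ⟨T, hT, Λ, hΛ0, hz, hΛ⟩ := exists_test_bound hφ.contDiff hφ.compact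
  obtain ⟨c, hcI⟩ := hc.boundI
  have h0 : Continuous fun x : ℝ => φ (0, x) := hφ.contDiff.continuous.comp (by fun_prop)
  refine Integrable.of_bound (C := c * Λ) (hc.measI.mul h0.aestronglyMeasurable) ?_
  filter_upwards [hcI] with x hx
  rw [norm_mul]
  exact mul_le_mul hx (hΛ _).1 (abs_nonneg _) ((abs_nonneg _).trans hx)

theorem Coeffs.lin_add (hc : Coeffs a b E F G I) (hφ : IsTest φ) (hψ : IsTest ψ) :
    lin a b E F G I (φ + ψ) = lin a b E F G I φ + lin a b E F G I ψ := by
  have e1 : ∀ p, dTime (φ + ψ) p = dTime φ p + dTime ψ p := fun p =>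
    ((hasDerivAt_dTime hφ.contDiff p).add (hasDerivAt_dTime hψ.contDiff p)).deriv
  have e2 : ∀ p, dSpace (φ + ψ) p = dSpace φ p + dSpace ψ p := fun p =>
    ((hasDerivAt_dSpace hφ.contDiff p).add (hasDerivAt_dSpace hψ.contDiff p)).deriv
  unfold lin bulk
  have h1 := integral_add (hc.integrableOn hφ) (hc.integrableOn hψ)
  have h2 := integral_add (hc.integrableOn_init hφ) (hc.integrableOn_init hψ)
  rw [add_add_add_comm, ← h1, ← h2]
  congr 1
  · exact integral_congr_ae (Eventually.of_forall fun p => by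
      simp only [e1, e2, Pi.add_apply]; ring)
  · exact integral_congr_ae (Eventually.of_forall fun p => by
      simp only [Pi.add_apply]; ring)

theorem lin_zero : lin a b E F G I 0 = 0 := by
  simp [lin, bulk, dTime, dSpace]

theorem Coeffs.lin_sum (hc : Coeffs a b E F G I) {ι : Type*} (s : Finset ι) {ψ : ι → ℝ × ℝ → ℝ}
    (h : ∀ i ∈ s, IsTest (ψ i)) :
    lin a b E F G I (∑ i ∈ s, ψ i) = ∑ i ∈ s, lin a b E F G I (ψ i) := by
  classical
  induction s using Finset.induction_on with
  | empty => simpa using lin_zero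
  | insert i s hi ih =>
    have hs : ∀ j ∈ s, IsTest (ψ j) := fun j hj => h j (Finset.mem_insert_of_mem hj)
    rw [Finset.sum_insert hi, Finset.sum_insert hi,
      hc.lin_add (h i (Finset.mem_insert_self _ _)) (IsTest.sum s hs), ih hs]

theorem Coeffs.sub (hc : Coeffs a b E F G I) (hc' : Coeffs a b E' F' G' I') :
    Coeffs a b (E - E') (F - F') (G - G') (I - I') := by
  refine ⟨hc.measE.sub hc'.measE, hc.measF.sub hc'.measF, hc.measG.sub hc'.measG,
    hc.measI.sub hc'.measI, fun T => ?_, ?_⟩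
  · obtain ⟨c, h⟩ := hc.bound T
    obtain ⟨c', h'⟩ := hc'.bound T
    refine ⟨c + c', fun p hp => ?_⟩
    obtain ⟨h1, h2, h3⟩ := h p hp
    obtain ⟨h1', h2', h3'⟩ := h' p hp
    exact ⟨(abs_sub _ _).trans (add_le_add h1 h1'), (abs_sub _ _).trans (add_le_add h2 h2'),
      (abs_sub _ _).trans (add_le_add h3 h3')⟩
  · obtain ⟨c, h⟩ := hc.boundI
    obtain ⟨c', h'⟩ := hc'.boundI
    refine ⟨c + c', ?_⟩
    filter_upwards [h, h'] with x h1 h1'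
    exact (abs_sub _ _).trans (add_le_add h1 h1')

theorem Coeffs.lin_sub (hc : Coeffs a b E F G I) (hc' : Coeffs a b E' F' G' I') (hφ : IsTest φ) :
    lin a b (E - E') (F - F') (G - G') (I - I') φ
      = lin a b E F G I φ - lin a b E' F' G' I' φ := by
  unfold lin bulk
  have h1 := integral_sub (hc.integrableOn hφ) (hc'.integrableOn hφ)
  have h2 := integral_sub (hc.integrableOn_init hφ) (hc'.integrableOn_init hφ)
  rw [add_sub_add_comm, ← h1, ← h2]
  congr 1
  · exact integral_congr_ae (Eventually.of_forall fun p => by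
      simp only [Pi.sub_apply]; ring)
  · exact integral_congr_ae (Eventually.of_forall fun p => by
      simp only [Pi.sub_apply]; ring)

theorem integral_ball_indicator_le (c : ℝ) {δ : ℝ} (hδ : 0 < δ) :
    IntegrableOn ((Metric.ball c δ).indicator fun _ => (1 : ℝ)) (Ioo a b) ∧
    ∫ x in Ioo a b, (Metric.ball c δ).indicator (fun _ => (1 : ℝ)) x ≤ 2 * δ := by
  refine ⟨(integrableOn_const measure_Ioo_lt_top.ne).indicator Metric.isOpen_ball.measurableSet, ?_⟩
  rw [integral_indicator Metric.isOpen_ball.measurableSet, setIntegral_const, smul_eq_mul, mul_one,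
    measureReal_restrict_apply Metric.isOpen_ball.measurableSet]
  refine (measureReal_mono inter_subset_left
    (by rw [Real.volume_ball]; exact ENNReal.ofReal_ne_top)).trans (le_of_eq ?_)
  rw [Measure.real, Real.volume_ball, ENNReal.toReal_ofReal (by positivity)]

theorem Coeffs.abs_lin_mul_cutoff_le (hc : Coeffs a b E F G I) {m : ℝ}
    (hm0 : 0 ≤ m) (hm : ∀ p ∈ Ioi (0 : ℝ) ×ˢ Ioo a b, |F p| ≤ m) (hψ : IsTest ψ)
    (hψ0 : ∀ p, 0 ≤ ψ p) (c : ℝ) : ∃ K, ∀ δ > 0, ∀ ζ, Cutoff a b c δ ζ →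
      |lin a b E F G I fun p => ψ p * ζ p.2| ≤ K * δ + m * ∫ t in Ioi (0 : ℝ), ψ (t, c) := by
  obtain ⟨T, hT, Λ, hΛ0, hz, hΛ⟩ := exists_test_bound hψ.contDiff hψ.compact
  obtain ⟨c₀', hcb'⟩ := hc.bound T
  obtain ⟨c₁', hcI'⟩ := hc.boundI
  set c₀ := max c₀' 0
  set c₁ := max c₁' 0
  have hc₀ : 0 ≤ c₀ := le_max_right _ _
  have hc₁ : 0 ≤ c₁ := le_max_right _ _
  refine ⟨3 * c₀ * Λ * T * 2 + m * Λ * T + c₁ * Λ * 2, fun δ hδ ζ hζ => ?_⟩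
  have hζd : Continuous (deriv ζ) := hζ.contDiff.continuous_deriv le_rfl
  have hζi : IntegrableOn (fun x => |deriv ζ x|) (Ioo a b) :=
    (hζd.abs.integrableOn_Icc (a := a) (b := b)).mono_set Ioo_subset_Icc_self
  have hψc : Continuous fun t => ψ (t, c) := hψ.contDiff.continuous.comp (by fun_prop)
  have hψi : IntegrableOn (fun t => ψ (t, c)) (Ioo 0 T) :=
    (hψc.integrableOn_Icc (a := 0) (b := T)).mono_set Ioo_subset_Icc_self
  have h1i : IntegrableOn (fun _ : ℝ => (1 : ℝ)) (Ioo 0 T) :=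
    integrableOn_const measure_Ioo_lt_top.ne
  obtain ⟨hJi, hJ⟩ := integral_ball_indicator_le (a := a) (b := b) c hδ
  set J := (Metric.ball c δ).indicator fun _ => (1 : ℝ) with hJdef
  have pi : ∀ {u v : ℝ → ℝ}, IntegrableOn u (Ioo 0 T) → IntegrableOn v (Ioo a b) →
      IntegrableOn (fun p : ℝ × ℝ => u p.1 * v p.2) (Ioo 0 T ×ˢ Ioo a b) := fun hu hv => by
    have := Integrable.mul_prod hu hv
    rwa [Measure.prod_restrict, ← Measure.volume_eq_prod] at this
  have pe : ∀ u v : ℝ → ℝ, ∫ p in Ioo 0 T ×ˢ Ioo a b, u p.1 * v p.2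
      = (∫ t in Ioo 0 T, u t) * ∫ x in Ioo a b, v x := fun u v => by
    rw [Measure.volume_eq_prod]; exact setIntegral_prod_mul u v _ _
  have g1 := (pi h1i hJi).const_mul (3 * c₀ * Λ)
  have g2 := (pi hψi hζi).const_mul m
  have g3 := (pi h1i hζi).const_mul (m * Λ * δ)
  have hbulk : |bulk a b E F G fun p => ψ p * ζ p.2|
      ≤ 3 * c₀ * Λ * (T * (2 * δ)) + m * (∫ t in Ioi (0 : ℝ), ψ (t, c)) + m * Λ * δ * T := by
    have e : bulk a b E F G (fun p => ψ p * ζ p.2) = ∫ p in Ioo 0 T ×ˢ Ioo a b,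
        (E p * dTime (fun p => ψ p * ζ p.2) p + F p * dSpace (fun p => ψ p * ζ p.2) p
          - G p * (ψ p * ζ p.2)) := by
      refine setIntegral_eq_of_subset_of_forall_sdiff_eq_zero
        (measurableSet_Ioi.prod measurableSet_Ioo) (prod_mono Ioo_subset_Ioi_self le_rfl) ?_
      rintro p ⟨hp, hp'⟩
      obtain ⟨z1, z2, z3⟩ := hz p (not_lt.1 fun hlt => hp' ⟨⟨hp.1, hlt⟩, hp.2⟩)
      rw [dTime_mul_space hψ, dSpace_mul_space hψ hζ.contDiff]
      simp only [z1, z2, z3]; ring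
    have hle : ∀ᵐ p ∂(volume.restrict (Ioo 0 T ×ˢ Ioo a b)),
        ‖E p * dTime (fun p => ψ p * ζ p.2) p + F p * dSpace (fun p => ψ p * ζ p.2) p
          - G p * (ψ p * ζ p.2)‖ ≤ 3 * c₀ * Λ * ((fun _ => (1 : ℝ)) p.1 * J p.2)
            + m * ((fun t => ψ (t, c)) p.1 * |deriv ζ p.2|)
            + m * Λ * δ * ((fun _ => (1 : ℝ)) p.1 * |deriv ζ p.2|) := by
      filter_upwards [ae_restrict_mem (measurableSet_Ioo.prod measurableSet_Ioo)] with p hp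
      rw [dTime_mul_space hψ, dSpace_mul_space hψ hζ.contDiff, Real.norm_eq_abs]
      by_cases hδx : δ ≤ |p.2 - c|
      · have z := hζ.zero p.2 (Ioo_subset_Icc_self hp.2) hδx
        rw [z, hζ.deriv_eq_zero z]
        simp only [mul_zero, add_zero, sub_zero, abs_zero, one_mul]
        have : 0 ≤ J p.2 := indicator_nonneg (fun _ _ => zero_le_one) _
        positivity
      · have hx : |p.2 - c| < δ := not_le.1 hδx
        have hJ1 : J p.2 = 1 := indicator_of_mem (by
          rw [Metric.mem_ball, Real.dist_eq]; exact hx) _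
        obtain ⟨e1', e2', e3'⟩ := hcb' p hp
        have e1 : |E p| ≤ c₀ := e1'.trans (le_max_left _ _)
        have e2 : |F p| ≤ c₀ := e2'.trans (le_max_left _ _)
        have e3 : |G p| ≤ c₀ := e3'.trans (le_max_left _ _)
        obtain ⟨d1, d2, d3⟩ := hΛ p
        have hF := hm p ⟨hp.1.1, hp.2⟩
        have hζ1 : |ζ p.2| ≤ 1 := by rw [abs_of_nonneg (hζ.nonneg _)]; exact hζ.le_one _
        have hψ1 : |ψ p| ≤ ψ (p.1, c) + Λ * δ := by
          have := abs_space_sub_le hψ.contDiff (fun p => (hΛ p).2.2) p.1 p.2 c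
          rw [abs_of_nonneg (hψ0 p)]
          have h2 := le_abs_self (ψ (p.1, p.2) - ψ (p.1, c))
          have h3 := mul_le_mul_of_nonneg_left hx.le hΛ0
          have h4 : ψ (p.1, p.2) = ψ p := rfl
          linarith
        have m1 : |E p * (dTime ψ p * ζ p.2)| ≤ c₀ * (Λ * 1) := by
          rw [abs_mul, abs_mul]
          exact mul_le_mul e1 (mul_le_mul d2 hζ1 (abs_nonneg _) hΛ0) (by positivity) hc₀
        have m2 : |F p * (dSpace ψ p * ζ p.2)| ≤ c₀ * (Λ * 1) := by
          rw [abs_mul, abs_mul]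
          exact mul_le_mul e2 (mul_le_mul d3 hζ1 (abs_nonneg _) hΛ0) (by positivity) hc₀
        have m3 : |F p * (ψ p * deriv ζ p.2)| ≤ m * ((ψ (p.1, c) + Λ * δ) * |deriv ζ p.2|) := by
          rw [abs_mul, abs_mul]
          exact mul_le_mul hF (mul_le_mul_of_nonneg_right hψ1 (abs_nonneg _)) (by positivity) hm0
        have m4 : |G p * (ψ p * ζ p.2)| ≤ c₀ * (Λ * 1) := by
          rw [abs_mul, abs_mul]
          exact mul_le_mul e3 (mul_le_mul d1 hζ1 (abs_nonneg _) hΛ0) (by positivity) hc₀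
        rw [hJ1, mul_add (F p)]
        refine (abs_sub _ _).trans ((add_le_add_left ((abs_add_le _ _).trans
          (add_le_add_right (abs_add_le _ _) _)) _).trans ?_)
        linarith
    rw [e, ← Real.norm_eq_abs]
    have key := norm_integral_le_of_norm_le ((g1.add g2).add g3) hle
    have s1 := integral_add (g1.add g2) g3
    have s2 := integral_add g1 g2
    refine key.trans ?_
    refine (s1.trans (congrArg₂ (· + ·) s2 rfl)).le.trans ?_
    have q1 : ∫ p in Ioo 0 T ×ˢ Ioo a b, 3 * c₀ * Λ * ((fun _ => (1 : ℝ)) p.1 * J p.2)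
        = 3 * c₀ * Λ * ((∫ _ in Ioo 0 T, (1 : ℝ)) * ∫ x in Ioo a b, J x) := by
      rw [integral_const_mul]; exact congrArg (3 * c₀ * Λ * ·) (pe (fun _ => 1) J)
    have q2 : ∫ p in Ioo 0 T ×ˢ Ioo a b, m * ((fun t => ψ (t, c)) p.1 * |deriv ζ p.2|)
        = m * ((∫ t in Ioo 0 T, ψ (t, c)) * ∫ x in Ioo a b, |deriv ζ x|) := by
      rw [integral_const_mul]; exact congrArg (m * ·) (pe (fun t => ψ (t, c)) fun x => |deriv ζ x|)
    have q3 : ∫ p in Ioo 0 T ×ˢ Ioo a b, m * Λ * δ * ((fun _ => (1 : ℝ)) p.1 * |deriv ζ p.2|)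
        = m * Λ * δ * ((∫ _ in Ioo 0 T, (1 : ℝ)) * ∫ x in Ioo a b, |deriv ζ x|) := by
      rw [integral_const_mul]; exact congrArg (m * Λ * δ * ·) (pe (fun _ => 1) fun x => |deriv ζ x|)
    refine (congrArg₂ (· + ·) (congrArg₂ (· + ·) q1 q2) q3).le.trans ?_
    have i1 : ∫ _ in Ioo 0 T, (1 : ℝ) = T := by
      rw [setIntegral_const, Real.volume_real_Ioo_of_le hT.le]; simp
    have i2 : ∫ t in Ioo 0 T, ψ (t, c) = ∫ t in Ioi (0 : ℝ), ψ (t, c) := by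
      symm
      refine setIntegral_eq_of_subset_of_forall_sdiff_eq_zero measurableSet_Ioi
        Ioo_subset_Ioi_self ?_
      rintro t ⟨ht, ht'⟩
      exact (hz (t, c) (not_lt.1 fun hlt => ht' ⟨ht, hlt⟩)).1
    have i3 : 0 ≤ ∫ t in Ioi (0 : ℝ), ψ (t, c) := integral_nonneg fun t => hψ0 _
    rw [i1, i2]
    have k1 := mul_le_mul_of_nonneg_left (mul_le_mul_of_nonneg_left hJ hT.le)
      (show 0 ≤ 3 * c₀ * Λ by positivity)
    have k2 := mul_le_mul_of_nonneg_left (mul_le_mul_of_nonneg_left hζ.variation i3) hm0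
    have k3 := mul_le_mul_of_nonneg_left (mul_le_mul_of_nonneg_left hζ.variation hT.le)
      (show 0 ≤ m * Λ * δ by positivity)
    linarith
  have hinit : |∫ x in Ioo a b, I x * (ψ (0, x) * ζ x)| ≤ c₁ * Λ * (2 * δ) := by
    rw [← Real.norm_eq_abs]
    refine (norm_integral_le_of_norm_le (hJi.const_mul (c₁ * Λ)) ?_).trans ?_
    · filter_upwards [hcI', ae_restrict_mem measurableSet_Ioo] with x hx hxm
      rw [Real.norm_eq_abs]
      by_cases hδx : δ ≤ |x - c|
      · rw [hζ.zero x (Ioo_subset_Icc_self hxm) hδx]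
        have : 0 ≤ J x := indicator_nonneg (fun _ _ => zero_le_one) _
        simp only [mul_zero, abs_zero]
        positivity
      · have hJ1 : J x = 1 := indicator_of_mem (by
          rw [Metric.mem_ball, Real.dist_eq]; exact not_le.1 hδx) _
        have hζ1 : |ζ x| ≤ 1 := by rw [abs_of_nonneg (hζ.nonneg _)]; exact hζ.le_one _
        rw [hJ1, abs_mul, abs_mul, mul_assoc]
        exact mul_le_mul (hx.trans (le_max_left _ _))
          (mul_le_mul (hΛ _).1 hζ1 (abs_nonneg _) hΛ0) (by positivity) hc₁
    · rw [integral_const_mul]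
      exact mul_le_mul_of_nonneg_left hJ (by positivity)
  refine (abs_add_le _ _).trans ((add_le_add hbulk hinit).trans (le_of_eq ?_))
  ring

end Coeffs


/-! ### The sharp constant in the boundary terms -/

/-- A decreasing family of smooth steps, with `timeStep ε i` supported in `t ≥ (i - 1) ε` -/
noncomputable def timeStep (ε : ℝ) (i : ℕ) (t : ℝ) : ℝ :=
  if i = 0 then 1 else Real.smoothTransition (t / ε - i + 1)

/-- A smooth bump near `t = i ε` -/
noncomputable def timeBump (ε : ℝ) (i : ℕ) (t : ℝ) : ℝ := timeStep ε i t - timeStep ε (i + 1) t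

theorem contDiff_timeStep (ε : ℝ) (i : ℕ) : ContDiff ℝ 1 (timeStep ε i) := by
  unfold timeStep
  split_ifs
  · exact contDiff_const
  · exact Real.smoothTransition.contDiff.comp (by fun_prop)

theorem contDiff_timeBump (ε : ℝ) (i : ℕ) : ContDiff ℝ 1 (timeBump ε i) :=
  (contDiff_timeStep ε i).sub (contDiff_timeStep ε (i + 1))

theorem timeStep_nonneg (ε : ℝ) (i : ℕ) (t : ℝ) : 0 ≤ timeStep ε i t := by
  unfold timeStep
  split_ifs
  · exact zero_le_one
  · exact Real.smoothTransition.nonneg _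

theorem timeStep_le_one (ε : ℝ) (i : ℕ) (t : ℝ) : timeStep ε i t ≤ 1 := by
  unfold timeStep
  split_ifs
  · exact le_rfl
  · exact Real.smoothTransition.le_one _

theorem timeBump_nonneg (ε : ℝ) (i : ℕ) (t : ℝ) : 0 ≤ timeBump ε i t := by
  refine sub_nonneg.2 ?_
  by_cases hi : i = 0
  · rw [show timeStep ε i t = 1 by simp [timeStep, hi]]; exact timeStep_le_one _ _ _
  · simp only [timeStep, hi, Nat.succ_ne_zero, if_false]
    refine Real.smoothTransition.monotone ?_
    push_cast; linarith

theorem timeStep_eq_zero {ε t : ℝ} (hε : 0 < ε) {i : ℕ} (hi : i ≠ 0) (ht : t ≤ (i - 1) * ε) :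
    timeStep ε i t = 0 := by
  simp only [timeStep, hi, if_false]
  refine Real.smoothTransition.zero_of_nonpos ?_
  have := (div_le_iff₀ hε).2 ht
  linarith

theorem abs_sub_le_of_timeBump_ne_zero {ε t : ℝ} (hε : 0 < ε) (ht : 0 < t) {i : ℕ}
    (h : timeBump ε i t ≠ 0) : |(i + 1) * ε - t| ≤ 2 * ε := by
  have h0 := timeBump_nonneg ε i t
  have h1 : t ≤ (i + 1) * ε := by
    by_contra! hlt
    refine h (le_antisymm ?_ h0)
    have : timeStep ε (i + 1) t = 1 := by
      simp only [timeStep, Nat.succ_ne_zero, if_false]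
      refine Real.smoothTransition.one_of_one_le ?_
      have := (le_div_iff₀ hε).2 hlt.le
      push_cast; linarith
    have h2 := timeStep_le_one ε i t
    unfold timeBump; linarith
  have h2 : (i - 1) * ε ≤ t := by
    by_contra! hlt
    by_cases hi : i = 0
    · rw [hi] at hlt; simp at hlt; linarith
    · refine h (le_antisymm ?_ h0)
      have h3 := timeStep_nonneg ε (i + 1) t
      have h4 := timeStep_eq_zero hε hi hlt.le
      unfold timeBump; linarith
  rw [abs_le]; constructor <;> nlinarith

theorem sum_timeBump (ε : ℝ) (n : ℕ) (t : ℝ) :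
    ∑ i ∈ Finset.range n, timeBump ε i t = 1 - timeStep ε n t := by
  unfold timeBump
  rw [Finset.sum_range_sub']
  simp [timeStep]

section Side
variable {a b c c' α β M σ : ℝ} {E F G : ℝ → ℝ × ℝ → ℝ} {I : ℝ → ℝ → ℝ} {u u' : ℝ → ℝ}
  (hab : a < b) (hc : ∀ k, Coeffs a b (E k) (F k) (G k) (I k)) (hM : 0 ≤ M)
  (hlip : ∀ k k', ∀ p ∈ Ioi (0 : ℝ) ×ˢ Ioo a b, |F k p - F k' p| ≤ M * |k - k'|)
  (hcut : ∀ δ > 0, δ < b - a → ∃ ζ, Cutoff a b c δ ζ) (hc' : c' ∈ Icc a b)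
  (hcc' : b - a ≤ |c' - c|)
  (h : ∀ k, ∀ φ, IsTest φ → (∀ p, 0 ≤ φ p) → 0 ≤ lin a b (E k) (F k) (G k) (I k) φ
    + α * (∫ t in Ioi (0 : ℝ), semi σ (u t - k) * φ (t, c))
    + β * ∫ t in Ioi (0 : ℝ), semi σ (u' t - k) * φ (t, c'))
include hab hc hM hlip hcut hc' hcc' h

theorem boundary_inequality_of_sum {k : ℝ} {ι : Type*} (s : Finset ι) {κ : ι → ℝ}
    {ψ : ι → ℝ × ℝ → ℝ} (hψ : ∀ i ∈ s, IsTest (ψ i)) (hψ0 : ∀ i ∈ s, ∀ p, 0 ≤ ψ i p)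
    {φ : ℝ × ℝ → ℝ} (hφ : IsTest φ) (hφ0 : ∀ p, 0 ≤ φ p) (hsum : ∑ i ∈ s, ψ i = φ) :
    0 ≤ lin a b (E k) (F k) (G k) (I k) φ
      + β * (∫ t in Ioi (0 : ℝ), semi σ (u' t - k) * φ (t, c'))
      + ∑ i ∈ s, (α * (∫ t in Ioi (0 : ℝ), semi σ (u t - κ i) * ψ i (t, c))
        + M * |k - κ i| * ∫ t in Ioi (0 : ℝ), ψ i (t, c)) := by
  have hK : ∀ i, ∃ K, i ∈ s → ∀ δ > 0, ∀ ζ, Cutoff a b c δ ζ →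
      |lin a b (E k - E (κ i)) (F k - F (κ i)) (G k - G (κ i)) (I k - I (κ i))
        fun p => ψ i p * ζ p.2| ≤ K * δ + M * |k - κ i| * ∫ t in Ioi (0 : ℝ), ψ i (t, c) := by
    intro i
    by_cases hi : i ∈ s
    · obtain ⟨K, hK⟩ := ((hc k).sub (hc (κ i))).abs_lin_mul_cutoff_le (m := M * |k - κ i|)
        (mul_nonneg hM (abs_nonneg _)) (fun p hp => hlip k (κ i) p hp) (hψ i hi) (hψ0 i hi) c
      exact ⟨K, fun _ => hK⟩
    · exact ⟨0, fun hi' => absurd hi' hi⟩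
  choose K hK using hK
  set X := lin a b (E k) (F k) (G k) (I k) φ
      + β * (∫ t in Ioi (0 : ℝ), semi σ (u' t - k) * φ (t, c'))
      + ∑ i ∈ s, (α * (∫ t in Ioi (0 : ℝ), semi σ (u t - κ i) * ψ i (t, c))
        + M * |k - κ i| * ∫ t in Ioi (0 : ℝ), ψ i (t, c)) with hX
  have key : ∀ δ > 0, δ < b - a → 0 ≤ X + (∑ i ∈ s, K i) * δ := by
    intro δ hδ hδb
    obtain ⟨ζ, hζ⟩ := hcut δ hδ hδb
    have hζc' : ζ c' = 0 := hζ.zero c' hc' (hδb.le.trans hcc')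
    have t1 : IsTest fun p => φ p * (1 - ζ p.2) := hφ.mul_space (contDiff_const.sub hζ.contDiff)
    have t2 : ∀ i ∈ s, IsTest fun p => ψ i p * ζ p.2 := fun i hi => (hψ i hi).mul_space hζ.contDiff
    have e : φ = (fun p => φ p * (1 - ζ p.2)) + ∑ i ∈ s, fun p : ℝ × ℝ => ψ i p * ζ p.2 := by
      ext p
      have : φ p = ∑ i ∈ s, ψ i p := by rw [← hsum, Finset.sum_apply]
      rw [Pi.add_apply, Finset.sum_apply, ← Finset.sum_mul, ← this]
      ring
    have e1 : lin a b (E k) (F k) (G k) (I k) φ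
        = lin a b (E k) (F k) (G k) (I k) (fun p => φ p * (1 - ζ p.2))
          + ∑ i ∈ s, lin a b (E k) (F k) (G k) (I k) (fun p => ψ i p * ζ p.2) := by
      conv_lhs => rw [e]
      rw [(hc k).lin_add t1 (IsTest.sum s t2), (hc k).lin_sum s t2]
    have h1 := h k _ t1 fun p => mul_nonneg (hφ0 p) (sub_nonneg.2 (hζ.le_one _))
    simp only [hζ.at_center, hζc', sub_self, mul_zero, integral_zero, sub_zero, mul_one,
      add_zero] at h1
    have h2 : ∀ i ∈ s, -(α * (∫ t in Ioi (0 : ℝ), semi σ (u t - κ i) * ψ i (t, c))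
        + M * |k - κ i| * ∫ t in Ioi (0 : ℝ), ψ i (t, c)) - K i * δ
        ≤ lin a b (E k) (F k) (G k) (I k) (fun p => ψ i p * ζ p.2) := by
      intro i hi
      have a1 := h (κ i) _ (t2 i hi) fun p => mul_nonneg (hψ0 i hi p) (hζ.nonneg _)
      simp only [hζ.at_center, hζc', mul_zero, integral_zero, mul_one, add_zero] at a1
      have a2 := hK i hi δ hδ ζ hζ
      rw [(hc k).lin_sub (hc (κ i)) (t2 i hi)] at a2
      have := (abs_le.1 a2).1
      linarith
    have h3 := Finset.sum_le_sum h2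
    rw [Finset.sum_sub_distrib, Finset.sum_neg_distrib, ← Finset.sum_mul] at h3
    rw [hX, e1]
    linarith
  have hlim : Tendsto (fun δ => X + (∑ i ∈ s, K i) * δ) (𝓝[>] 0) (𝓝 X) := by
    have : Tendsto (fun δ : ℝ => X + (∑ i ∈ s, K i) * δ) (𝓝 0) (𝓝 (X + (∑ i ∈ s, K i) * 0)) :=
      (Continuous.tendsto (by fun_prop) 0)
    rw [mul_zero, add_zero] at this
    exact this.mono_left nhdsWithin_le_nhds
  refine ge_of_tendsto hlim ?_
  filter_upwards [Ioo_mem_nhdsGT (sub_pos.2 hab)] with δ hδ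
  exact key δ hδ.1 hδ.2

theorem boundary_inequality {v : ℝ → ℝ} {D V : ℝ} (hu : DatumRep u (Ioi 0) v D V) (hα : 0 ≤ α)
    (hσ : σ = 1 ∨ σ = -1) (k : ℝ) {φ : ℝ × ℝ → ℝ} (hφ : IsTest φ) (hφ0 : ∀ p, 0 ≤ φ p) :
    0 ≤ lin a b (E k) (F k) (G k) (I k) φ
      + M * (∫ t in Ioi (0 : ℝ), semi σ (u t - k) * φ (t, c))
      + β * ∫ t in Ioi (0 : ℝ), semi σ (u' t - k) * φ (t, c') := by
  obtain ⟨T, hT, Λ, hΛ0, hz, hΛ⟩ := exists_test_bound hφ.contDiff hφ.compact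
  have hD := hu.D_nonneg
  set ε : ℕ → ℝ := fun m => 1 / ((m : ℝ) + 1) with hε
  have hεp : ∀ m, 0 < ε m := fun m => by positivity
  have hε0 : Tendsto ε atTop (𝓝 0) := tendsto_one_div_add_atTop_nhds_zero_nat
  set n : ℕ → ℕ := fun m => ⌈T / ε m⌉₊ + 1 with hn
  have hstep : ∀ m p, timeStep (ε m) (n m) p.1 * φ p = 0 := by
    intro m p
    rcases le_total T p.1 with hp | hp
    · rw [(hz p hp).1, mul_zero]
    · rw [timeStep_eq_zero (hεp m) (Nat.succ_ne_zero _), zero_mul]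
      have := (div_le_iff₀ (hεp m)).1 (Nat.le_ceil (T / ε m))
      push_cast
      rw [add_sub_cancel_right]; exact hp.trans this
  have hsum : ∀ m p, ∑ i ∈ Finset.range (n m), φ p * timeBump (ε m) i p.1 = φ p := fun m p => by
    rw [← Finset.mul_sum, sum_timeBump, mul_sub, mul_one, mul_comm (φ p), hstep, sub_zero]
  set w : ℕ → ℕ → ℝ := fun m i => v ((i + 1) * ε m) with hw
  have hwD : ∀ m i, |w m i| ≤ D := fun m i =>
    hu.abs_le _ (mem_Ioi.2 (mul_pos (by positivity) (hεp m)))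
  set Ψ : ℝ → ℝ → ℝ := fun r y => α * semi σ (r - clip σ k y) + M * semi σ (y - k) with hΨ
  have hΨlip : ∀ r y y', |Ψ r y - Ψ r y'| ≤ (α + M) * |y - y'| := by
    intro r y y'
    have e : Ψ r y - Ψ r y' = α * (semi σ (r - clip σ k y) - semi σ (r - clip σ k y'))
        + M * (semi σ (y - k) - semi σ (y' - k)) := by simp only [hΨ]; ring
    have a1 := abs_semi_sub_le hσ (y - k) (y' - k)
    rw [sub_sub_sub_cancel_right] at a1
    have a2 := abs_semi_sub_le hσ (r - clip σ k y) (r - clip σ k y')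
    have a3 : |r - clip σ k y - (r - clip σ k y')| ≤ |y - y'| := by
      rw [show r - clip σ k y - (r - clip σ k y') = σ * (semi σ (y' - k) - semi σ (y - k)) by
        unfold clip; ring, abs_mul, abs_sign hσ, one_mul, abs_sub_comm]
      exact a1
    rw [e]
    refine (abs_add_le _ _).trans ?_
    rw [abs_mul, abs_mul, abs_of_nonneg hα, abs_of_nonneg hM, add_mul]
    exact add_le_add (mul_le_mul_of_nonneg_left (a2.trans a3) hα)
      (mul_le_mul_of_nonneg_left a1 hM)
  have hΨr : ∀ r, Ψ r r = M * semi σ (r - k) := by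
    intro r
    have : semi σ (r - clip σ k r) = 0 := by
      unfold clip semi
      refine max_eq_right ?_
      have := sq_sign hσ
      have e : σ * (r - (k + σ * max (σ * (r - k)) 0))
          = σ * (r - k) - σ * σ * max (σ * (r - k)) 0 := by ring
      rw [e, this, one_mul]
      linarith [le_max_left (σ * (r - k)) 0]
    simp [hΨ, this]
  set H : ℕ → ℝ → ℝ := fun m t =>
    ∑ i ∈ Finset.range (n m), Ψ (u t) (w m i) * (φ (t, c) * timeBump (ε m) i t) with hH
  have hφc : Continuous fun t => φ (t, c) := hφ.contDiff.continuous.comp (by fun_prop)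
  have hsub : ∀ g : ℝ → ℝ, (∀ t, φ (t, c) = 0 → g t = 0) →
      ∫ t in Ioi (0 : ℝ), g t = ∫ t in Ioo 0 T, g t := fun g hg => by
    refine setIntegral_eq_of_subset_of_forall_sdiff_eq_zero measurableSet_Ioi Ioo_subset_Ioi_self ?_
    rintro t ⟨ht, ht'⟩
    exact hg t (hz (t, c) (not_lt.1 fun hlt => ht' ⟨ht, hlt⟩)).1
  have hum : AEStronglyMeasurable u (volume.restrict (Ioo 0 T)) :=
    (hu.aemeasurable'.mono_measure
      (Measure.restrict_mono Ioo_subset_Ioi_self le_rfl)).aestronglyMeasurable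
  have huD : ∀ᵐ t ∂(volume.restrict (Ioo 0 T)), |u t| ≤ D :=
    ae_mono (Measure.restrict_mono Ioo_subset_Ioi_self le_rfl) hu.ae_abs_le
  have hbump : ∀ m i, Continuous (timeBump (ε m) i) := fun m i =>
    (contDiff_timeBump (ε m) i).continuous
  have hmain : ∀ m, 0 ≤ lin a b (E k) (F k) (G k) (I k) φ
      + β * (∫ t in Ioi (0 : ℝ), semi σ (u' t - k) * φ (t, c')) + ∫ t in Ioo 0 T, H m t := by
    intro m
    have t1 : ∀ i ∈ Finset.range (n m), IsTest fun p => φ p * timeBump (ε m) i p.1 := fun i _ =>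
      hφ.mul_time (contDiff_timeBump (ε m) i)
    have key := boundary_inequality_of_sum hab hc hM hlip hcut hc' hcc' h (k := k)
      (Finset.range (n m)) (κ := fun i => clip σ k (w m i)) t1
      (fun i _ p => mul_nonneg (hφ0 p) (timeBump_nonneg _ _ _)) hφ hφ0 (by
        ext p; rw [Finset.sum_apply]; exact hsum m p)
    refine key.trans_eq ?_
    congr 1
    have hi1 : ∀ i, IntegrableOn (fun t => φ (t, c) * timeBump (ε m) i t) (Ioo 0 T) := fun i =>
      ((hφc.mul (hbump m i)).integrableOn_Icc).mono_set Ioo_subset_Icc_self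
    have hi2 : ∀ i, IntegrableOn (fun t => semi σ (u t - clip σ k (w m i))
        * (φ (t, c) * timeBump (ε m) i t)) (Ioo 0 T) := fun i => by
      refine (hi1 i).bdd_mul (c := D + |clip σ k (w m i)|) ?_ ?_
      · exact (continuous_semi σ).comp_aestronglyMeasurable (hum.sub aestronglyMeasurable_const)
      · filter_upwards [huD] with t ht
        rw [Real.norm_eq_abs, abs_of_nonneg (semi_nonneg _ _)]
        exact (semi_le_abs hσ _).trans ((abs_sub _ _).trans (by linarith))
    rw [hH, integral_finsetSum _ fun i _ => ?_]
    · refine Finset.sum_congr rfl fun i _ => ?_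
      rw [hsub _ fun t ht => by simp [ht], hsub _ fun t ht => by simp [ht], abs_sub_comm k,
        abs_clip_sub hσ, ← integral_const_mul, ← integral_const_mul,
        ← integral_add ((hi2 i).const_mul α) ((hi1 i).const_mul _)]
      refine integral_congr_ae (Eventually.of_forall fun t => ?_)
      simp only [hΨ]; ring
    · refine (((hi2 i).const_mul α).add ((hi1 i).const_mul (M * semi σ (w m i - k)))).congr
        (Eventually.of_forall fun t => ?_)
      simp only [hΨ, Pi.add_apply]; ring
  have hdiff : ∀ m t, |H m t - M * semi σ (u t - k) * φ (t, c)|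
      ≤ ∑ i ∈ Finset.range (n m), (α + M) * |w m i - u t| * (φ (t, c) * timeBump (ε m) i t) := by
    intro m t
    have e : H m t - M * semi σ (u t - k) * φ (t, c)
        = ∑ i ∈ Finset.range (n m), (Ψ (u t) (w m i) - Ψ (u t) (u t))
          * (φ (t, c) * timeBump (ε m) i t) := by
      simp only [sub_mul, Finset.sum_sub_distrib, ← Finset.mul_sum (Finset.range (n m))]
      have hs := hsum m (t, c)
      rw [← Finset.mul_sum] at hs
      change φ (t, c) * ∑ i ∈ Finset.range (n m), timeBump (ε m) i t = φ (t, c) at hs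
      rw [hs, hΨr]
    rw [e]
    refine (Finset.abs_sum_le_sum_abs _ _).trans (Finset.sum_le_sum fun i _ => ?_)
    have h0 : 0 ≤ φ (t, c) * timeBump (ε m) i t := mul_nonneg (hφ0 _) (timeBump_nonneg _ _ _)
    rw [abs_mul, abs_of_nonneg h0]
    exact mul_le_mul_of_nonneg_right (hΨlip _ _ _) h0
  have hdiff2 : ∀ m t η, 0 ≤ η → (∀ i, timeBump (ε m) i t ≠ 0 → |w m i - u t| ≤ η) →
      |H m t - M * semi σ (u t - k) * φ (t, c)| ≤ (α + M) * η * Λ := by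
    intro m t η hη hi
    refine (hdiff m t).trans ?_
    calc _ ≤ ∑ i ∈ Finset.range (n m), (α + M) * η * (φ (t, c) * timeBump (ε m) i t) := by
          refine Finset.sum_le_sum fun i _ => ?_
          by_cases hb : timeBump (ε m) i t = 0
          · simp [hb]
          · exact mul_le_mul_of_nonneg_right (mul_le_mul_of_nonneg_left (hi i hb) (by linarith))
              (mul_nonneg (hφ0 _) (timeBump_nonneg _ _ _))
      _ = (α + M) * η * φ (t, c) := by rw [← Finset.mul_sum, hsum m (t, c)]
      _ ≤ _ := mul_le_mul_of_nonneg_left ((le_abs_self _).trans (hΛ _).1)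
          (mul_nonneg (by linarith) hη)
  have hlim : Tendsto (fun m => ∫ t in Ioo 0 T, H m t) atTop
      (𝓝 (∫ t in Ioo 0 T, M * semi σ (u t - k) * φ (t, c))) := by
    refine tendsto_integral_of_dominated_convergence
      (fun _ => (α + M) * (2 * D) * Λ + M * (D + |k|) * Λ) (fun m => ?_)
      (integrableOn_const measure_Ioo_lt_top.ne) (fun m => ?_) ?_
    · refine Finset.aestronglyMeasurable_fun_sum _ fun i _ => ?_
      refine AEStronglyMeasurable.mul ?_ (hφc.mul (hbump m i)).aestronglyMeasurable
      exact (((continuous_semi σ).comp_aestronglyMeasurable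
        (hum.sub aestronglyMeasurable_const)).const_mul α).add aestronglyMeasurable_const
    · filter_upwards [huD] with t ht
      have h1 := hdiff2 m t (2 * D) (by linarith) fun i _ =>
        (abs_sub _ _).trans (by linarith [hwD m i])
      have h2 : |M * semi σ (u t - k) * φ (t, c)| ≤ M * (D + |k|) * Λ := by
        rw [abs_mul, abs_mul, abs_of_nonneg hM, abs_of_nonneg (semi_nonneg _ _)]
        have h3 : semi σ (u t - k) ≤ D + |k| :=
          (semi_le_abs hσ _).trans ((abs_sub _ _).trans (by linarith))
        exact mul_le_mul (mul_le_mul_of_nonneg_left h3 hM) (hΛ _).1 (abs_nonneg _)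
          (mul_nonneg hM ((semi_nonneg _ _).trans h3))
      rw [Real.norm_eq_abs]
      have h4 := abs_add_le (H m t - M * semi σ (u t - k) * φ (t, c))
        (M * semi σ (u t - k) * φ (t, c))
      rw [sub_add_cancel] at h4
      linarith
    · filter_upwards [ae_mono (Measure.restrict_mono Ioo_subset_Ioi_self le_rfl) hu.ae_continuousAt,
        ae_mono (Measure.restrict_mono Ioo_subset_Ioi_self le_rfl) hu.ae_eq,
        ae_restrict_mem measurableSet_Ioo] with t h1 h2 h3
      rw [Metric.tendsto_atTop]
      intro e he
      set η := e / ((α + M) * Λ + 1) with hη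
      have hden : 0 < (α + M) * Λ + 1 := by positivity
      have hη0 : 0 < η := by positivity
      obtain ⟨d, hd, hd'⟩ := Metric.continuousAt_iff.1 h1 η hη0
      obtain ⟨m₀, hm₀⟩ := Metric.tendsto_atTop.1 hε0 (d / 2) (by positivity)
      refine ⟨m₀, fun m hm => ?_⟩
      have h4 : ε m < d / 2 := by
        have := hm₀ m hm
        rwa [Real.dist_eq, sub_zero, abs_of_pos (hεp m)] at this
      rw [Real.dist_eq]
      refine (hdiff2 m t η hη0.le fun i hi => ?_).trans_lt ?_
      · have h5 := abs_sub_le_of_timeBump_ne_zero (hεp m) h3.1 hi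
        have := hd' (x := ((i : ℝ) + 1) * ε m) (by rw [Real.dist_eq]; linarith)
        rw [Real.dist_eq] at this
        rw [h2]; exact this.le
      · have : (α + M) * η * Λ = e * ((α + M) * Λ) / ((α + M) * Λ + 1) := by
          rw [hη]; ring
        rw [this, div_lt_iff₀ hden]
        linarith
  have := ge_of_tendsto' (hlim.const_add (lin a b (E k) (F k) (G k) (I k) φ
      + β * (∫ t in Ioi (0 : ℝ), semi σ (u' t - k) * φ (t, c')))) hmain
  rw [hsub (fun t => semi σ (u t - k) * φ (t, c)) fun t ht => by simp [ht], ← integral_const_mul]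
  simp only [mul_assoc] at this ⊢
  linarith

end Side


/-! ### The entropy coefficients of a bounded function -/

theorem measurable_sgnSemi (σ : ℝ) : Measurable (sgnSemi σ) := by
  unfold sgnSemi
  exact Measurable.ite (measurableSet_lt measurable_const (by fun_prop)) measurable_const
    measurable_const

theorem bulk_eq {a b T : ℝ} {E F G : ℝ × ℝ → ℝ} {φ : ℝ × ℝ → ℝ}
    (hz : ∀ p : ℝ × ℝ, T ≤ p.1 → φ p = 0 ∧ dTime φ p = 0 ∧ dSpace φ p = 0) :
    bulk a b E F G φ
      = ∫ p in Ioo 0 T ×ˢ Ioo a b, (E p * dTime φ p + F p * dSpace φ p - G p * φ p) := by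
  refine setIntegral_eq_of_subset_of_forall_sdiff_eq_zero
    (measurableSet_Ioi.prod measurableSet_Ioo) (prod_mono Ioo_subset_Ioi_self le_rfl) ?_
  rintro p ⟨hp, hp'⟩
  obtain ⟨z1, z2, z3⟩ := hz p (not_lt.1 fun hlt => hp' ⟨⟨hp.1, hlt⟩, hp.2⟩)
  rw [z1, z2, z3]; ring

section Regularity
variable {a b L C : ℝ} {f : ℝ → ℝ → ℝ → ℝ → ℝ} {ω : ℝ → ℝ} {ρ : ℝ → ℝ → ℝ} (hab : a < b)

theorem measurable_conv (hρm : Measurable fun p : ℝ × ℝ => ρ p.1 p.2) (hab : a < b) {g : ℝ → ℝ}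
    (hg : Continuous g) : Measurable fun p : ℝ × ℝ => ∫ y in a..b, ρ p.1 y * g (y - p.2) := by
  simp only [intervalIntegral.integral_of_le hab.le]
  have h1 : Measurable fun q : (ℝ × ℝ) × ℝ => ρ q.1.1 q.2 * g (q.2 - q.1.2) :=
    (hρm.comp (measurable_fst.fst.prodMk measurable_snd)).mul (hg.measurable.comp (by fun_prop))
  exact (h1.stronglyMeasurable.integral_prod_right (ν := volume.restrict (Ioc a b))).measurable

theorem measurable_nonlocalTerm (hρm : Measurable fun p : ℝ × ℝ => ρ p.1 p.2) (hab : a < b)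
    (hω : KernelAssumption a b ω) :
    Measurable fun p : ℝ × ℝ => nonlocalTerm a b ω ρ p.1 p.2 := by
  have hc := hω.contDiff.continuous
  have h1 := measurable_conv (ρ := fun _ _ => 1) (by fun_prop) hab hc
  simp only [one_mul] at h1
  exact (measurable_const.div h1).mul (measurable_conv hρm hab hc)

theorem measurable_nonlocalDeriv (hρm : Measurable fun p : ℝ × ℝ => ρ p.1 p.2) (hab : a < b)
    (hω : KernelAssumption a b ω) :
    Measurable fun p : ℝ × ℝ => nonlocalDeriv a b ω ρ p.1 p.2 := by
  obtain ⟨B, hB⟩ := hω.exists_bound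
  have h1 := measurable_conv (ρ := fun _ _ => 1) (by fun_prop) hab hω.contDiff.continuous
  have h2 := measurable_conv (ρ := fun _ _ => 1) (by fun_prop) hab hB.continuous_deriv
  simp only [one_mul] at h1 h2
  exact ((measurable_conv hρm hab hB.continuous_deriv).neg.sub
    ((measurable_nonlocalTerm hρm hab hω).mul h2.neg)).div h1

theorem exists_nonlocalDeriv_bound (hab : a < b) (hω : KernelAssumption a b ω) {T M : ℝ}
    (hM : ∀ t ≤ T, ∀ x, |ρ t x| ≤ M) :
    ∃ c, ∀ t ≤ T, ∀ x ∈ Icc a b, |nonlocalDeriv a b ω ρ t x| ≤ c := by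
  obtain ⟨B, hB⟩ := hω.exists_bound
  obtain ⟨κ, hκ, hmass⟩ := hω.mass_lower_bound
  have hB0 := hB.pos
  have hw : 0 < b - a := sub_pos.2 hab
  have hM0 : 0 ≤ M := (abs_nonneg _).trans (hM T le_rfl 0)
  have hI : ∀ {g : ℝ → ℝ} {c : ℝ}, (∀ y, |g y| ≤ c) → |∫ y in a..b, g y| ≤ c * (b - a) := by
    intro g c hg
    have := intervalIntegral.norm_integral_le_of_norm_le_const (a := a) (b := b) (f := g)
      (fun y _ => hg y)
    rwa [abs_of_pos hw] at this
  refine ⟨(M * B * (b - a) + 1 / κ * (M * B * (b - a)) * (B * (b - a))) / κ, fun t ht x hx => ?_⟩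
  have hK := hmass x hx
  have hKp : 0 < kernelMass a b ω x := hκ.trans_le hK
  have c1 : |∫ y in a..b, ρ t y * deriv ω (y - x)| ≤ M * B * (b - a) := hI fun y => by
    rw [abs_mul]; exact mul_le_mul (hM t ht y) (hB.bound_deriv _) (abs_nonneg _) hM0
  have c2 : |∫ y in a..b, ρ t y * ω (y - x)| ≤ M * B * (b - a) := hI fun y => by
    rw [abs_mul]; exact mul_le_mul (hM t ht y) (hB.bound _) (abs_nonneg _) hM0
  have c3 : |∫ y in a..b, deriv ω (y - x)| ≤ B * (b - a) := hI fun y => hB.bound_deriv _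
  have c4 : |nonlocalTerm a b ω ρ t x| ≤ 1 / κ * (M * B * (b - a)) := by
    unfold nonlocalTerm
    rw [abs_mul, abs_of_pos (one_div_pos.2 hKp)]
    exact mul_le_mul (one_div_le_one_div_of_le hκ hK) c2 (abs_nonneg _) (by positivity)
  unfold nonlocalDeriv
  rw [abs_div, abs_of_pos hKp]
  refine div_le_div₀ (by positivity) ?_ hκ hK
  refine (abs_sub _ _).trans ?_
  rw [abs_neg, abs_mul, abs_neg]
  exact add_le_add c1 (mul_le_mul c4 c3 (abs_nonneg _) (by positivity))

theorem aestronglyMeasurable_of_clamp {g : ℝ → ℝ → ℝ → ℝ → ℝ}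
    (hg : Continuous fun p => uncurryFlux g (clampDomain a b p)) {r R : ℝ × ℝ → ℝ}
    (hr : Measurable r) (hR : Measurable R) :
    AEStronglyMeasurable (fun p : ℝ × ℝ => g p.1 p.2 (r p) (R p))
      (volume.restrict (Ioi (0 : ℝ) ×ˢ Ioo a b)) := by
  have h1 : Measurable fun p : ℝ × ℝ => uncurryFlux g (clampDomain a b (p.1, p.2, r p, R p)) :=
    hg.measurable.comp (measurable_fst.prodMk (measurable_snd.prodMk (hr.prodMk hR)))
  refine h1.aestronglyMeasurable.congr ?_
  filter_upwards [ae_restrict_mem (measurableSet_Ioi.prod measurableSet_Ioo)] with p hp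
  rw [clampDomain_eq (le_of_lt hp.1) (Ioo_subset_Icc_self hp.2)]
  rfl

end Regularity

section Entropy
variable {a b L C σ : ℝ} {f : ℝ → ℝ → ℝ → ℝ → ℝ} {ω : ℝ → ℝ} {ρ : ℝ → ℝ → ℝ} (hab : a < b)
  (hf : FluxAssumption a b L C f) (hω : KernelAssumption a b ω)
  (hρm : Measurable fun p : ℝ × ℝ => ρ p.1 p.2) (hρb : ∀ T, ∃ M, ∀ t ≤ T, ∀ x, |ρ t x| ≤ M)
  (hσ : σ = 1 ∨ σ = -1)
include hab hf hω hρb hσ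

theorem exists_entropy_bound (T κ : ℝ) : ∃ c, ∀ k, |k| ≤ κ → ∀ p ∈ Ioo 0 T ×ˢ Ioo a b,
    |entE σ ρ k p| ≤ c ∧ |entF f σ ρ (nonlocalTerm a b ω ρ) k p| ≤ c ∧
      |entG a b f σ ρ (nonlocalTerm a b ω ρ) (nonlocalDeriv a b ω ρ) k p| ≤ c := by
  obtain ⟨M, hM⟩ := hρb T
  obtain ⟨c', hc'⟩ := exists_nonlocalDeriv_bound hab hω hM
  have hM0 : 0 ≤ M := (abs_nonneg _).trans (hM T le_rfl 0)
  have hL := hf.L_pos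
  have hC := hf.C_pos
  rcases lt_or_ge κ 0 with hκ | hκ
  · exact ⟨0, fun k hk => absurd (abs_nonneg k) (by linarith)⟩
  have hc0 : 0 ≤ c' := (abs_nonneg _).trans (hc' T le_rfl a (left_mem_Icc.2 hab.le))
  refine ⟨(M + κ) + L * (M + κ) + C * κ * (1 + c'), fun k hk p hp => ?_⟩
  have ht : (0 : ℝ) ≤ p.1 := hp.1.1.le
  have hx := Ioo_subset_Icc_self hp.2
  have h1 : |ρ p.1 p.2 - k| ≤ M + κ := (abs_sub _ _).trans (add_le_add (hM _ hp.1.2.le _) hk)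
  have p1 : 0 ≤ L * (M + κ) := by positivity
  have p2 : 0 ≤ C * κ * (1 + c') := by positivity
  have p3 : 0 ≤ M + κ := by positivity
  refine ⟨?_, ?_, ?_⟩
  · unfold entE
    rw [abs_of_nonneg (semi_nonneg _ _)]
    have := (semi_le_abs hσ _).trans h1
    linarith
  · unfold entF
    rw [abs_mul]
    have := mul_le_mul (abs_sgnSemi_le hσ (ρ p.1 p.2 - k)) ((hf.abs_sub_le ht hx (ρ p.1 p.2) k
      (nonlocalTerm a b ω ρ p.1 p.2)).trans (mul_le_mul_of_nonneg_left h1 hL.le)) (abs_nonneg _)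
      zero_le_one
    linarith
  · unfold entG
    rw [abs_mul]
    have hCk : C * |k| ≤ C * κ := mul_le_mul_of_nonneg_left hk hC.le
    have h2 := (hf.bound_x p.1 ht p.2 hx k (nonlocalTerm a b ω ρ p.1 p.2)).trans hCk
    have h3 := (hf.bound_R p.1 ht p.2 hx k (nonlocalTerm a b ω ρ p.1 p.2)).trans hCk
    have h4 := mul_le_mul h3 (hc' p.1 hp.1.2.le p.2 hx) (abs_nonneg _) (by positivity)
    rw [← abs_mul] at h4
    have h5 := (abs_add_le _ _).trans (add_le_add h2 h4)
    have := mul_le_mul (abs_sgnSemi_le hσ (ρ p.1 p.2 - k)) h5 (abs_nonneg _) zero_le_one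
    linarith

include hρm

theorem coeffs_entropy {ρo vo : ℝ → ℝ} {Do Vo : ℝ} (ho : DatumRep ρo (Ioo a b) vo Do Vo) (k : ℝ) :
    Coeffs a b (entE σ ρ k) (entF f σ ρ (nonlocalTerm a b ω ρ) k)
      (entG a b f σ ρ (nonlocalTerm a b ω ρ) (nonlocalDeriv a b ω ρ) k)
      (fun x => semi σ (ρo x - k)) := by
  have hR := measurable_nonlocalTerm hρm hab hω
  have hs : Measurable fun p : ℝ × ℝ => sgnSemi σ (ρ p.1 p.2 - k) :=
    (measurable_sgnSemi σ).comp (hρm.sub_const k)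
  refine ⟨?_, ?_, ?_, ?_, fun T => ?_, ⟨Do + |k|, ?_⟩⟩
  · exact ((continuous_semi σ).measurable.comp (hρm.sub_const k)).aestronglyMeasurable
  · exact hs.aestronglyMeasurable.mul ((aestronglyMeasurable_of_clamp (hf.continuous_clamp hab)
      hρm hR).sub (aestronglyMeasurable_of_clamp (hf.continuous_clamp hab) measurable_const hR))
  · exact hs.aestronglyMeasurable.mul ((aestronglyMeasurable_of_clamp (hf.continuous_dX_clamp hab)
      measurable_const hR).add ((aestronglyMeasurable_of_clamp (hf.continuous_dR_clamp hab)
      measurable_const hR).mul (measurable_nonlocalDeriv hρm hab hω).aestronglyMeasurable))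
  · exact (continuous_semi σ).comp_aestronglyMeasurable
      (ho.aemeasurable'.aestronglyMeasurable.sub aestronglyMeasurable_const)
  · obtain ⟨c, hc⟩ := exists_entropy_bound hab hf hω hρb hσ T |k|
    exact ⟨c, hc k le_rfl⟩
  · filter_upwards [ho.ae_abs_le] with x hx
    rw [abs_of_nonneg (semi_nonneg _ _)]
    exact (semi_le_abs hσ _).trans ((abs_sub _ _).trans (by linarith))

omit hab hω hρm hρb in
theorem entF_lip {M : ℝ} (hM : 0 ≤ M) {R : ℝ → ℝ → ℝ}
    (hMb : ∀ t > 0, ∀ x ∈ Icc a b, ∀ r, |dRho f t x r (R t x)| ≤ M) (k k' : ℝ) :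
    ∀ p ∈ Ioi (0 : ℝ) ×ˢ Ioo a b, |entF f σ ρ R k p - entF f σ ρ R k' p| ≤ M * |k - k'| :=
  fun p hp => abs_sgnSemi_mul_sub_le hσ (g := fun r => f p.1 p.2 r (R p.1 p.2)) hM
    (fun r r' => hf.abs_sub_le_of_dRho_le (le_of_lt hp.1) (Ioo_subset_Icc_self hp.2)
      (fun r => hMb p.1 hp.1 p.2 (Ioo_subset_Icc_self hp.2) r) r r') _ _ _

theorem entropy_inequality_of_countable {ρo vo ρa va ρb vb : ℝ → ℝ} {Do Vo Da Va Db Vb α : ℝ}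
    (ho : DatumRep ρo (Ioo a b) vo Do Vo) (ha : DatumRep ρa (Ioi 0) va Da Va)
    (hb : DatumRep ρb (Ioi 0) vb Db Vb) {Z : Set ℝ} (hZ : Z.Countable) {φ : ℝ × ℝ → ℝ}
    (hφ : IsTest φ)
    (h : ∀ k ∉ Z, 0 ≤ lin a b (entE σ ρ k) (entF f σ ρ (nonlocalTerm a b ω ρ) k)
        (entG a b f σ ρ (nonlocalTerm a b ω ρ) (nonlocalDeriv a b ω ρ) k)
        (fun x => semi σ (ρo x - k)) φ
      + α * (∫ t in Ioi (0 : ℝ), semi σ (ρa t - k) * φ (t, a))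
      + α * ∫ t in Ioi (0 : ℝ), semi σ (ρb t - k) * φ (t, b)) (k : ℝ) :
    0 ≤ lin a b (entE σ ρ k) (entF f σ ρ (nonlocalTerm a b ω ρ) k)
        (entG a b f σ ρ (nonlocalTerm a b ω ρ) (nonlocalDeriv a b ω ρ) k)
        (fun x => semi σ (ρo x - k)) φ
      + α * (∫ t in Ioi (0 : ℝ), semi σ (ρa t - k) * φ (t, a))
      + α * ∫ t in Ioi (0 : ℝ), semi σ (ρb t - k) * φ (t, b) := by
  obtain ⟨T, hT, Λ, hΛ0, hz, hΛ⟩ := exists_test_bound hφ.contDiff hφ.compact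
  have hex : ∀ i : ℕ, ∃ κ ∉ Z, 0 < σ * (κ - k) ∧ σ * (κ - k) < 1 / ((i : ℝ) + 1) := by
    intro i
    have hpos : (0 : ℝ) < 1 / ((i : ℝ) + 1) := by positivity
    have hopen : IsOpen ((fun y : ℝ => σ * (y - k)) ⁻¹' Ioo 0 (1 / ((i : ℝ) + 1))) :=
      isOpen_Ioo.preimage (by fun_prop)
    obtain ⟨κ, h1, h2⟩ := (hZ.dense_compl ℝ).inter_open_nonempty _ hopen
      ⟨k + σ * (1 / ((i : ℝ) + 1) / 2), by
        rw [mem_preimage, add_sub_cancel_left, ← mul_assoc, sq_sign hσ, one_mul]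
        constructor <;> linarith⟩
    exact ⟨κ, h2, h1⟩
  choose κ hκZ hκ0 hκ1 using hex
  have habs : ∀ i, |κ i - k| = σ * (κ i - k) := fun i => by
    rw [← abs_of_pos (hκ0 i), abs_mul, abs_sign hσ, one_mul]
  have hκlim : Tendsto κ atTop (𝓝 k) := by
    rw [tendsto_iff_dist_tendsto_zero]
    refine squeeze_zero (fun i => dist_nonneg) (fun i => ?_) tendsto_one_div_add_atTop_nhds_zero_nat
    rw [Real.dist_eq, habs]; exact (hκ1 i).le
  have hκb : ∀ i, |κ i| ≤ |k| + 1 := fun i => by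
    have h1 : σ * (κ i - k) < 1 := (hκ1 i).trans_le (by
      rw [div_le_one (by positivity)]; linarith [(Nat.cast_nonneg i : (0 : ℝ) ≤ i)])
    rw [← habs] at h1
    have h2 := abs_add_le (κ i - k) k
    rw [sub_add_cancel] at h2
    linarith
  have hsemi : ∀ r : ℝ, Tendsto (fun i => semi σ (r - κ i)) atTop (𝓝 (semi σ (r - k))) := fun r =>
    ((continuous_semi σ).tendsto _).comp (hκlim.const_sub r)
  have hsgn : ∀ r : ℝ, Tendsto (fun i => sgnSemi σ (r - κ i)) atTop (𝓝 (sgnSemi σ (r - k))) := by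
    intro r
    refine Tendsto.congr' ?_ tendsto_const_nhds
    rcases lt_or_ge 0 (σ * (r - k)) with hr | hr
    · have h1 : Tendsto (fun i => σ * (r - κ i)) atTop (𝓝 (σ * (r - k))) :=
        (hκlim.const_sub r).const_mul σ
      filter_upwards [h1.eventually_const_lt hr] with i hi
      simp [sgnSemi, hr, hi]
    · refine Eventually.of_forall fun i => ?_
      have : ¬ 0 < σ * (r - κ i) := by
        have := hκ0 i
        have e : σ * (r - κ i) = σ * (r - k) - σ * (κ i - k) := by ring
        rw [e]; linarith
      simp [sgnSemi, not_lt.2 hr, this]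
  obtain ⟨c, hc⟩ := exists_entropy_bound hab hf hω hρb hσ T (|k| + 1)
  have hsub : Ioo 0 T ×ˢ Ioo a b ⊆ Ioi (0 : ℝ) ×ˢ Ioo a b := prod_mono Ioo_subset_Ioi_self le_rfl
  have hvol : volume (Ioo 0 T ×ˢ Ioo a b) ≠ ⊤ := by
    rw [Measure.volume_eq_prod, Measure.prod_prod]
    exact (ENNReal.mul_lt_top measure_Ioo_lt_top measure_Ioo_lt_top).ne
  have l1 : Tendsto (fun i => bulk a b (entE σ ρ (κ i)) (entF f σ ρ (nonlocalTerm a b ω ρ) (κ i))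
        (entG a b f σ ρ (nonlocalTerm a b ω ρ) (nonlocalDeriv a b ω ρ) (κ i)) φ) atTop
      (𝓝 (bulk a b (entE σ ρ k) (entF f σ ρ (nonlocalTerm a b ω ρ) k)
        (entG a b f σ ρ (nonlocalTerm a b ω ρ) (nonlocalDeriv a b ω ρ) k) φ)) := by
    simp only [bulk_eq hz]
    refine tendsto_integral_of_dominated_convergence (fun _ => c * Λ + c * Λ + c * Λ)
      (fun i => ?_) (integrableOn_const hvol) (fun i => ?_) ?_
    · exact (((coeffs_entropy hab hf hω hρm hρb hσ ho (κ i)).integrableOn hφ).1.mono_measure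
        (Measure.restrict_mono hsub le_rfl))
    · filter_upwards [ae_restrict_mem (measurableSet_Ioo.prod measurableSet_Ioo)] with p hp
      obtain ⟨e1, e2, e3⟩ := hc (κ i) (hκb i) p hp
      obtain ⟨d1, d2, d3⟩ := hΛ p
      have hc0 : 0 ≤ c := (abs_nonneg _).trans e1
      rw [Real.norm_eq_abs]
      refine (abs_sub _ _).trans ((add_le_add_left (abs_add_le _ _) _).trans ?_)
      rw [abs_mul, abs_mul, abs_mul]
      have m1 := mul_le_mul e1 d2 (abs_nonneg _) hc0
      have m2 := mul_le_mul e2 d3 (abs_nonneg _) hc0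
      have m3 := mul_le_mul e3 d1 (abs_nonneg _) hc0
      linarith
    · filter_upwards [ae_restrict_mem (measurableSet_Ioo.prod measurableSet_Ioo)] with p hp
      have ht : (0 : ℝ) ≤ p.1 := hp.1.1.le
      have hx := Ioo_subset_Icc_self hp.2
      have hcl : ∀ {g : ℝ → ℝ → ℝ → ℝ → ℝ}, Continuous (fun p => uncurryFlux g (clampDomain a b p)) →
          Tendsto (fun i => g p.1 p.2 (κ i) (nonlocalTerm a b ω ρ p.1 p.2)) atTop
            (𝓝 (g p.1 p.2 k (nonlocalTerm a b ω ρ p.1 p.2))) := fun hg =>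
        tendsto_of_continuous_clamp hg (fun _ => ht) (fun _ => hx) ht hx tendsto_const_nhds
          tendsto_const_nhds hκlim tendsto_const_nhds
      have q1 : Tendsto (fun i => entF f σ ρ (nonlocalTerm a b ω ρ) (κ i) p) atTop
          (𝓝 (entF f σ ρ (nonlocalTerm a b ω ρ) k p)) :=
        (hsgn _).mul ((hcl (hf.continuous_clamp hab)).const_sub _)
      have q2 : Tendsto (fun i => entG a b f σ ρ (nonlocalTerm a b ω ρ) (nonlocalDeriv a b ω ρ)
          (κ i) p) atTop
          (𝓝 (entG a b f σ ρ (nonlocalTerm a b ω ρ) (nonlocalDeriv a b ω ρ) k p)) :=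
        (hsgn _).mul ((hcl (hf.continuous_dX_clamp hab)).add
          ((hcl (hf.continuous_dR_clamp hab)).mul_const _))
      exact (((hsemi _).mul_const _).add (q1.mul_const _)).sub (q2.mul_const _)
  have hdata : ∀ {D : ℝ} {u : ℝ → ℝ} {s : Set ℝ} {g : ℝ → ℝ}, volume s ≠ ⊤ →
      AEStronglyMeasurable u (volume.restrict s) → (∀ᵐ t ∂(volume.restrict s), |u t| ≤ D) →
      Continuous g → (∀ t, |g t| ≤ Λ) → Tendsto (fun i => ∫ t in s, semi σ (u t - κ i) * g t) atTop
        (𝓝 (∫ t in s, semi σ (u t - k) * g t)) := by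
    intro D u s g hs hum huD hg hgΛ
    refine tendsto_integral_of_dominated_convergence (fun _ => (D + (|k| + 1)) * Λ) (fun i => ?_)
      (integrableOn_const hs) (fun i => ?_) (Eventually.of_forall fun t => (hsemi _).mul_const _)
    · exact ((continuous_semi σ).comp_aestronglyMeasurable
        (hum.sub aestronglyMeasurable_const)).mul hg.aestronglyMeasurable
    · filter_upwards [huD] with t ht
      have h1 : semi σ (u t - κ i) ≤ D + (|k| + 1) :=
        (semi_le_abs hσ _).trans ((abs_sub _ _).trans (add_le_add ht (hκb i)))
      rw [norm_mul, Real.norm_eq_abs, Real.norm_eq_abs, abs_of_nonneg (semi_nonneg _ _)]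
      exact mul_le_mul h1 (hgΛ t) (abs_nonneg _) ((semi_nonneg _ _).trans h1)
  have l2 := hdata measure_Ioo_lt_top.ne ho.aemeasurable'.aestronglyMeasurable ho.ae_abs_le
    (g := fun x => φ (0, x)) (hφ.contDiff.continuous.comp (by fun_prop)) fun x => (hΛ _).1
  have l3 : ∀ {D V : ℝ} {u v : ℝ → ℝ} (c : ℝ), DatumRep u (Ioi 0) v D V →
      Tendsto (fun i => ∫ t in Ioi (0 : ℝ), semi σ (u t - κ i) * φ (t, c)) atTop
        (𝓝 (∫ t in Ioi (0 : ℝ), semi σ (u t - k) * φ (t, c))) := by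
    intro D V u v c hu
    have e : ∀ k, ∫ t in Ioi (0 : ℝ), semi σ (u t - k) * φ (t, c)
        = ∫ t in Ioo 0 T, semi σ (u t - k) * φ (t, c) := fun k => by
      refine setIntegral_eq_of_subset_of_forall_sdiff_eq_zero measurableSet_Ioi
        Ioo_subset_Ioi_self ?_
      rintro t ⟨ht, ht'⟩
      rw [(hz (t, c) (not_lt.1 fun hlt => ht' ⟨ht, hlt⟩)).1, mul_zero]
    simp only [e]
    have hr : volume.restrict (Ioo 0 T) ≤ volume.restrict (Ioi 0) :=
      Measure.restrict_mono Ioo_subset_Ioi_self le_rfl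
    exact hdata measure_Ioo_lt_top.ne (hu.aemeasurable'.mono_measure hr).aestronglyMeasurable
      (ae_mono hr hu.ae_abs_le) (hφ.contDiff.continuous.comp (by fun_prop)) fun x => (hΛ _).1
  exact ge_of_tendsto' (((l1.add l2).add ((l3 a ha).const_mul α)).add ((l3 b hb).const_mul α))
    fun i => h (κ i) (hκZ i)

theorem entropy_inequality_sharp {ρo vo ρa va ρb vb : ℝ → ℝ} {Do Vo Da Va Db Vb α M : ℝ}
    (ho : DatumRep ρo (Ioo a b) vo Do Vo) (ha : DatumRep ρa (Ioi 0) va Da Va)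
    (hb : DatumRep ρb (Ioi 0) vb Db Vb) (hα : 0 ≤ α) (hM : 0 ≤ M)
    (hMb : ∀ t > 0, ∀ x ∈ Icc a b, ∀ r, |dRho f t x r (nonlocalTerm a b ω ρ t x)| ≤ M)
    (h : ∀ k, ∀ φ, IsTest φ → (∀ p, 0 ≤ φ p) →
      0 ≤ lin a b (entE σ ρ k) (entF f σ ρ (nonlocalTerm a b ω ρ) k)
        (entG a b f σ ρ (nonlocalTerm a b ω ρ) (nonlocalDeriv a b ω ρ) k)
        (fun x => semi σ (ρo x - k)) φ
      + α * (∫ t in Ioi (0 : ℝ), semi σ (ρa t - k) * φ (t, a))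
      + α * ∫ t in Ioi (0 : ℝ), semi σ (ρb t - k) * φ (t, b))
    (k : ℝ) {φ : ℝ × ℝ → ℝ} (hφ : IsTest φ) (hφ0 : ∀ p, 0 ≤ φ p) :
    0 ≤ lin a b (entE σ ρ k) (entF f σ ρ (nonlocalTerm a b ω ρ) k)
        (entG a b f σ ρ (nonlocalTerm a b ω ρ) (nonlocalDeriv a b ω ρ) k)
        (fun x => semi σ (ρo x - k)) φ
      + M * ((∫ t in Ioi (0 : ℝ), semi σ (ρa t - k) * φ (t, a))
      + ∫ t in Ioi (0 : ℝ), semi σ (ρb t - k) * φ (t, b)) := by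
  have hc := coeffs_entropy hab hf hω hρm hρb hσ ho
  have hlip := entF_lip (ρ := ρ) hf hσ hM hMb
  have hw : 0 ≤ b - a := by linarith
  have h1 := fun k φ (hφ : IsTest φ) (hφ0 : ∀ p, 0 ≤ φ p) =>
    boundary_inequality hab hc hM hlip (fun δ => exists_cutoff_left hab)
    (right_mem_Icc.2 hab.le) (le_abs_self _) h ha hα hσ k hφ hφ0
  have h2 := boundary_inequality (α := α) (β := M) (c := b) (c' := a) (u := ρb) (u' := ρa) hab hc hM
    hlip (fun δ => exists_cutoff_right hab) (left_mem_Icc.2 hab.le)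
    (by rw [abs_sub_comm]; exact le_abs_self _)
    (fun k φ hφ hφ0 => (h1 k φ hφ hφ0).trans_eq (by ring)) hb hα hσ k hφ hφ0
  exact h2.trans_eq (by ring)

end Entropy


/-! ### Convergence of the scheme -/

theorem DatumRep.ae_tendsto_timeMean {u v : ℝ → ℝ} {D V : ℝ} (hu : DatumRep u (Ioi 0) v D V)
    {τ : ℕ → ℝ} (hτ : ∀ m, 0 < τ m) (hτ0 : Tendsto τ atTop (𝓝 0)) :
    ∀ᵐ t ∂(volume.restrict (Ioi 0)),
      Tendsto (fun m => timeMean u (τ m) ⌊t / τ m⌋₊) atTop (𝓝 (u t)) := by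
  filter_upwards [hu.ae_tendsto_mean, ae_restrict_mem measurableSet_Ioi] with t ht ht0
  simp only [timeMean_eq]
  refine ht _ τ hτ (fun m x hx => lt_of_le_of_lt
    (mul_nonneg (Nat.cast_nonneg _) (hτ m).le) hx.1) (fun m => ⟨?_, ?_⟩) hτ0
  · exact floor_mul_le (hτ m) (le_of_lt ht0)
  · have := Nat.lt_floor_add_one (t / τ m)
    rw [div_lt_iff₀ (hτ m)] at this
    linarith

theorem DatumRep.ae_tendsto_scheme_init {a b α : ℝ} (hab : a < b) {f : ℝ → ℝ → ℝ → ℝ → ℝ}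
    {ω ρo ρa ρb vo : ℝ → ℝ} {Do Vo : ℝ} (ho : DatumRep ρo (Ioo a b) vo Do Vo) {N : ℕ → ℕ}
    {Δt : ℕ → ℝ} (hN : ∀ m, 0 < N m)
    (hlim : Tendsto (fun m => (b - a) / (N m : ℝ)) atTop (𝓝 0)) :
    ∀ᵐ x ∂(volume.restrict (Ioo a b)),
      Tendsto (fun m => scheme a b f ω ρo ρa ρb α (N m) (Δt m) 0
        (⌊(x - a) / ((b - a) / N m)⌋₊ + 1)) atTop (𝓝 (ρo x)) := by
  filter_upwards [ho.ae_tendsto_mean, ae_restrict_mem measurableSet_Ioo] with x hx hxm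
  have hN' : ∀ m, (0 : ℝ) < N m := fun m => Nat.cast_pos.2 (hN m)
  have hh : ∀ m, 0 < (b - a) / N m := fun m => div_pos (sub_pos.2 hab) (hN' m)
  have hmesh : ∀ m, N m * ((b - a) / N m) = b - a := fun m => by
    have := (hN' m).ne'
    field_simp
  have hlt : ∀ m, ⌊(x - a) / ((b - a) / N m)⌋₊ < N m := fun m =>
    floor_cell_lt (hh m) (hmesh m) (Ioo_subset_Ico_self hxm)
  simp only [scheme_init _ _ _ _ _ _ _ _ _ _ (hlt _)]
  refine hx _ _ hh (fun m => Ioo_subset_Ioo ?_ ?_) (fun m => ?_) hlim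
  · have := mul_nonneg (Nat.cast_nonneg ⌊(x - a) / ((b - a) / N m)⌋₊) (hh m).le
    linarith
  · have h1 : (⌊(x - a) / ((b - a) / N m)⌋₊ : ℝ) + 1 ≤ N m := by exact_mod_cast hlt m
    have := mul_le_mul_of_nonneg_right h1 (hh m).le
    have := hmesh m
    linarith
  · obtain ⟨h1, h2⟩ := floor_cell_bounds (hh m) hxm.1.le
    exact ⟨h1, by linarith⟩

theorem fluxLip_bounds {a b L C : ℝ} {f : ℝ → ℝ → ℝ → ℝ → ℝ} (hf : FluxAssumption a b L C f)
    (R : ℝ → ℝ → ℝ) : 0 ≤ fluxLip a b f R ∧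
      ∀ t > 0, ∀ x ∈ Icc a b, ∀ r, |dRho f t x r (R t x)| ≤ fluxLip a b f R := by
  constructor
  · refine Real.sSup_nonneg ?_
    rintro m ⟨t, x, r, -, -, rfl⟩
    exact abs_nonneg _
  · intro t ht x hx r
    refine le_csSup ⟨L, ?_⟩ ⟨t, x, r, ht, hx, rfl⟩
    rintro m ⟨t, x, r, ht, hx, rfl⟩
    exact hf.bound_rho t (le_of_lt ht) x hx r _

section Convergence
variable {a b L C α D V : ℝ} {f : ℝ → ℝ → ℝ → ℝ → ℝ} {ω ρo ρa ρb vo va vb : ℝ → ℝ}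
  {Do Vo Da Va Db Vb : ℝ} {N : ℕ → ℕ} {Δt : ℕ → ℝ} {ρ : ℝ → ℝ → ℝ} (hab : a < b)
  (hf : FluxAssumption a b L C f) (hω : KernelAssumption a b ω)
  (ho : DatumRep ρo (Ioo a b) vo Do Vo) (ha : DatumRep ρa (Ioi 0) va Da Va)
  (hb : DatumRep ρb (Ioi 0) vb Db Vb) (hα : 1 ≤ α) (hN : ∀ m, 0 < N m)
  (hS : ∀ m, IsScheme a b f ω L α D V (N m) ((b - a) / N m) (Δt m)
    (scheme a b f ω ρo ρa ρb α (N m) (Δt m)))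
  (hlim : Tendsto (fun m => (b - a) / (N m : ℝ)) atTop (𝓝 0))
  (hτ : Tendsto Δt atTop (𝓝 0)) (hτ1 : ∀ m, Δt m ≤ 1)
  (hR : ∀ T > 0, ∃ M V' K R₁ : ℝ, 0 ≤ M ∧ 0 ≤ V' ∧ 0 ≤ K ∧ 0 ≤ R₁ ∧
    ∀ m (n : ℕ), n * Δt m ≤ T → RowBounds ω M V' K R₁ (N m) ((b - a) / N m) (Δt m)
      (scheme a b f ω ρo ρa ρb α (N m) (Δt m)) n)
  (hρm : Measurable fun p : ℝ × ℝ => ρ p.1 p.2) (hρb : ∀ T, ∃ M, ∀ t ≤ T, ∀ x, |ρ t x| ≤ M)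
  (hconv : ∀ T > 0, Tendsto (fun m => eLpNorm (fun p : ℝ × ℝ =>
    cellFn (scheme a b f ω ρo ρa ρb α (N m) (Δt m)) a ((b - a) / N m) (Δt m) p - ρ p.1 p.2) 1
      (volume.restrict (Ioo 0 T ×ˢ Ioo a b))) atTop (𝓝 0))
include hab hf hω ho ha hb hα hN hS hlim hτ hτ1 hR hρm hρb hconv

omit hα in
theorem entropy_inequality_scheme_constant {σ : ℝ} (hσ : σ = 1 ∨ σ = -1) (k : ℝ) {φ : ℝ × ℝ → ℝ}
    (hφ : IsTest φ) (hφ0 : ∀ p, 0 ≤ φ p) :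
    0 ≤ lin a b (entE σ ρ k) (entF f σ ρ (nonlocalTerm a b ω ρ) k)
        (entG a b f σ ρ (nonlocalTerm a b ω ρ) (nonlocalDeriv a b ω ρ) k)
        (fun x => semi σ (ρo x - k)) φ
      + α * (∫ t in Ioi (0 : ℝ), semi σ (ρa t - k) * φ (t, a))
      + α * ∫ t in Ioi (0 : ℝ), semi σ (ρb t - k) * φ (t, b) := by
  obtain ⟨T, hT, Λ, -, hz, hΛ⟩ := exists_test_bound hφ.contDiff hφ.compact
  obtain ⟨M, V', K, R₁, -, -, -, -, hRk⟩ := hR (T + 2) (by linarith)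
  obtain ⟨Mρ, hMρ⟩ := hρb (T + 1)
  have hRk' : ∀ m (n : ℕ), n * Δt m ≤ T + 1 + Δt m →
      RowBounds ω M V' K R₁ (N m) ((b - a) / N m) (Δt m)
        (scheme a b f ω ρo ρa ρb α (N m) (Δt m)) n :=
    fun m n hn => hRk m n (by linarith [hτ1 m])
  obtain ⟨s, hs, hae⟩ := exists_subseq_ae hab (by linarith) hS hlim hτ hRk' hρm hMρ
    (hconv (T + 1) (by linarith))
  set μ : Measure (ℝ × ℝ) := volume.restrict (Ioo 0 (T + 1) ×ˢ Ioo a b) with hμ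
  have hZ : {k : ℝ | 0 < μ {p : ℝ × ℝ | ρ p.1 p.2 = k}}.Countable :=
    Measure.countable_meas_level_set_pos hρm
  refine entropy_inequality_of_countable hab hf hω hρm hρb hσ ho ha hb hZ hφ (fun k hk => ?_) k
  have hk' : ∀ᵐ p ∂μ, ρ p.1 p.2 ≠ k := by
    rw [mem_ofPred_eq, not_lt, nonpos_iff_eq_zero] at hk
    rw [ae_iff]
    simpa using hk
  have ht := hs.tendsto_atTop
  have key := entropy_inequality_of_ae_ne (N := fun m => N (s m)) (τ := fun m => Δt (s m))
    (h := fun m => (b - a) / (N (s m) : ℝ))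
    (S := fun m => scheme a b f ω ρo ρa ρb α (N (s m)) (Δt (s m))) hab hf hω (fun m => hS (s m))
    (hlim.comp ht) (hτ.comp ht) hσ hφ.contDiff hφ0 hT hz hΛ (fun m => hτ1 (s m))
    (fun m => hRk' (s m)) hρm hMρ hae hk'
    (ho.ae_tendsto_scheme_init hab (fun m => hN (s m)) (hlim.comp ht))
    (by
      simp only [scheme_left]
      exact ha.ae_tendsto_timeMean (fun m => (hS (s m)).τ_pos) (hτ.comp ht))
    (by
      simp only [scheme_right]
      exact hb.ae_tendsto_timeMean (fun m => (hS (s m)).τ_pos) (hτ.comp ht))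
  refine key.trans_eq ?_
  unfold lin
  ring

theorem entropyFunctional_nonneg {σ : ℝ} (hσ : σ = 1 ∨ σ = -1) (k : ℝ) {φ : ℝ × ℝ → ℝ}
    (hφ : IsTest φ) (hφ0 : ∀ p, 0 ≤ φ p) :
    0 ≤ entropyFunctional a b f ω ρo ρa ρb (semi σ) (sgnSemi σ) ρ k φ := by
  obtain ⟨hM, hMb⟩ := fluxLip_bounds hf (nonlocalTerm a b ω ρ)
  have key := entropy_inequality_sharp hab hf hω hρm hρb hσ ho ha hb (zero_le_one.trans hα) hM hMb
    (fun k φ hφ hφ0 => entropy_inequality_scheme_constant hab hf hω ho ha hb hN hS hlim hτ hτ1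
      hR hρm hρb hconv hσ k hφ hφ0) k hφ hφ0
  refine key.trans_eq ?_
  unfold lin bulk entropyFunctional
  simp only
  congr 2
  obtain ⟨B, hB⟩ := hω.exists_bound
  obtain ⟨κ, hκ, hmass⟩ := hω.mass_lower_bound
  refine setIntegral_congr_fun (measurableSet_Ioi.prod measurableSet_Ioo) fun p hp => ?_
  have hW : kernelMass a b ω p.2 ≠ 0 :=
    (hκ.trans_le (hmass p.2 (Ioo_subset_Icc_self hp.2))).ne'
  have hi : IntervalIntegrable (ρ p.1) volume a b := by
    obtain ⟨M, hMp⟩ := hρb p.1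
    rw [intervalIntegrable_iff, uIoc_of_le hab.le]
    exact Measure.integrableOn_of_bounded (M := M) measure_Ioc_lt_top.ne
      (hρm.comp measurable_prodMk_left).aestronglyMeasurable
      (Eventually.of_forall fun x => hMp p.1 le_rfl x)
  simp only [entE, entF, entG, dTime, dSpace, (hB.hasDerivAt_nonlocalTerm hW hi).deriv]

theorem isEntropySolution_limit : IsEntropySolution a b f ω ρo ρa ρb ρ := by
  have key := fun {σ : ℝ} (hσ : σ = 1 ∨ σ = -1) k φ (h1 : ContDiff ℝ 1 φ)
    (h2 : HasCompactSupport φ) h3 => entropyFunctional_nonneg hab hf hω ho ha hb hα hN hS hlim hτ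
      hτ1 hR hρm hρb hconv hσ k (φ := φ) ⟨h1, h2⟩ h3
  refine ⟨fun T hT => ?_, fun φ h1 h2 h3 k => ?_, fun φ h1 h2 h3 k => ?_⟩
  · obtain ⟨M, hM⟩ := hρb T
    refine memLp_top_of_bound hρm.aestronglyMeasurable M ?_
    filter_upwards [ae_restrict_mem (measurableSet_Ioo.prod measurableSet_Ioo)] with p hp
    exact hM p.1 hp.1.2.le p.2
  · have := key (Or.inl rfl) k φ h1 h2 h3
    rwa [semi_one, sgnSemi_one] at this
  · have := key (Or.inr rfl) k φ h1 h2 h3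
    rwa [semi_neg_one, sgnSemi_neg_one] at this

end Convergence

end NonlocalIBVP

theorem mainTheorem3
    (a b : ℝ) (hab : a < b)
    (f : ℝ → ℝ → ℝ → ℝ → ℝ) (L C : ℝ) (hf : NonlocalIBVP.FluxAssumption a b L C f)
    (ω : ℝ → ℝ) (hω : NonlocalIBVP.KernelAssumption a b ω)
    (ρo ρa ρb : ℝ → ℝ)
    (hρo : NonlocalIBVP.IsBVDatum ρo (Set.Ioo a b))
    (hρa : NonlocalIBVP.IsBVDatum ρa (Set.Ioi 0))
    (hρb : NonlocalIBVP.IsBVDatum ρb (Set.Ioi 0))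
    (α : ℝ) (hα : 1 ≤ α)
    (N : ℕ → ℕ) (Δt : ℕ → ℝ)
    (hN : ∀ m, 0 < N m) (hΔt : ∀ m, 0 < Δt m)
    (hCFL : ∀ m, NonlocalIBVP.CFL L C α ((b - a) / (N m : ℝ)) (Δt m))
    (hlim : Filter.Tendsto (fun m => (b - a) / (N m : ℝ)) Filter.atTop (nhds 0)) :
    ∃ (ρ : ℝ → ℝ → ℝ) (s : ℕ → ℕ),
      NonlocalIBVP.IsEntropySolution a b f ω ρo ρa ρb ρ ∧
      StrictMono s ∧
      ∀ T : ℝ, 0 < T →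
        Filter.Tendsto
          (fun m => MeasureTheory.eLpNorm
            (fun p : ℝ × ℝ =>
              NonlocalIBVP.approxSolution a b f ω ρo ρa ρb α (N (s m)) (Δt (s m)) p.1 p.2
                - ρ p.1 p.2)
            1 (MeasureTheory.volume.restrict (Set.Ioo 0 T ×ˢ Set.Ioo a b)))
          Filter.atTop (nhds 0) := by
  obtain ⟨vo, Do, Vo, ho⟩ := hρo.exists_rep isOpen_Ioo (nonempty_Ioo.2 hab)
  obtain ⟨va, Da, Va, ha⟩ := hρa.exists_rep isOpen_Ioi nonempty_Ioi
  obtain ⟨vb, Db, Vb, hb⟩ := hρb.exists_rep isOpen_Ioi nonempty_Ioi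
  set D := max Do (max Da Db) with hD
  set V := max (Vo + 2 * D) (max Va Vb) with hV
  have hD0 : 0 ≤ D := ho.D_nonneg.trans (le_max_left _ _)
  have hVo : 0 ≤ Vo := by
    simpa using ho.variation 0 (fun _ => (a + b) / 2) (fun _ _ _ _ _ => le_rfl)
      (fun _ _ => ⟨by linarith, by linarith⟩)
  have hV0 : 0 ≤ V := le_trans (by linarith) (le_max_left _ _)
  obtain ⟨h₀, hh₀, hrow⟩ := NonlocalIBVP.exists_rowBounds hab hf hω hD0 hV0 (hCFL 0).1
  obtain ⟨m₀, hm₀⟩ := eventually_atTop.1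
    (hlim.eventually_le_const (show (0 : ℝ) < min h₀ 1 by positivity))
  have hsch := fun m => NonlocalIBVP.isScheme_scheme (f := f) hab ω ho ha hb
    (show Do ≤ D from le_max_left _ _)
    (show Da ≤ D from (le_max_left _ _).trans (le_max_right _ _))
    (show Db ≤ D from (le_max_right _ _).trans (le_max_right _ _))
    (show Vo + 2 * D ≤ V from le_max_left _ _)
    (show Va ≤ V from (le_max_left _ _).trans (le_max_right _ _))
    (show Vb ≤ V from (le_max_right _ _).trans (le_max_right _ _)) hα (hN m) (hΔt m) (hCFL m)
  have hτh : ∀ m, Δt m ≤ (b - a) / N m := fun m => by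
    have h1 := (hsch m).lam_le
    have h2 := (hsch m).lam_nonneg
    have h3 := (hsch m).h_pos
    have h4 : Δt m / ((b - a) / N m) ≤ 1 := by nlinarith
    rwa [div_le_one h3] at h4
  have hτ : Tendsto Δt atTop (𝓝 0) := squeeze_zero (fun m => (hΔt m).le) hτh hlim
  have hsh : Tendsto (fun m : ℕ => m + m₀) atTop atTop := tendsto_add_atTop_nat m₀
  have hR : ∀ T > 0, ∃ M V' K R₁ : ℝ, 0 ≤ M ∧ 0 ≤ V' ∧ 0 ≤ K ∧ 0 ≤ R₁ ∧
      ∀ m (n : ℕ), n * Δt (m + m₀) ≤ T → NonlocalIBVP.RowBounds ω M V' K R₁ (N (m + m₀))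
        ((b - a) / N (m + m₀)) (Δt (m + m₀))
        (NonlocalIBVP.scheme a b f ω ρo ρa ρb α (N (m + m₀)) (Δt (m + m₀))) n := by
    intro T hT
    obtain ⟨M, V', K, R₁, h1, h2, h3, h4, h5⟩ := hrow T hT
    exact ⟨M, V', K, R₁, h1, h2, h3, h4, fun m n hn => h5 _ _ _ _
      ((hm₀ _ (Nat.le_add_left _ _)).trans (min_le_left _ _)) (hsch _) n hn⟩
  obtain ⟨ρ, s, hs, hρm, hρb', hconv⟩ := NonlocalIBVP.exists_limit hab (fun m => hsch (m + m₀))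
    (hτ.comp hsh) hR
  have hst := hsh.comp hs.tendsto_atTop
  refine ⟨ρ, fun m => s m + m₀, ?_, fun i j hij => Nat.add_lt_add_right (hs hij) m₀, hconv⟩
  refine NonlocalIBVP.isEntropySolution_limit (N := fun m => N (s m + m₀))
    (Δt := fun m => Δt (s m + m₀)) hab hf hω ho ha hb hα (fun m => hN _) (fun m => hsch _)
    (hlim.comp hst) (hτ.comp hst) (fun m => ?_) (fun T hT => ?_) hρm hρb' hconv
  · exact (hτh _).trans ((hm₀ _ (Nat.le_add_left _ _)).trans (min_le_right _ _))
  · obtain ⟨M, V', K, R₁, h1, h2, h3, h4, h5⟩ := hR T hT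
    exact ⟨M, V', K, R₁, h1, h2, h3, h4, fun m n hn => h5 (s m) n hn⟩
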